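/- Let $\Omega=\mathbb R/2\pi\mathbb Z$ and $\alpha>0$. For $u\in L^2(\Omega)$ let $$E(u)=\frac12\int_\Omega (u_x^2-\alpha^2u^2)\,dx-\int_\Omega u\cos x\,dx\quad\text{if }u\in H^1(\Omega),\qquad E(u)=\infty\text{ otherwise.}$$ For every $M>0$, $E$ has a unique minimizer $u_M$ among the functions $u\in L^2(\Omega)$ with $u\ge 0$ and $\int_\Omega u\,dx=M$. (Uniqueness is as an element of $L^2$; below, $u_M$ is the continuous representative.) It has the following properties. 1. $u_M$ is even, nonincreasing on $[0,\pi]$, and strictly decreasing in $|x|\in[0,\pi]$ on its positivity set $\{u_M>0\}$. It is of class $C^{1,1}$. 2. $u_M$ depends continuously on $M>0$ in the following sense: as $M\to M_0>0$, $u_M\to u_{M_0}$ in $C^{1,\beta}(\Omega)$ for every $\beta\in[0,1)$ and $u_M''\to u_{M_0}''$ in $L^p(\Omega)$ for every $p<\infty$, while the Lipschitz constants of $u_M'$ remain bounded for $M$ near $M_0$. 3. If $0<M_1<M_2$, then $u_{M_1}(x)<u_{M_2}(x)$ for every $x$ with $u_{M_1}(x)>0$. 4. If $\alpha<1$ and $M(1-\alpha^2)>2\pi$,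 then $u_M$ is strictly positive and $u_M(x)=\frac{M}{2\pi}+\frac{1}{1-\alpha^2}\cos x$ for all $x\in\Omega$. 5. Otherwise, there is $\tau=\tau(M)>0$ with $\tau\max\{\alpha,1\}\le\pi$, where equality holds if and only if $\alpha<1$ and $M(1-\alpha^2)=2\pi$, such that $u_M$ is positive exactly for $|x|<\tau$ (where $|x|\le\pi$), $u_M'(\pm\tau)=0$, and $$u_M(x)=u^0(x)+A\cos(\alpha x)-u^0(\tau)-A\cos(\alpha\tau)\quad\text{for }|x|<\tau,\qquad u_M(x)=0\quad\text{for }\tau\le|x|\le\pi.$$ Here $u^0(x)=-\frac12x\sin x$ if $\alpha=1$, $u^0(x)=\frac{1}{1-\alpha^2}\cos x$ if $\alpha\neq1$, and $A=\frac{u^0_x(\tau)}{\alpha\sin(\alpha\tau)}$. On the set of all $M>0$ that are not covered by 4, $\tau$ is a $C^\infty$, strictly increasing function of $M$ (when $\alpha<1$, smooth up to the right endpoint $M=2\pi/(1-\alpha^2)$). -/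

import Mathlib

open Real Set Filter Topology MeasureTheory
open scoped ContDiff NNReal ENNReal

namespace ThinFilm

/-- Lebesgue measure on one period. Functions on the circle `ℝ / 2πℤ` are
`2π`-periodic functions on `ℝ`, considered modulo equality almost everywhere
on a period. -/
noncomputable def periodMeasure : Measure ℝ := volume.restrict (Ioc (-π) π)

/-- `v` is a square integrable weak derivative of `u` on the circle; the test functions
are the smooth `2π`-periodic ones. Thus a `2π`-periodic `u` lies in `H¹` of the circle
if and only if some `v` with `HasWeakDeriv u v` exists; this `v` is unique almost
everywhere on the period. -/
def HasWeakDeriv (u v : ℝ → ℝ) : Prop :=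
  MemLp u 2 periodMeasure ∧ MemLp v 2 periodMeasure ∧
    ∀ φ : ℝ → ℝ, ContDiff ℝ ∞ φ → Function.Periodic φ (2 * π) →
      ∫ x in (-π)..π, u x * deriv φ x = -∫ x in (-π)..π, v x * φ x

/-- The energy `½ ∫ (u_x² - α² u²) - ∫ u cos x`, equal to `∞` when `u` is not in `H¹`.
The infimum runs over all versions `v` of the weak derivative `u_x`. They agree
almost everywhere, so all of them give the same value; when there is none, the
infimum is over the empty family, that is, `⊤`. -/
noncomputable def energy (α : ℝ) (u : ℝ → ℝ) : EReal :=
  ⨅ (v : ℝ → ℝ) (_ : HasWeakDeriv u v),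
    (((1 / 2) * (∫ x in (-π)..π, ((v x) ^ 2 - α ^ 2 * (u x) ^ 2))
      - ∫ x in (-π)..π, u x * cos x : ℝ) : EReal)

/-- The nonnegative square integrable functions of mass `M` on the circle. -/
def massClass (M : ℝ) : Set (ℝ → ℝ) :=
  {u | Function.Periodic u (2 * π) ∧ MemLp u 2 periodMeasure ∧
    (∀ᵐ x ∂periodMeasure, 0 ≤ u x) ∧ ∫ x in (-π)..π, u x = M}

/-- `u` minimizes the energy among the nonnegative functions of mass `M`. -/
def IsEnergyMinimizer (α M : ℝ) (u : ℝ → ℝ) : Prop :=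
  u ∈ massClass M ∧ ∀ v ∈ massClass M, energy α u ≤ energy α v

/-- Class `C^{1,1}`: differentiable with Lipschitz continuous derivative. -/
def IsC11 (u : ℝ → ℝ) : Prop :=
  Differentiable ℝ u ∧ ∃ K : ℝ≥0, LipschitzWith K (deriv u)

/-- `u` is symmetric decreasing about `0` on `[-π, π]`, strictly so where it is positive. -/
def IsStrictlySymmetricDecreasing (u : ℝ → ℝ) : Prop :=
  (∀ x, u (-x) = u x) ∧ AntitoneOn u (Icc 0 π) ∧
    ∀ x ∈ Icc 0 π, ∀ y ∈ Icc 0 π, x < y → 0 < u x → u y < u x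

/-- Continuity at `M₀` of a family `u M` of `C^{1,1}` functions, in `C^{1,β}` for every
`β < 1` and in `W^{2,p}` for every `p < ∞`, with `C^{1,1}` seminorms bounded near `M₀`. -/
def IsC11FamilyContinuousAt (u : ℝ → ℝ → ℝ) (M₀ : ℝ) : Prop :=
  (∀ β : ℝ, 0 ≤ β → β < 1 → ∀ ε : ℝ, 0 < ε → ∀ᶠ M in 𝓝 M₀,
      (∀ x, |u M x - u M₀ x| ≤ ε) ∧
      (∀ x, |deriv (u M) x - deriv (u M₀) x| ≤ ε) ∧
      (∀ x y, |(deriv (u M) x - deriv (u M₀) x) - (deriv (u M) y - deriv (u M₀) y)|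
        ≤ ε * |x - y| ^ β)) ∧
  (∀ p : ℝ≥0∞, p ≠ ⊤ → Tendsto
      (fun M => eLpNorm (fun x => deriv (deriv (u M)) x - deriv (deriv (u M₀)) x) p periodMeasure)
      (𝓝 M₀) (𝓝 0)) ∧
  ∃ K : ℝ≥0, ∀ᶠ M in 𝓝 M₀, LipschitzWith K (deriv (u M))

/-- The particular solution `u⁰` of `u'' + α² u + cos x = 0`. -/
noncomputable def particular (α x : ℝ) : ℝ :=
  if α = 1 then -(1 / 2) * x * sin x else 1 / (1 - α ^ 2) * cos x

/-- The coefficient `A = u⁰_x(τ) / (α sin (α τ))`. -/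
noncomputable def coeffA (α τ : ℝ) : ℝ :=
  deriv (particular α) τ / (α * sin (α * τ))

/-- The droplet profile with contact point `τ`, as a formula for `|x| < τ`. -/
noncomputable def dropletProfile (α τ x : ℝ) : ℝ :=
  particular α x + coeffA α τ * cos (α * x)
    - particular α τ - coeffA α τ * cos (α * τ)

/-- The masses for which the minimizer is a droplet. -/
def dropletMasses (α : ℝ) : Set ℝ :=
  {M | 0 < M ∧ ¬ (α < 1 ∧ 2 * π < M * (1 - α ^ 2))}

end ThinFilm

/-! The proof is direct: the minimizers are written down explicitly, and each is compared with an
arbitrary competitor. No compactness and no rearrangement theory is used.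

*The candidates.* On `|x| < τ` the droplet profile solves `u'' + α² u + cos x = l` with
`u(±τ) = u'(±τ) = 0`. Its coefficient `A` increases with `τ`, because `A'(τ)` is a positive
multiple of the Wronskian of `u⁰_x` and `sin (α x)`, whose derivative is `sin x sin (α x) > 0`
(`strictMonoOn_coeffA`). This gives the sign of the slope, the monotonicity of the profiles in `τ`,
and, after integration, that the mass is strictly increasing in `τ` with positive derivative
(`strictMonoOn_dropletMass`, `deriv_dropletMass_pos`). The contact point is the inverse function,
which is smooth by the inverse function theorem; beyond the mass at `τ = π`, if `α < 1`, the
profile is lifted by a constant.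

*Minimality.* Choose `p ≤ π` with `α p < π` and `τ ≤ p`, namely `p = π` if `α < 1` and
`τ < p < π / α` otherwise. If a competitor lives on `[-p, p]` with equal values at the end points,
Wirtinger's inequality on the circle of length `2 p` makes the second variation
`½ ∫ (w'² - α² w²)` coercive on functions of mean zero, while the first variation at the profile is
nonnegative since `cos x ≤ l` outside the droplet. Hence the profile is the strict minimizer.

An arbitrary `v ≥ 0` is reduced to this case by *collapsing* the circle: a weight
`0 ≤ σ ≤ 1` of total mass `2 p` selects the set on which `v` is largest, above a level `t`, and
`y(x) = ∫₀ˣ σ` is a coordinate on a circle of length `2 p`. As a function of `y`, the truncation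
`max v t`, increased by the constant `k` that restores the mass, has no larger energy than `v`:
the kinetic term does not increase, the `L²` norm does not decrease, and neither does the integral
against the cosine, since `cos x ≤ cos y(x)` and by the bathtub principle (`IsSobolev.collapse`).
Since the coordinate degenerates where `σ = 0`, Wirtinger's inequality and the comparison are proved
for weighted derivatives, `f' = σ D` (`weighted_wirtinger`, `IsCriticalProfile.weighted_comparison`).
Wirtinger's inequality is obtained by calibration with `β tan (β (y - m))`, which needs only two
antipodal points at which the function takes the same value. Equality everywhere gives uniqueness
(`IsCriticalProfile.minimality`), and du Bois-Reymond's lemma on the circle transfers the result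
to weak derivatives (`isEnergyMinimizer_of_sobolev`).

*Continuity in the mass.* The second derivatives of the minimizers are locally uniformly bounded in
`M` and converge at every point except the contact points of the limit. By dominated convergence
they converge in `L^p`; integrating the `L¹` convergence gives uniform convergence of the profiles
and slopes, and interpolation with the Lipschitz bound gives the Hölder estimate. -/

namespace ThinFilm

/-! ### Absolutely continuous functions and weighted derivatives -/

theorem integral_of_ae_hasDerivAt {F F' : ℝ → ℝ} {a b : ℝ}
    (hF : AbsolutelyContinuousOnInterval F a b)
    (h : ∀ᵐ x, x ∈ uIcc a b → HasDerivAt F (F' x) x) :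
    IntervalIntegrable F' volume a b ∧ ∫ x in a..b, F' x = F b - F a := by
  have hd : ∀ᵐ x, x ∈ uIoc a b → deriv F x = F' x := by
    filter_upwards [h] with x hx hxm
    exact (hx (uIoc_subset_uIcc hxm)).deriv
  refine ⟨hF.intervalIntegrable_deriv.congr_ae ?_, ?_⟩
  · exact (ae_restrict_iff' measurableSet_uIoc).2 hd
  · rw [← hF.integral_deriv_eq_sub]
    exact (intervalIntegral.integral_congr_ae hd).symm

theorem absolutelyContinuous_primitive {f d : ℝ → ℝ} {a b c : ℝ}
    (hd : IntervalIntegrable d volume a b) (hc : c ∈ uIcc a b)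
    (hf : ∀ x ∈ uIcc a b, f x = f c + ∫ s in c..x, d s) :
    AbsolutelyContinuousOnInterval f a b := by
  have h := hd.absolutelyContinuousOnInterval_intervalIntegral hc
  rw [absolutelyContinuousOnInterval_iff] at h ⊢
  intro ε hε
  obtain ⟨δ, hδ, H⟩ := h ε hε
  refine ⟨δ, hδ, fun E hE hl => ?_⟩
  refine lt_of_le_of_lt (le_of_eq (Finset.sum_congr rfl fun i hi => ?_)) (H E hE hl)
  have := hE.1 i hi
  rw [hf _ this.1, hf _ this.2, dist_add_left]

theorem ae_hasDerivAt_primitive {f d : ℝ → ℝ} {a b c : ℝ}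
    (hd : IntervalIntegrable d volume a b) (hc : c ∈ uIcc a b)
    (hf : ∀ x ∈ uIcc a b, f x = f c + ∫ s in c..x, d s) :
    ∀ᵐ x, x ∈ uIcc a b → HasDerivAt f (d x) x := by
  have h₁ : ∀ᵐ x, x ≠ a := by simp [ae_iff, measure_singleton]
  have h₂ : ∀ᵐ x, x ≠ b := by simp [ae_iff, measure_singleton]
  filter_upwards [hd.ae_hasDerivAt_integral, h₁, h₂] with x hx hxa hxb hxm
  refine ((hx hxm c hc).const_add (f c)).congr_of_eventuallyEq ?_
  have : uIcc a b ∈ 𝓝 x := by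
    rw [uIcc, mem_Icc] at hxm
    refine Icc_mem_nhds (lt_of_le_of_ne hxm.1 ?_) (lt_of_le_of_ne hxm.2 ?_)
    · rcases min_choice a b with h | h <;> rw [h] <;> [exact hxa.symm; exact hxb.symm]
    · rcases max_choice a b with h | h <;> rw [h] <;> [exact hxa; exact hxb]
  filter_upwards [this] with z hz using hf z hz

theorem absolutelyContinuous_comp {Φ y : ℝ → ℝ} {a b : ℝ} {s : Set ℝ} {K : ℝ≥0}
    (hΦ : LipschitzOnWith K Φ s) (hy : AbsolutelyContinuousOnInterval y a b)
    (hs : MapsTo y (uIcc a b) s) : AbsolutelyContinuousOnInterval (fun x => Φ (y x)) a b := by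
  rw [absolutelyContinuousOnInterval_iff] at hy ⊢
  intro ε hε
  obtain ⟨δ, hδ, H⟩ := hy (ε / (K + 1)) (by positivity)
  refine ⟨δ, hδ, fun E hE hl => ?_⟩
  have h1 := H E hE hl
  calc ∑ i ∈ Finset.range E.1, dist (Φ (y (E.2 i).1)) (Φ (y (E.2 i).2))
      ≤ ∑ i ∈ Finset.range E.1, (K : ℝ) * dist (y (E.2 i).1) (y (E.2 i).2) :=
        Finset.sum_le_sum fun i hi =>
          hΦ.dist_le_mul _ (hs (hE.1 i hi).1) _ (hs (hE.1 i hi).2)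
    _ = K * ∑ i ∈ Finset.range E.1, dist (y (E.2 i).1) (y (E.2 i).2) := by rw [Finset.mul_sum]
    _ ≤ (K + 1) * ∑ i ∈ Finset.range E.1, dist (y (E.2 i).1) (y (E.2 i).2) := by
        gcongr
        linarith
    _ < (K + 1) * (ε / (K + 1)) := by gcongr
    _ = ε := by field_simp

/-- On `[a, b]`, `f` is absolutely continuous with derivative `D` relative to the measure
`σ dx`, and `D` is square integrable for this measure. When `y' = σ`, this says that `f` is
an `H¹` function `G ∘ y` of `y`, with `D = G' ∘ y`. -/
structure WeightedDeriv (σ f D : ℝ → ℝ) (a b : ℝ) : Prop where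
  ac : AbsolutelyContinuousOnInterval f a b
  hasDeriv : ∀ᵐ x, x ∈ uIcc a b → HasDerivAt f (σ x * D x) x
  sq : IntervalIntegrable (fun x => σ x * D x ^ 2) volume a b

namespace WeightedDeriv

variable {σ f g D y : ℝ → ℝ} {a b : ℝ}

theorem mono {a' b' : ℝ} (h : WeightedDeriv σ f D a b) (hab : uIcc a' b' ⊆ uIcc a b) :
    WeightedDeriv σ f D a' b' :=
  ⟨h.ac.mono hab, h.hasDeriv.mono fun _ hx hm => hx (hab hm), h.sq.mono_set hab⟩

theorem integrable (h : WeightedDeriv σ f D a b) :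
    IntervalIntegrable (fun x => σ x * D x) volume a b :=
  (integral_of_ae_hasDerivAt h.ac h.hasDeriv).1

theorem integral_eq (h : WeightedDeriv σ f D a b) :
    ∫ x in a..b, σ x * D x = f b - f a :=
  (integral_of_ae_hasDerivAt h.ac h.hasDeriv).2

theorem add_const (h : WeightedDeriv σ f D a b) (c : ℝ) :
    WeightedDeriv σ (fun x => f x + c) D a b := by
  refine ⟨?_, h.hasDeriv.mono fun x hx hm => (hx hm).add_const c, h.sq⟩
  exact h.ac.fun_add (LipschitzWith.const c).lipschitzOnWith.absolutelyContinuousOnInterval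

theorem weight_integrable (h : WeightedDeriv σ y (fun _ => 1) a b) :
    IntervalIntegrable σ volume a b := by simpa using h.integrable

/-- Composition of a smooth function with the coordinate `y` of the weight. -/
theorem comp {Φ Φ' : ℝ → ℝ} {l u : ℝ} (h : WeightedDeriv σ y (fun _ => 1) a b)
    (hy : MapsTo y (uIcc a b) (Icc l u)) (hΦ : ∀ z ∈ Icc l u, HasDerivAt Φ (Φ' z) z)
    (hc : ContinuousOn Φ' (Icc l u)) :
    WeightedDeriv σ (fun x => Φ (y x)) (fun x => Φ' (y x)) a b := by
  obtain ⟨C, hC⟩ := isCompact_Icc.exists_bound_of_continuousOn hc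
  have hL : LipschitzOnWith (Real.toNNReal C) Φ (Icc l u) := by
    refine (convex_Icc l u).lipschitzOnWith_of_nnnorm_hasDerivWithin_le
      (fun z hz => (hΦ z hz).hasDerivWithinAt) fun z hz => ?_
    rw [← NNReal.coe_le_coe, coe_nnnorm]
    exact (hC z hz).trans (Real.le_coe_toNNReal C)
  refine ⟨absolutelyContinuous_comp hL h.ac hy, ?_, ?_⟩
  · filter_upwards [h.hasDeriv] with x hx hm
    exact ((hΦ _ (hy hm)).comp x (hx hm)).congr_deriv (by ring)
  · exact h.weight_integrable.mul_continuousOn ((hc.comp h.ac.continuousOn hy).pow 2)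

/-- The product rule, integrated. -/
theorem integral_mul {f₁ D₁ : ℝ → ℝ} (h : WeightedDeriv σ f D a b)
    (h₁ : WeightedDeriv σ f₁ D₁ a b) :
    IntervalIntegrable (fun x => σ x * (D x * f₁ x + f x * D₁ x)) volume a b ∧
    ∫ x in a..b, σ x * (D x * f₁ x + f x * D₁ x) = f b * f₁ b - f a * f₁ a := by
  refine integral_of_ae_hasDerivAt (h.ac.fun_mul h₁.ac) ?_
  filter_upwards [h.hasDeriv, h₁.hasDeriv] with x hx hx₁ hm
  exact ((hx hm).mul (hx₁ hm)).congr_deriv (by ring)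

end WeightedDeriv

/-! ### A weighted Wirtinger inequality -/

section Wirtinger

variable {σ y f D : ℝ → ℝ} {a b : ℝ}

theorem WeightedDeriv.integrable_mul_sq (hy : WeightedDeriv σ y (fun _ => 1) a b)
    (hf : ContinuousOn f (uIcc a b)) :
    IntervalIntegrable (fun x => σ x * f x ^ 2) volume a b :=
  hy.weight_integrable.mul_continuousOn (hf.pow 2)

/-- Completing the square with the solution `β tan (β (y - m))` of the Riccati equation
`T' = β² + T²`. -/
theorem tan_calibration {β m l u : ℝ} (hab : a ≤ b) (hσ : ∀ x, 0 ≤ σ x)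
    (hy : WeightedDeriv σ y (fun _ => 1) a b) (hf : WeightedDeriv σ f D a b)
    (hyr : MapsTo y (uIcc a b) (Icc l u)) (hβ : 0 < β)
    (hl : -(π / 2) < β * (l - m)) (hu : β * (u - m) < π / 2) :
    β * tan (β * (y a - m)) * f a ^ 2 - β * tan (β * (y b - m)) * f b ^ 2
      ≤ (∫ x in a..b, σ x * D x ^ 2) - β ^ 2 * ∫ x in a..b, σ x * f x ^ 2 := by
  have hcos : ∀ z ∈ Icc l u, cos (β * (z - m)) ≠ 0 := fun z hz =>
    (cos_pos_of_mem_Ioo ⟨by nlinarith [hz.1], by nlinarith [hz.2]⟩).ne'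
  have hT : WeightedDeriv σ (fun x => β * tan (β * (y x - m)))
      (fun x => β ^ 2 * (1 + tan (β * (y x - m)) ^ 2)) a b := by
    refine hy.comp (Φ := fun z => β * tan (β * (z - m)))
      (Φ' := fun z => β ^ 2 * (1 + tan (β * (z - m)) ^ 2)) hyr (fun z hz => ?_) ?_
    · have h1 : HasDerivAt (fun z => β * (z - m)) β z := by
        simpa using ((hasDerivAt_id z).sub_const m).const_mul β
      refine (((hasDerivAt_tan (hcos z hz)).comp z h1).const_mul β).congr_deriv ?_
      have := hcos z hz
      rw [tan_eq_sin_div_cos]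
      field_simp
      linear_combination (-1) * sin_sq_add_cos_sq (β * (z - m))
    · refine continuousOn_const.mul (continuousOn_const.add (ContinuousOn.pow ?_ 2))
      exact fun z hz => ((continuousAt_tan.2 (hcos z hz)).comp
        (f := fun z => β * (z - m)) (by fun_prop)).continuousWithinAt
  obtain ⟨hi, he⟩ := integral_of_ae_hasDerivAt (hT.ac.fun_mul (hf.ac.fun_mul hf.ac))
    (F' := fun x => σ x * (β ^ 2 * (1 + tan (β * (y x - m)) ^ 2) * f x ^ 2
      + β * tan (β * (y x - m)) * (2 * f x * D x))) (by
    filter_upwards [hT.hasDeriv, hf.hasDeriv] with x hx hx₁ hm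
    exact ((hx hm).mul ((hx₁ hm).mul (hx₁ hm))).congr_deriv (by simp only [Pi.mul_apply]; ring))
  have hi2 := (hy.integrable_mul_sq hf.ac.continuousOn).const_mul (β ^ 2)
  have key : 0 ≤ ∫ x in a..b, (σ x * D x ^ 2 - β ^ 2 * (σ x * f x ^ 2)
      + σ x * (β ^ 2 * (1 + tan (β * (y x - m)) ^ 2) * f x ^ 2
      + β * tan (β * (y x - m)) * (2 * f x * D x))) := by
    refine intervalIntegral.integral_nonneg hab fun x _ => ?_
    have := mul_nonneg (hσ x) (sq_nonneg (D x + β * tan (β * (y x - m)) * f x))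
    nlinarith
  rw [intervalIntegral.integral_add (hf.sq.sub hi2) hi, he,
    intervalIntegral.integral_sub hf.sq hi2, intervalIntegral.integral_const_mul] at key
  nlinarith

theorem WeightedDeriv.monotoneOn_coord (hσ : ∀ x, 0 ≤ σ x)
    (hy : WeightedDeriv σ y (fun _ => 1) a b) (hab : a ≤ b) : MonotoneOn y (Icc a b) := by
  intro x hx z hz hxz
  have h := (hy.mono (a' := x) (b' := z) (by
    rw [uIcc_of_le hxz, uIcc_of_le hab]; exact Icc_subset_Icc hx.1 hz.2)).integral_eq
  have : 0 ≤ ∫ s in x..z, σ s * 1 :=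
    intervalIntegral.integral_nonneg hxz fun s _ => by simpa using hσ s
  linarith

/-- A function with a weighted derivative only depends on the coordinate of the weight. -/
theorem WeightedDeriv.eq_of_coord_eq (hσ : ∀ x, 0 ≤ σ x)
    (hy : WeightedDeriv σ y (fun _ => 1) a b) (hf : WeightedDeriv σ f D a b) (hab : a ≤ b)
    {x z : ℝ} (hx : x ∈ Icc a b) (hz : z ∈ Icc a b) (h : y x = y z) : f x = f z := by
  wlog hxz : x ≤ z generalizing x z
  · exact (this hz hx h.symm (le_of_not_ge hxz)).symm
  have hsub : uIcc x z ⊆ uIcc a b := by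
    rw [uIcc_of_le hxz, uIcc_of_le hab]; exact Icc_subset_Icc hx.1 hz.2
  have hy' := hy.mono hsub
  have h0 : ∫ s in x..z, σ s = 0 := by simpa [h] using hy'.integral_eq
  rw [intervalIntegral.integral_eq_zero_iff_of_le_of_nonneg_ae hxz
    (ae_of_all _ hσ) hy'.weight_integrable] at h0
  have h1 : ∫ s in x..z, σ s * D s = 0 := by
    rw [intervalIntegral.integral_of_le hxz]
    refine integral_eq_zero_of_ae ?_
    filter_upwards [h0] with s hs
    simp [hs]
  have := (hf.mono hsub).integral_eq
  linarith

/-- On the circle of length `2 p` obtained by collapsing with the weight `σ`, there are two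
antipodal points with equal values of `f`. -/
theorem exists_antipodal_eq {p : ℝ} (hab : a ≤ b) (hp : 0 < p) (hσ : ∀ x, 0 ≤ σ x)
    (hy : WeightedDeriv σ y (fun _ => 1) a b) (hf : WeightedDeriv σ f D a b)
    (ha : y a = -p) (hb : y b = p) (hfab : f a = f b) :
    ∃ x₀ ∈ Icc a b, ∃ x₁ ∈ Icc a b, x₀ ≤ x₁ ∧ y x₁ = y x₀ + p ∧ f x₀ = f x₁ := by
  have hmono := hy.monotoneOn_coord hσ hab
  have hyc : ContinuousOn y (Icc a b) := by simpa [uIcc_of_le hab] using hy.ac.continuousOn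
  have hfc : ContinuousOn f (Icc a b) := by simpa [uIcc_of_le hab] using hf.ac.continuousOn
  have hmap : ∀ x : Icc a b, y x ∈ Icc (-p) p := fun x =>
    ⟨ha ▸ hmono (left_mem_Icc.2 hab) x.2 x.2.1, hb ▸ hmono x.2 (right_mem_Icc.2 hab) x.2.2⟩
  let Y : Icc a b → Icc (-p) p := fun x => ⟨y x, hmap x⟩
  have hYc : Continuous Y := (continuousOn_iff_continuous_domRestrict.1 hyc).subtype_mk _
  have hYs : Function.Surjective Y := by
    intro z
    obtain ⟨x, hx, hxz⟩ := intermediate_value_Icc hab hyc (by rw [ha, hb]; exact z.2)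
    exact ⟨⟨x, hx⟩, Subtype.ext hxz⟩
  have hq : IsQuotientMap Y := hYc.isClosedMap.isQuotientMap hYc hYs
  let ξ := Function.surjInv hYs
  have hξ : ∀ z, y (ξ z) = z := fun z => congrArg Subtype.val (Function.surjInv_eq hYs z)
  let G : Icc (-p) p → ℝ := fun z => f (ξ z)
  have hG : ∀ x : Icc a b, G (Y x) = f x := fun x =>
    hy.eq_of_coord_eq hσ hf hab (ξ (Y x)).2 x.2 (hξ (Y x))
  have hGc : Continuous G := by
    rw [hq.continuous_iff]
    have : G ∘ Y = (Icc a b).domRestrict f := funext hG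
    rw [this]
    exact continuousOn_iff_continuous_domRestrict.1 hfc
  let H : ℝ → ℝ := fun s => G (projIcc (-p) p (by linarith) (s + p))
    - G (projIcc (-p) p (by linarith) s)
  have hHc : Continuous H := by
    refine (hGc.comp (continuous_projIcc.comp (by fun_prop))).sub
      (hGc.comp continuous_projIcc)
  have hl : (⟨-p, by constructor <;> linarith⟩ : Icc (-p) p) = Y ⟨a, left_mem_Icc.2 hab⟩ :=
    Subtype.ext ha.symm
  have hr : (⟨p, by constructor <;> linarith⟩ : Icc (-p) p) = Y ⟨b, right_mem_Icc.2 hab⟩ :=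
    Subtype.ext hb.symm
  have hGG : G ⟨-p, by constructor <;> linarith⟩ = G ⟨p, by constructor <;> linarith⟩ := by
    rw [hl, hr, hG, hG]; exact hfab
  have hH : H 0 = -H (-p) := by
    simp only [H, zero_add, neg_add_cancel]
    rw [projIcc_of_mem _ (x := p) (by constructor <;> linarith),
      projIcc_of_mem _ (x := -p) (by constructor <;> linarith), hGG]
    ring
  obtain ⟨s, hs, hs0⟩ : ∃ s ∈ Icc (-p) 0, H s = 0 := by
    rcases le_total 0 (H 0) with h | h
    · exact intermediate_value_Icc (by linarith) hHc.continuousOn ⟨by linarith, h⟩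
    · exact intermediate_value_Icc' (by linarith) hHc.continuousOn ⟨h, by linarith⟩
  have hs1 : s ∈ Icc (-p) p := ⟨hs.1, by linarith [hs.2]⟩
  have hs2 : s + p ∈ Icc (-p) p := ⟨by linarith [hs.1], by linarith [hs.2]⟩
  simp only [H, projIcc_of_mem _ hs1, projIcc_of_mem _ hs2] at hs0
  have h0 := hξ ⟨s, hs1⟩
  have h1 := hξ ⟨s + p, hs2⟩
  refine ⟨ξ ⟨s, hs1⟩, (ξ _).2, ξ ⟨s + p, hs2⟩, (ξ _).2, ?_, ?_, ?_⟩
  · by_contra hlt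
    have := hmono (ξ ⟨s + p, hs2⟩).2 (ξ ⟨s, hs1⟩).2 (le_of_not_ge hlt)
    simp only [h0, h1] at this
    linarith
  · simp only [h0, h1]
  · simp only [G] at hs0
    linarith

/-- **Wirtinger's inequality** on a circle of length `2 p`, for functions of mean zero,
written in terms of a weight `σ` of total mass `2 p`. -/
theorem weighted_wirtinger {p : ℝ} (hab : a ≤ b) (hp : 0 < p) (hσ : ∀ x, 0 ≤ σ x)
    (hy : WeightedDeriv σ y (fun _ => 1) a b) (hf : WeightedDeriv σ f D a b)
    (ha : y a = -p) (hb : y b = p) (hfab : f a = f b) (hmean : ∫ x in a..b, σ x * f x = 0) :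
    (π / p) ^ 2 * ∫ x in a..b, σ x * f x ^ 2 ≤ ∫ x in a..b, σ x * D x ^ 2 := by
  obtain ⟨x₀, hx₀, x₁, hx₁, h01, hy01, hf01⟩ := exists_antipodal_eq hab hp hσ hy hf ha hb hfab
  have hmono := hy.monotoneOn_coord hσ hab
  have hfc := hf.ac.continuousOn
  have s1 : uIcc a x₀ ⊆ uIcc a b := by
    rw [uIcc_of_le hab, uIcc_of_le hx₀.1]; exact Icc_subset_Icc_right hx₀.2
  have s2 : uIcc x₀ x₁ ⊆ uIcc a b := by
    rw [uIcc_of_le hab, uIcc_of_le h01]; exact Icc_subset_Icc hx₀.1 hx₁.2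
  have s3 : uIcc x₁ b ⊆ uIcc a b := by
    rw [uIcc_of_le hab, uIcc_of_le hx₁.2]; exact Icc_subset_Icc_left hx₁.1
  have hg := hf.add_const (-f x₀)
  have hy0l : -p ≤ y x₀ := ha ▸ hmono (left_mem_Icc.2 hab) hx₀ hx₀.1
  have hy1r : y x₁ ≤ p := hb ▸ hmono hx₁ (right_mem_Icc.2 hab) hx₁.2
  have hi0 : IntervalIntegrable (fun x => σ x * (f x + -f x₀) ^ 2) volume a b :=
    hy.integrable_mul_sq hg.ac.continuousOn
  have main : ∀ β, 0 < β → β < π / p →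
      β ^ 2 * ∫ x in a..b, σ x * (f x + -f x₀) ^ 2 ≤ ∫ x in a..b, σ x * D x ^ 2 := by
    intro β hβ hβp
    have hβp' : β * p < π := (lt_div_iff₀ hp).1 hβp
    have c1 := tan_calibration (m := y x₀ - p / 2) hx₀.1 hσ (hy.mono s1) (hg.mono s1)
      (l := -p) (u := y x₀) (fun x hx => by
        rw [uIcc_of_le hx₀.1] at hx
        exact ⟨ha ▸ hmono (left_mem_Icc.2 hab) ⟨hx.1, hx.2.trans hx₀.2⟩ hx.1,
          hmono ⟨hx.1, hx.2.trans hx₀.2⟩ hx₀ hx.2⟩) hβ (by nlinarith) (by nlinarith)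
    have c2 := tan_calibration (m := y x₀ + p / 2) h01 hσ (hy.mono s2) (hg.mono s2)
      (l := y x₀) (u := y x₁) (fun x hx => by
        rw [uIcc_of_le h01] at hx
        have hx' : x ∈ Icc a b := ⟨hx₀.1.trans hx.1, hx.2.trans hx₁.2⟩
        exact ⟨hmono hx₀ hx' hx.1, hmono hx' hx₁ hx.2⟩) hβ (by nlinarith) (by nlinarith)
    -- the last piece continues the first one, after a full turn of length `2 p`
    have c3 := tan_calibration (m := y x₁ + p / 2) hx₁.2 hσ (hy.mono s3) (hg.mono s3)
      (l := y x₁) (u := p) (fun x hx => by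
        rw [uIcc_of_le hx₁.2] at hx
        have hx' : x ∈ Icc a b := ⟨hx₁.1.trans hx.1, hx.2⟩
        exact ⟨hmono hx₁ hx' hx.1, hb ▸ hmono hx' (right_mem_Icc.2 hab) hx.2⟩) hβ
      (by nlinarith) (by nlinarith)
    have e : (-p - (y x₀ - p / 2)) = (p - (y x₁ + p / 2)) := by rw [hy01]; ring
    simp only [← hf01, ha, hb, e, ← hfab] at c1 c2 c3
    have t1 := intervalIntegral.integral_add_adjacent_intervals
      (hf.sq.mono_set s1) (hf.sq.mono_set s2)
    have t2 := intervalIntegral.integral_add_adjacent_intervals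
      ((hf.sq.mono_set s1).trans (hf.sq.mono_set s2)) (hf.sq.mono_set s3)
    have t3 := intervalIntegral.integral_add_adjacent_intervals
      (hi0.mono_set s1) (hi0.mono_set s2)
    have t4 := intervalIntegral.integral_add_adjacent_intervals
      ((hi0.mono_set s1).trans (hi0.mono_set s2)) (hi0.mono_set s3)
    rw [← t2, ← t1, ← t4, ← t3]
    nlinarith
  have main' : (π / p) ^ 2 * ∫ x in a..b, σ x * (f x + -f x₀) ^ 2
      ≤ ∫ x in a..b, σ x * D x ^ 2 := by
    have hpp : 0 < π / p := by positivity
    have ht : Tendsto (fun β : ℝ => β ^ 2 * ∫ x in a..b, σ x * (f x + -f x₀) ^ 2)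
        (𝓝[<] (π / p)) (𝓝 ((π / p) ^ 2 * ∫ x in a..b, σ x * (f x + -f x₀) ^ 2)) :=
      (Continuous.tendsto (by fun_prop) _).mono_left nhdsWithin_le_nhds
    refine le_of_tendsto ht ?_
    filter_upwards [Ioo_mem_nhdsLT hpp] with β hβ using main β hβ.1 hβ.2
  refine le_trans (mul_le_mul_of_nonneg_left ?_ (sq_nonneg _)) main'
  have hσi := hy.weight_integrable
  have hfi : IntervalIntegrable (fun x => σ x * f x) volume a b := hσi.mul_continuousOn hfc
  have hfi2 := hy.integrable_mul_sq hfc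
  have : ∫ x in a..b, σ x * (f x + -f x₀) ^ 2
      = (∫ x in a..b, σ x * f x ^ 2) + f x₀ ^ 2 * ∫ x in a..b, σ x := by
    have e : ∀ x, σ x * (f x + -f x₀) ^ 2
        = (σ x * f x ^ 2 + (-2 * f x₀) * (σ x * f x)) + f x₀ ^ 2 * σ x := fun x => by ring
    simp only [e]
    rw [intervalIntegral.integral_add (hfi2.add (hfi.const_mul _)) (hσi.const_mul _),
      intervalIntegral.integral_add hfi2 (hfi.const_mul _),
      intervalIntegral.integral_const_mul, intervalIntegral.integral_const_mul, hmean]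
    ring
  rw [this]
  have : 0 ≤ ∫ x in a..b, σ x := intervalIntegral.integral_nonneg hab fun x _ => hσ x
  nlinarith [mul_nonneg (sq_nonneg (f x₀)) this]

end Wirtinger

/-! ### Comparison with a solution of the Euler-Lagrange equation -/

/-- `u`, with derivative `q`, is a critical profile on `[-p, p]` with contact points `±τ`:
it solves `u'' + α² u + cos x = l` for `|x| ≤ τ`, it vanishes for `τ ≤ |x| ≤ p` (a condition which
is void when `τ = p`), and the Lagrange multiplier `l` satisfies there the inequality that makes
adding mass unfavourable. The function `P` extends the derivative from `[-τ, τ]` by a solution of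
the equation, so that `q = u'` itself may have corners at `±τ`. -/
structure IsCriticalProfile (α p τ l : ℝ) (u q P : ℝ → ℝ) : Prop where
  pos : 0 < τ
  le : τ ≤ p
  hasDeriv : ∀ x, HasDerivAt u (q x) x
  cont : Continuous q
  eq_inside : ∀ x ∈ Icc (-τ) τ, q x = P x
  ode : ∀ x ∈ Icc (-τ) τ, HasDerivAt P (l - α ^ 2 * u x - cos x) x
  left : P (-τ) = 0
  right : P τ = 0
  outside : τ < p → ∀ x, τ ≤ |x| → |x| ≤ p → u x = 0 ∧ q x = 0 ∧ cos x ≤ l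

section Comparison

variable {σ y f D : ℝ → ℝ} {a b : ℝ}

/-- Change of variables `z = y x` for a weight `σ = y'`. -/
theorem WeightedDeriv.integral_comp_coord {F : ℝ → ℝ}
    (hy : WeightedDeriv σ y (fun _ => 1) a b) (hF : Continuous F) :
    ∫ x in a..b, σ x * F (y x) = ∫ z in (y a)..(y b), F z := by
  have hc := hy.ac.continuousOn
  obtain ⟨C, hC⟩ := isCompact_uIcc.exists_bound_of_continuousOn hc
  have hd : ∀ z, HasDerivAt (fun z => ∫ s in (y a)..z, F s) (F z) z := fun z =>
    intervalIntegral.integral_hasDerivAt_right (hF.intervalIntegrable _ _)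
      (hF.stronglyMeasurableAtFilter _ _) hF.continuousAt
  have h := (hy.comp (l := -C) (u := C) (Φ := fun z => ∫ s in (y a)..z, F s) (Φ' := F)
    (fun x hx => abs_le.1 (hC x hx)) (fun z _ => hd z) hF.continuousOn).integral_eq
  simpa using h

/-- The energy of a weighted function exceeds that of a critical profile of the same mass by
at least a positive multiple of the squared weighted distance. -/
theorem IsCriticalProfile.weighted_comparison {α p τ l : ℝ} {u q P : ℝ → ℝ}
    (h : IsCriticalProfile α p τ l u q P) (hab : a ≤ b) (hσ : ∀ x, 0 ≤ σ x)
    (hy : WeightedDeriv σ y (fun _ => 1) a b) (hf : WeightedDeriv σ f D a b)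
    (ha : y a = -p) (hb : y b = p) (hfab : f a = f b) (hup : u (-p) = u p)
    (hf0 : ∀ x ∈ Icc a b, 0 ≤ f x)
    (hmass : ∫ x in a..b, σ x * f x = ∫ z in (-p)..p, u z) :
    ((1 / 2) * (∫ z in (-p)..p, ((q z) ^ 2 - α ^ 2 * (u z) ^ 2)) - ∫ z in (-p)..p, u z * cos z)
      + (1 / 2) * ((π / p) ^ 2 - α ^ 2) * ∫ x in a..b, σ x * (f x - u (y x)) ^ 2
    ≤ (1 / 2) * (∫ x in a..b, σ x * D x ^ 2) - α ^ 2 / 2 * (∫ x in a..b, σ x * f x ^ 2)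
      - ∫ x in a..b, σ x * (f x * cos (y x)) := by
  have hp : 0 < p := h.pos.trans_le h.le
  have hmono := hy.monotoneOn_coord hσ hab
  have hyr : MapsTo y (uIcc a b) (Icc (-p) p) := fun x hx => by
    rw [uIcc_of_le hab] at hx
    exact ⟨ha ▸ hmono (left_mem_Icc.2 hab) hx hx.1, hb ▸ hmono hx (right_mem_Icc.2 hab) hx.2⟩
  have huc : Continuous u := continuous_iff_continuousAt.2 fun x => (h.hasDeriv x).continuousAt
  have hu : WeightedDeriv σ (fun x => u (y x)) (fun x => q (y x)) a b :=
    hy.comp hyr (fun z _ => h.hasDeriv z) h.cont.continuousOn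
  have hyc := hy.ac.continuousOn
  have hσi := hy.weight_integrable
  have cu : ContinuousOn (fun x => u (y x)) (uIcc a b) := hu.ac.continuousOn
  have cq : ContinuousOn (fun x => q (y x)) (uIcc a b) := h.cont.comp_continuousOn hyc
  have cc : ContinuousOn (fun x => cos (y x)) (uIcc a b) := continuous_cos.comp_continuousOn hyc
  have cf := hf.ac.continuousOn
  have iDq : IntervalIntegrable (fun x => σ x * D x * q (y x)) volume a b :=
    hf.integrable.mul_continuousOn cq
  have iqq : IntervalIntegrable (fun x => σ x * q (y x) ^ 2) volume a b := hu.sq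
  have hg : WeightedDeriv σ (fun x => f x - u (y x)) (fun x => D x - q (y x)) a b := by
    refine ⟨hf.ac.fun_sub hu.ac, ?_, ?_⟩
    · filter_upwards [hf.hasDeriv, hu.hasDeriv] with x h1 h2 hm
      exact ((h1 hm).sub (h2 hm)).congr_deriv (by ring)
    · refine ((hf.sq.sub (iDq.const_mul 2)).add iqq).congr fun x _ => ?_
      ring
  have cg := hg.ac.continuousOn
  have ig2 := hy.integrable_mul_sq cg
  have ig : IntervalIntegrable (fun x => σ x * (f x - u (y x))) volume a b :=
    hσi.mul_continuousOn cg
  have hmu : ∫ x in a..b, σ x * u (y x) = ∫ z in (-p)..p, u z := by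
    rw [hy.integral_comp_coord huc, ha, hb]
  have hmean : ∫ x in a..b, σ x * (f x - u (y x)) = 0 := by
    have : ∀ x, σ x * (f x - u (y x)) = σ x * f x - σ x * u (y x) := fun x => by ring
    simp only [this]
    rw [intervalIntegral.integral_sub (hσi.mul_continuousOn cf) (hσi.mul_continuousOn cu),
      hmass, hmu, sub_self]
  have hW := weighted_wirtinger hab hp hσ hy hg ha hb (by simp only [ha, hb, hfab, hup]) hmean
  -- `n` is the density of the first variation in the direction `f - u ∘ y`; with the added term
  -- `l (f - u ∘ y)`, of weighted mean zero, its integral over the droplet vanishes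
  set n : ℝ → ℝ := fun x => σ x * (q (y x) * (D x - q (y x))
    + (l - α ^ 2 * u (y x) - cos (y x)) * (f x - u (y x))) with hn
  have iqG : IntervalIntegrable (fun x => σ x * (D x - q (y x)) * q (y x)) volume a b :=
    hg.integrable.mul_continuousOn cq
  have icg : IntervalIntegrable
      (fun x => σ x * ((l - α ^ 2 * u (y x) - cos (y x)) * (f x - u (y x)))) volume a b :=
    hσi.mul_continuousOn (((continuousOn_const.sub (continuousOn_const.mul cu)).sub cc).mul cg)
  have inn : IntervalIntegrable n volume a b :=
    (iqG.add icg).congr fun x _ => by simp only [hn]; ring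
  have hn0 : 0 ≤ ∫ x in a..b, n x := by
    have hcy : ContinuousOn y (Icc a b) := by simpa [uIcc_of_le hab] using hyc
    obtain ⟨xA, hxA, hyA⟩ := intermediate_value_Icc hab hcy
      (show -τ ∈ Icc (y a) (y b) by
        rw [ha, hb]; constructor <;> linarith [h.le, h.pos])
    obtain ⟨xB, hxB, hyB⟩ := intermediate_value_Icc hab hcy
      (show τ ∈ Icc (y a) (y b) by
        rw [ha, hb]; constructor <;> linarith [h.le, h.pos])
    have hAB : xA ≤ xB := by
      by_contra hlt
      have := hmono hxB hxA (le_of_not_ge hlt)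
      linarith [h.pos]
    have s1 : uIcc a xA ⊆ uIcc a b := by
      rw [uIcc_of_le hab, uIcc_of_le hxA.1]; exact Icc_subset_Icc_right hxA.2
    have s2 : uIcc xA xB ⊆ uIcc a b := by
      rw [uIcc_of_le hab, uIcc_of_le hAB]; exact Icc_subset_Icc hxA.1 hxB.2
    have s3 : uIcc xB b ⊆ uIcc a b := by
      rw [uIcc_of_le hab, uIcc_of_le hxB.2]; exact Icc_subset_Icc_left hxB.1
    have hmid : ∫ x in xA..xB, n x = 0 := by
      have hyin : MapsTo y (uIcc xA xB) (Icc (-τ) τ) := fun x hx => by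
        rw [uIcc_of_le hAB] at hx
        have hx' : x ∈ Icc a b := ⟨hxA.1.trans hx.1, hx.2.trans hxB.2⟩
        exact ⟨hyA ▸ hmono hxA hx' hx.1, hyB ▸ hmono hx' hxB hx.2⟩
      have hPy : WeightedDeriv σ (fun x => P (y x))
          (fun x => l - α ^ 2 * u (y x) - cos (y x)) xA xB :=
        (hy.mono s2).comp (Φ := P) (Φ' := fun z => l - α ^ 2 * u z - cos z) hyin h.ode
          (by fun_prop)
      have e := (hPy.integral_mul (hg.mono s2)).2
      simp only [hyA, hyB, h.left, h.right, zero_mul, sub_zero] at e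
      rw [← e]
      refine intervalIntegral.integral_congr fun x hx => ?_
      simp only [hn, h.eq_inside _ (hyin hx)]
      ring
    have hout : ∀ x ∈ Icc a b, τ < p → τ ≤ |y x| → 0 ≤ n x := by
      intro x hx hτp hyx
      obtain ⟨h1, h2, h3⟩ := h.outside hτp (y x) hyx
        (abs_le.2 (hyr (by rwa [uIcc_of_le hab])))
      simp only [hn, h1, h2]
      have := hf0 x hx
      have h4 : 0 ≤ (l - cos (y x)) * f x := mul_nonneg (by linarith) this
      have := mul_nonneg (hσ x) h4
      linarith
    rw [← intervalIntegral.integral_add_adjacent_intervals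
      ((inn.mono_set s1).trans (inn.mono_set s2)) (inn.mono_set s3),
      ← intervalIntegral.integral_add_adjacent_intervals (inn.mono_set s1) (inn.mono_set s2), hmid]
    rcases h.le.eq_or_lt with hτp | hτp
    · have z1 : ∀ c d, c ∈ Icc a b → d ∈ Icc a b → c ≤ d → y c = y d → ∫ x in c..d, n x = 0 := by
        intro c d hc hd hcd hycd
        have s : uIcc c d ⊆ uIcc a b := by
          rw [uIcc_of_le hab, uIcc_of_le hcd]; exact Icc_subset_Icc hc.1 hd.2
        have h0 : ∫ s in c..d, σ s = 0 := by simpa [hycd] using (hy.mono s).integral_eq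
        rw [intervalIntegral.integral_eq_zero_iff_of_le_of_nonneg_ae hcd
          (ae_of_all _ hσ) (hσi.mono_set s)] at h0
        rw [intervalIntegral.integral_of_le hcd]
        refine integral_eq_zero_of_ae ?_
        filter_upwards [h0] with s hs
        simp [hn, hs]
      rw [z1 a xA (left_mem_Icc.2 hab) hxA hxA.1 (by rw [ha, hyA, hτp]),
        z1 xB b hxB (right_mem_Icc.2 hab) hxB.2 (by rw [hb, hyB, hτp])]
      norm_num
    · have p1 : 0 ≤ ∫ x in a..xA, n x := by
        refine intervalIntegral.integral_nonneg hxA.1 fun x hx => ?_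
        have hx' : x ∈ Icc a b := ⟨hx.1, hx.2.trans hxA.2⟩
        refine hout x hx' hτp ?_
        have := hmono hx' hxA hx.2
        rw [abs_of_nonpos] <;> linarith [h.pos]
      have p3 : 0 ≤ ∫ x in xB..b, n x := by
        refine intervalIntegral.integral_nonneg hxB.2 fun x hx => ?_
        have hx' : x ∈ Icc a b := ⟨hxB.1.trans hx.1, hx.2⟩
        refine hout x hx' hτp ?_
        have := hmono hxB hx' hx.1
        rw [abs_of_nonneg] <;> linarith [h.pos]
      linarith
  -- the energy of the profile, written in terms of the weight
  have e1 : ∫ z in (-p)..p, ((q z) ^ 2 - α ^ 2 * (u z) ^ 2)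
      = (∫ x in a..b, σ x * q (y x) ^ 2) - α ^ 2 * ∫ x in a..b, σ x * u (y x) ^ 2 := by
    have := hy.integral_comp_coord (F := fun z => (q z) ^ 2 - α ^ 2 * (u z) ^ 2)
      ((h.cont.pow 2).sub ((huc.pow 2).const_mul _))
    rw [ha, hb] at this
    rw [← this, ← intervalIntegral.integral_const_mul, ← intervalIntegral.integral_sub iqq
      ((hy.integrable_mul_sq cu).const_mul _)]
    exact intervalIntegral.integral_congr fun x _ => by ring
  have e2 : ∫ z in (-p)..p, u z * cos z = ∫ x in a..b, σ x * (u (y x) * cos (y x)) := by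
    rw [hy.integral_comp_coord (F := fun z => u z * cos z) (huc.mul continuous_cos), ha, hb]
  have iu2 := hy.integrable_mul_sq cu
  have if2 := hy.integrable_mul_sq cf
  have ifc : IntervalIntegrable (fun x => σ x * (f x * cos (y x))) volume a b :=
    hσi.mul_continuousOn (cf.mul cc)
  have iuc : IntervalIntegrable (fun x => σ x * (u (y x) * cos (y x))) volume a b :=
    hσi.mul_continuousOn (cu.mul cc)
  have expand : (∫ x in a..b, n x)
      = (1 / 2) * (∫ x in a..b, σ x * D x ^ 2) - α ^ 2 / 2 * (∫ x in a..b, σ x * f x ^ 2)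
      - (∫ x in a..b, σ x * (f x * cos (y x)))
      - ((1 / 2) * (∫ x in a..b, σ x * q (y x) ^ 2)
        - α ^ 2 / 2 * (∫ x in a..b, σ x * u (y x) ^ 2)
        - ∫ x in a..b, σ x * (u (y x) * cos (y x)))
      - (1 / 2) * (∫ x in a..b, σ x * (D x - q (y x)) ^ 2)
      + α ^ 2 / 2 * (∫ x in a..b, σ x * (f x - u (y x)) ^ 2)
      + l * ∫ x in a..b, σ x * (f x - u (y x)) := by
    simp only [← intervalIntegral.integral_const_mul]
    rw [← intervalIntegral.integral_sub (hf.sq.const_mul _) (if2.const_mul _),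
      ← intervalIntegral.integral_sub ((hf.sq.const_mul _).sub (if2.const_mul _)) ifc,
      ← intervalIntegral.integral_sub (iqq.const_mul _) (iu2.const_mul _),
      ← intervalIntegral.integral_sub ((iqq.const_mul _).sub (iu2.const_mul _)) iuc,
      ← intervalIntegral.integral_sub
        (((hf.sq.const_mul _).sub (if2.const_mul _)).sub ifc)
        (((iqq.const_mul _).sub (iu2.const_mul _)).sub iuc),
      ← intervalIntegral.integral_sub ((((hf.sq.const_mul _).sub (if2.const_mul _)).sub ifc).sub
        (((iqq.const_mul _).sub (iu2.const_mul _)).sub iuc)) (hg.sq.const_mul _),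
      ← intervalIntegral.integral_add (((((hf.sq.const_mul _).sub (if2.const_mul _)).sub ifc).sub
        (((iqq.const_mul _).sub (iu2.const_mul _)).sub iuc)).sub (hg.sq.const_mul _))
        (ig2.const_mul _),
      ← intervalIntegral.integral_add ((((((hf.sq.const_mul _).sub (if2.const_mul _)).sub ifc).sub
        (((iqq.const_mul _).sub (iu2.const_mul _)).sub iuc)).sub (hg.sq.const_mul _)).add
        (ig2.const_mul _)) (ig.const_mul _)]
    refine intervalIntegral.integral_congr fun x _ => ?_
    simp only [hn]
    ring
  rw [hmean] at expand
  rw [e1, e2]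
  nlinarith

end Comparison

/-! ### Collapsing a function to its highest part -/

/-- A bathtub weight: `σ` selects a set of measure `2 p` in a period on which `v` is largest. On
the critical level set `{v = t}` it may take any value in `[0, 1]`. The whole period, `p = π`, is
selected with weight `1`. -/
structure IsBathtubWeight (v : ℝ → ℝ) (p t : ℝ) (σ : ℝ → ℝ) : Prop where
  nonneg : 0 ≤ t
  meas : Measurable σ
  periodic : Function.Periodic σ (2 * π)
  zero_le : ∀ x, 0 ≤ σ x
  le_one : ∀ x, σ x ≤ 1
  of_gt : ∀ x, t < v x → σ x = 1
  of_lt : ∀ x, v x < t → σ x = 0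
  mass : ∫ x in (-π)..π, σ x = 2 * p
  full : p = π → ∀ x, σ x = 1

/-- The level `t` above which `v` occupies a set of measure `2 p`, up to the part of the period on
which `v = t`. -/
theorem exists_level {v : ℝ → ℝ} (hv : Continuous v) (hv0 : ∀ x, 0 ≤ v x) {p : ℝ} (hp : 0 < p)
    (hpπ : p ≤ π) : ∃ t, 0 ≤ t ∧
      (volume.restrict (Ioc (-π) π)).real {x | t < v x} ≤ 2 * p ∧
      2 * p ≤ (volume.restrict (Ioc (-π) π)).real {x | t ≤ v x} := by
  set μ := volume.restrict (Ioc (-π) π) with hμ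
  have hμu : μ.real univ = 2 * π := by
    simp [hμ, measureReal_def, Real.pi_pos.le]
    ring
  set T := {t | 0 ≤ t ∧ μ.real {x | t < v x} ≤ 2 * p} with hT
  obtain ⟨C, hC⟩ := (isCompact_Icc (a := -π) (b := π)).exists_bound_of_continuousOn hv.continuousOn
  have hCT : max C 0 ∈ T := by
    refine ⟨le_max_right _ _, ?_⟩
    have : μ {x | max C 0 < v x} = 0 := by
      rw [hμ, Measure.restrict_apply (measurableSet_lt measurable_const hv.measurable)]
      convert measure_empty (μ := volume)
      ext x
      simp only [mem_inter_iff, mem_ofPred_eq, mem_empty_iff_false, iff_false, not_and]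
      intro h hx
      have := (le_abs_self _).trans (hC x ⟨hx.1.le, hx.2⟩)
      exact absurd h (not_lt.2 (this.trans (le_max_left _ _)))
    simp only [measureReal_def, this]
    simpa using hp.le
  have hbdd : BddBelow T := ⟨0, fun t ht => ht.1⟩
  have ht0 : 0 ≤ sInf T := le_csInf ⟨_, hCT⟩ fun t ht => ht.1
  refine ⟨sInf T, ht0, ?_, ?_⟩
  · have hlim : Tendsto (fun n : ℕ => μ {x | sInf T + 1 / ((n : ℝ) + 1) < v x}) atTop
        (𝓝 (μ (⋃ n : ℕ, {x | sInf T + 1 / ((n : ℝ) + 1) < v x}))) := by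
      refine tendsto_measure_iUnion_atTop fun m n hmn x hx => ?_
      have : 1 / ((n : ℝ) + 1) ≤ 1 / ((m : ℝ) + 1) := Nat.one_div_le_one_div hmn
      simp only [mem_ofPred_eq] at hx ⊢
      linarith
    have hU : (⋃ n : ℕ, {x | sInf T + 1 / ((n : ℝ) + 1) < v x}) = {x | sInf T < v x} := by
      ext x
      simp only [mem_iUnion, mem_ofPred_eq]
      constructor
      · rintro ⟨n, hn⟩
        have : 0 < 1 / ((n : ℝ) + 1) := Nat.one_div_pos_of_nat
        linarith
      · intro h
        obtain ⟨n, hn⟩ := exists_nat_one_div_lt (sub_pos.2 h)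
        exact ⟨n, by linarith⟩
    rw [hU] at hlim
    refine le_of_tendsto ((ENNReal.tendsto_toReal (measure_ne_top μ _)).comp hlim)
      (Eventually.of_forall fun n => ?_)
    have hpos : 0 < 1 / ((n : ℝ) + 1) := Nat.one_div_pos_of_nat
    obtain ⟨s, hs, hsn⟩ := exists_lt_of_csInf_lt ⟨_, hCT⟩ (lt_add_of_pos_right (sInf T) hpos)
    exact (measureReal_mono (fun x hx => hsn.trans hx)).trans hs.2
  · rcases ht0.eq_or_lt with h0 | h0
    · have : {x | sInf T ≤ v x} = univ := eq_univ_of_forall fun x => by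
        simpa [← h0] using hv0 x
      rw [this, hμu]
      linarith
    · have hlim : Tendsto (fun n : ℕ => μ {x | sInf T - sInf T * (1 / ((n : ℝ) + 1)) < v x}) atTop
          (𝓝 (μ (⋂ n : ℕ, {x | sInf T - sInf T * (1 / ((n : ℝ) + 1)) < v x}))) := by
        refine tendsto_measure_iInter_atTop (fun n => (measurableSet_lt measurable_const
          hv.measurable).nullMeasurableSet) (fun m n hmn x hx => ?_) ⟨0, measure_ne_top μ _⟩
        have : 1 / ((n : ℝ) + 1) ≤ 1 / ((m : ℝ) + 1) := Nat.one_div_le_one_div hmn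
        simp only [mem_ofPred_eq] at hx ⊢
        nlinarith
      have hU : (⋂ n : ℕ, {x | sInf T - sInf T * (1 / ((n : ℝ) + 1)) < v x})
          = {x | sInf T ≤ v x} := by
        ext x
        simp only [mem_iInter, mem_ofPred_eq]
        constructor
        · intro h
          by_contra hlt
          obtain ⟨n, hn⟩ := exists_nat_one_div_lt (div_pos (sub_pos.2 (not_le.1 hlt)) h0)
          have h1 := h n
          rw [lt_div_iff₀ h0] at hn
          linarith
        · intro h n
          have : 0 < 1 / ((n : ℝ) + 1) := Nat.one_div_pos_of_nat
          nlinarith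
      rw [hU] at hlim
      refine ge_of_tendsto ((ENNReal.tendsto_toReal (measure_ne_top μ _)).comp hlim)
        (Eventually.of_forall fun n => ?_)
      have h1 : 1 / ((n : ℝ) + 1) ≤ 1 := by
        simpa using Nat.one_div_le_one_div (α := ℝ) (Nat.zero_le n)
      have hpos : 0 < 1 / ((n : ℝ) + 1) := Nat.one_div_pos_of_nat
      have hnot : sInf T - sInf T * (1 / ((n : ℝ) + 1)) ∉ T := fun hmem => by
        have := csInf_le hbdd hmem
        nlinarith
      by_contra hlt
      exact hnot ⟨by nlinarith, (not_le.1 hlt).le⟩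

theorem exists_bathtubWeight {v : ℝ → ℝ} (hv : Continuous v) (hv0 : ∀ x, 0 ≤ v x)
    (hvp : Function.Periodic v (2 * π)) {p : ℝ} (hp : 0 < p) (hpπ : p ≤ π) :
    ∃ t σ, IsBathtubWeight v p t σ := by
  rcases hpπ.eq_or_lt with rfl | hlt
  · refine ⟨0, fun _ => 1, le_rfl, measurable_const, fun _ => rfl, fun _ => zero_le_one,
      fun _ => le_rfl, fun _ _ => rfl, fun x hx => absurd hx (not_lt.2 (hv0 x)), ?_, fun _ _ => rfl⟩
    simp
    ring
  obtain ⟨t, ht0, h1, h2⟩ := exists_level hv hv0 hp hpπ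
  set μ := volume.restrict (Ioc (-π) π) with hμ
  have mgt : MeasurableSet {x | t < v x} := measurableSet_lt measurable_const hv.measurable
  have meq : MeasurableSet {x | v x = t} := measurableSet_eq_fun hv.measurable measurable_const
  have hsplit : μ.real {x | t ≤ v x} = μ.real {x | t < v x} + μ.real {x | v x = t} := by
    rw [← measureReal_union _ meq]
    · congr 1
      ext x
      simp only [mem_ofPred_eq, mem_union]
      rw [le_iff_lt_or_eq, eq_comm]
    · rw [Set.disjoint_left]
      intro x hx hx'
      simp only [mem_ofPred_eq] at hx hx'
      linarith
  obtain ⟨s, hs0, hs1, hs⟩ : ∃ s, 0 ≤ s ∧ s ≤ 1 ∧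
      μ.real {x | t < v x} + s * μ.real {x | v x = t} = 2 * p := by
    rcases (measureReal_nonneg (μ := μ) (s := {x | v x = t})).eq_or_lt with h0 | h0
    · exact ⟨0, le_rfl, zero_le_one, by linarith⟩
    · refine ⟨(2 * p - μ.real {x | t < v x}) / μ.real {x | v x = t},
        div_nonneg (by linarith) h0.le, (div_le_one h0).2 (by linarith), ?_⟩
      field_simp
      ring
  have hσ : ∀ x, (if t < v x then 1 else if v x = t then s else 0)
      = {x | t < v x}.indicator (fun _ => (1 : ℝ)) x + {x | v x = t}.indicator (fun _ => s) x := by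
    intro x
    by_cases h : t < v x
    · simp [h, h.ne']
    · by_cases h' : v x = t <;> simp [indicator, h, h']
  refine ⟨t, fun x => if t < v x then 1 else if v x = t then s else 0, ht0, ?_, ?_, ?_, ?_, ?_, ?_,
    ?_, fun h => absurd h hlt.ne⟩
  · exact Measurable.ite mgt measurable_const (Measurable.ite meq measurable_const measurable_const)
  · intro x
    simp only [hvp x]
  · intro x
    split_ifs <;> linarith
  · intro x
    split_ifs <;> linarith
  · intro x hx
    simp [hx]
  · intro x hx
    simp [hx.ne, not_lt.2 hx.le]
  · rw [intervalIntegral.integral_of_le (by linarith [Real.pi_pos]), ← hμ]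
    simp only [hσ]
    rw [integral_add ((integrable_const _).indicator mgt) ((integrable_const _).indicator meq),
      integral_indicator_const _ mgt, integral_indicator_const _ meq, ← hs]
    simp [mul_comm]

namespace IsBathtubWeight

variable {v σ : ℝ → ℝ} {p t : ℝ}

theorem intervalIntegrable (h : IsBathtubWeight v p t σ) (a b : ℝ) :
    IntervalIntegrable σ volume a b := by
  refine (intervalIntegrable_const (c := (1 : ℝ))).mono_fun h.meas.aestronglyMeasurable
    (ae_of_all _ fun x => ?_)
  simpa [abs_of_nonneg (h.zero_le x)] using h.le_one x

theorem integral_period (h : IsBathtubWeight v p t σ) (a : ℝ) :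
    ∫ x in a..(a + 2 * π), σ x = 2 * p := by
  rw [h.periodic.intervalIntegral_add_eq a (-π), ← h.mass]
  congr 1
  ring

/-- The coordinate on the collapsed circle of length `2 p`. -/
theorem coord (h : IsBathtubWeight v p t σ) (a b : ℝ) :
    WeightedDeriv σ (fun x => ∫ s in (0 : ℝ)..x, σ s) (fun _ => 1) a b := by
  have h1 : ∀ x ∈ uIcc a b, (∫ s in (0 : ℝ)..x, σ s)
      = (∫ s in (0 : ℝ)..a, σ s) + ∫ s in a..x, σ s := fun x _ =>
    (intervalIntegral.integral_add_adjacent_intervals (h.intervalIntegrable _ _)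
      (h.intervalIntegrable _ _)).symm
  refine ⟨absolutelyContinuous_primitive (h.intervalIntegrable a b) left_mem_uIcc h1, ?_, ?_⟩
  · filter_upwards [ae_hasDerivAt_primitive (h.intervalIntegrable a b) left_mem_uIcc h1] with x hx hm
    simpa using hx hm
  · simpa using h.intervalIntegrable a b

theorem coord_sub (h : IsBathtubWeight v p t σ) {x z : ℝ} (hxz : x ≤ z) :
    (0 ≤ (∫ s in (0 : ℝ)..z, σ s) - ∫ s in (0 : ℝ)..x, σ s) ∧
    (∫ s in (0 : ℝ)..z, σ s) - (∫ s in (0 : ℝ)..x, σ s) ≤ z - x := by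
  rw [intervalIntegral.integral_interval_sub_left (h.intervalIntegrable _ _)
    (h.intervalIntegrable _ _)]
  refine ⟨intervalIntegral.integral_nonneg hxz fun s _ => h.zero_le s, ?_⟩
  have := intervalIntegral.integral_mono_on hxz (h.intervalIntegrable x z)
    (intervalIntegrable_const (c := (1 : ℝ))) fun s _ => h.le_one s
  simpa using this

theorem coord_add (h : IsBathtubWeight v p t σ) (x : ℝ) :
    ∫ s in (0 : ℝ)..(x + 2 * π), σ s = (∫ s in (0 : ℝ)..x, σ s) + 2 * p := by
  rw [← h.integral_period x, intervalIntegral.integral_add_adjacent_intervals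
    (h.intervalIntegrable _ _) (h.intervalIntegrable _ _)]

/-- There is a point opposite to `0` on the collapsed circle; the circle is cut open there. -/
theorem exists_cut (h : IsBathtubWeight v p t σ) (hp : 0 < p) :
    ∃ a ∈ Icc (-(2 * π)) 0, ∫ s in (0 : ℝ)..a, σ s = -p := by
  have hc := (h.coord (-(2 * π)) 0).ac.continuousOn
  have hle : -(2 * π) ≤ 0 := by linarith [Real.pi_pos]
  rw [uIcc_of_le hle] at hc
  refine intermediate_value_Icc hle hc ⟨?_, by simpa using hp.le⟩
  have := h.coord_add (-(2 * π))
  simp only [neg_add_cancel, intervalIntegral.integral_same] at this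
  linarith

/-- Collapsing the circle towards `0` does not decrease the cosine. -/
theorem cos_le_cos_coord (h : IsBathtubWeight v p t σ) {a x : ℝ} (ha : a ∈ Icc (-(2 * π)) 0)
    (hya : ∫ s in (0 : ℝ)..a, σ s = -p) (hx : x ∈ Icc a (a + 2 * π)) :
    cos x ≤ cos (∫ s in (0 : ℝ)..x, σ s) := by
  have hyb := h.coord_add a
  rw [hya] at hyb
  have h1 := (h.coord_sub hx.1).1
  have h2 := (h.coord_sub hx.2).1
  have h0 : ∫ s in (0 : ℝ)..0, σ s = 0 := intervalIntegral.integral_same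
  have h2π := h.coord_add 0
  have h2π' := h.coord_add (-(2 * π))
  rw [neg_add_cancel, h0] at h2π'
  rw [zero_add, h0] at h2π
  set Y := ∫ s in (0 : ℝ)..x, σ s with hY
  have hmain : ∀ r, |Y| ≤ r → r ≤ π → cos r ≤ cos Y := fun r hr hrπ => by
    rw [← cos_abs Y]
    exact cos_le_cos_of_nonneg_of_le_pi (abs_nonneg _) hrπ hr
  rcases le_total 0 x with hx0 | hx0
  · have h3 := h.coord_sub hx0
    rw [h0] at h3
    rcases le_total x π with hxπ | hxπ
    · exact hmain x (by rw [abs_of_nonneg] <;> linarith) hxπ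
    · have h4 := (h.coord_sub (x := x) (z := 2 * π) (by linarith [hx.2, ha.2])).2
      rw [← cos_neg x, ← cos_add_two_pi (-x)]
      exact hmain _ (by rw [abs_of_nonneg] <;> linarith) (by linarith)
  · have h3 := h.coord_sub hx0
    rw [h0] at h3
    rcases le_total (-π) x with hxπ | hxπ
    · rw [← cos_neg x]
      exact hmain (-x) (by rw [abs_of_nonpos] <;> linarith) (by linarith)
    · have h4 := (h.coord_sub (x := -(2 * π)) (z := x) (by linarith [hx.1, ha.1])).2
      rw [← cos_add_two_pi x]
      exact hmain _ (by rw [abs_of_nonpos] <;> linarith) (by linarith)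

end IsBathtubWeight

/-- Truncation from below: the weighted derivative of `max v t + k`. -/
theorem IsBathtubWeight.truncation {v d σ : ℝ → ℝ} {p t : ℝ} (h : IsBathtubWeight v p t σ)
    {a b : ℝ} (hv : WeightedDeriv (fun _ => 1) v d a b) (k : ℝ) :
    WeightedDeriv σ (fun x => max (v x) t + k) (fun x => {x | t < v x}.indicator d x) a b := by
  suffices WeightedDeriv σ (fun x => max (v x) t) (fun x => {x | t < v x}.indicator d x) a b from
    this.add_const k
  have hac : AbsolutelyContinuousOnInterval (fun x => max (v x) t) a b :=
    absolutelyContinuous_comp (s := univ) (K := 1) (Φ := fun z => max z t)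
      ((LipschitzWith.id.max_const t).lipschitzOnWith) hv.ac (mapsTo_univ _ _)
  have hsq : IntervalIntegrable (fun x => d x ^ 2) volume a b := by simpa using hv.sq
  have hdint : IntervalIntegrable d volume a b := by simpa using hv.integrable
  have h₁ : ∀ᵐ x, x ≠ a := by simp [ae_iff, measure_singleton]
  have h₂ : ∀ᵐ x, x ≠ b := by simp [ae_iff, measure_singleton]
  have hder : ∀ᵐ x, x ∈ uIcc a b →
      HasDerivAt (fun x => max (v x) t) (σ x * {x | t < v x}.indicator d x) x := by
    filter_upwards [hv.hasDeriv, hac.ae_differentiableAt] with x hx hdx hm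
    have hvx : HasDerivAt v (d x) x := by simpa using hx hm
    rcases lt_trichotomy (v x) t with hlt | heq | hgt
    · have : (fun x => max (v x) t) =ᶠ[𝓝 x] fun _ => t := by
        filter_upwards [hvx.continuousAt.eventually_lt continuousAt_const hlt] with z hz
        exact max_eq_right hz.le
      rw [h.of_lt x hlt, zero_mul]
      exact (hasDerivAt_const x t).congr_of_eventuallyEq this
    · have hmin : IsLocalMin (fun x => max (v x) t) x :=
        Eventually.of_forall fun z => by simp [heq]
      have := (hdx hm).hasDerivAt
      rw [hmin.deriv_eq_zero] at this
      simpa [heq] using this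
    · have : (fun x => max (v x) t) =ᶠ[𝓝 x] v := by
        filter_upwards [continuousAt_const.eventually_lt hvx.continuousAt hgt] with z hz
        exact max_eq_left hz.le
      rw [h.of_gt x hgt, one_mul, indicator_of_mem (by exact hgt)]
      exact hvx.congr_of_eventuallyEq this
  refine ⟨hac, hder, ?_⟩
  have hmeas : AEStronglyMeasurable (fun x => σ x * {x | t < v x}.indicator d x ^ 2)
      (volume.restrict (uIoc a b)) := by
    have m1 := (integral_of_ae_hasDerivAt hac hder).1.def'.aestronglyMeasurable
    have m2 := hdint.def'.aestronglyMeasurable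
    refine (m1.mul m2).congr (ae_of_all _ fun x => ?_)
    by_cases hx : t < v x
    · simp [h.of_gt x hx, indicator, hx, sq]
    · simp [indicator, hx]
  refine hsq.mono_fun hmeas (ae_of_all _ fun x => ?_)
  by_cases hx : t < v x
  · simp [h.of_gt x hx, indicator, hx]
  · simp [indicator, hx, sq_nonneg]

/-! ### The energy of a collapsed function -/

theorem mul_cos_lt_sin {x : ℝ} (hx : 0 < x) (hxπ : x ≤ π) : x * cos x < sin x := by
  rcases lt_trichotomy x (π / 2) with h | h | h
  · have hc : 0 < cos x := cos_pos_of_mem_Ioo ⟨by linarith, h⟩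
    have := lt_tan hx h
    rwa [tan_eq_sin_div_cos, lt_div_iff₀ hc] at this
  · rw [h, cos_pi_div_two, mul_zero, sin_pi_div_two]
    exact one_pos
  · have : cos x < 0 := cos_neg_of_pi_div_two_lt_of_lt h (by linarith)
    nlinarith [sin_nonneg_of_nonneg_of_le_pi hx.le hxπ]

/-- The bathtub principle for `cos`: with total mass `2 p (t + k)` and height at most `t`, the
integral against `cos` is at most that of the constant `t + k` on `[-p, p]`. The part `k` that does
not fit below the height bound is controlled by `p cos p < sin p`. -/
theorem integral_mul_cos_le {b : ℝ → ℝ} (hb : Continuous b) (hb0 : ∀ x, 0 ≤ b x) {p t k : ℝ}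
    (hbt : ∀ x, b x ≤ t) (hp : 0 < p) (hpπ : p ≤ π) (hk : 0 ≤ k)
    (hmass : ∫ x in (-π)..π, b x = 2 * p * (t + k)) :
    ∫ x in (-π)..π, b x * cos x ≤ (t + k) * (2 * sin p) := by
  have hi : ∀ c d, IntervalIntegrable (fun x => b x * (cos x - cos p)) volume c d := fun c d =>
    (hb.mul (continuous_cos.sub continuous_const)).intervalIntegrable c d
  have h1 : ∫ x in (-π)..(-p), b x * (cos x - cos p) ≤ 0 := by
    rw [← neg_nonneg, ← intervalIntegral.integral_neg]
    refine intervalIntegral.integral_nonneg (by linarith) fun x hx => ?_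
    have : cos x ≤ cos p := by
      rw [← cos_neg x]
      exact cos_le_cos_of_nonneg_of_le_pi hp.le (by linarith [hx.1]) (by linarith [hx.2])
    nlinarith [hb0 x]
  have h3 : ∫ x in p..π, b x * (cos x - cos p) ≤ 0 := by
    rw [← neg_nonneg, ← intervalIntegral.integral_neg]
    refine intervalIntegral.integral_nonneg hpπ fun x hx => ?_
    have : cos x ≤ cos p := cos_le_cos_of_nonneg_of_le_pi hp.le hx.2 hx.1
    nlinarith [hb0 x]
  have h2 : ∫ x in (-p)..p, b x * (cos x - cos p) ≤ ∫ x in (-p)..p, t * (cos x - cos p) := by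
    refine intervalIntegral.integral_mono_on (by linarith) (hi _ _)
      ((continuous_const.mul (continuous_cos.sub continuous_const)).intervalIntegrable _ _)
      fun x hx => ?_
    have : cos p ≤ cos x := by
      rw [← cos_abs x]
      exact cos_le_cos_of_nonneg_of_le_pi (abs_nonneg x) hpπ (abs_le.2 hx)
    exact mul_le_mul_of_nonneg_right (hbt x) (by linarith)
  have e2 : ∫ x in (-p)..p, t * (cos x - cos p) = t * (2 * sin p - 2 * p * cos p) := by
    rw [intervalIntegral.integral_const_mul, intervalIntegral.integral_sub
      (continuous_cos.intervalIntegrable _ _) intervalIntegrable_const]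
    simp
    left
    ring
  have e : ∫ x in (-π)..π, b x * (cos x - cos p)
      = (∫ x in (-π)..π, b x * cos x) - cos p * (2 * p * (t + k)) := by
    have i1 : IntervalIntegrable (fun x => b x * cos x) volume (-π) π :=
      (hb.mul continuous_cos).intervalIntegrable _ _
    rw [← hmass, ← intervalIntegral.integral_const_mul, ← intervalIntegral.integral_sub i1
      ((hb.intervalIntegrable _ _).const_mul _)]
    exact intervalIntegral.integral_congr fun x _ => by ring
  rw [← intervalIntegral.integral_add_adjacent_intervals (hi _ (-p)) (hi _ _),
    ← intervalIntegral.integral_add_adjacent_intervals (hi (-p) p) (hi _ _)] at e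
  have hpc := (mul_cos_lt_sin hp hpπ).le
  nlinarith

/-- An `H¹` function on the circle: `2π`-periodic and absolutely continuous, with square
integrable derivative `d`. -/
structure IsSobolev (v d : ℝ → ℝ) : Prop where
  periodic : Function.Periodic v (2 * π)
  periodic_deriv : Function.Periodic d (2 * π)
  cont : Continuous v
  hasDeriv : ∀ a b, WeightedDeriv (fun _ => 1) v d a b

/-- The energy of an `H¹` function `v` with derivative `d`. -/
noncomputable def sobolevEnergy (α : ℝ) (v d : ℝ → ℝ) : ℝ :=
  (1 / 2) * (∫ x in (-π)..π, ((d x) ^ 2 - α ^ 2 * (v x) ^ 2)) - ∫ x in (-π)..π, v x * cos x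

theorem integral_period_eq {F : ℝ → ℝ} (hF : Function.Periodic F (2 * π)) (a : ℝ) :
    ∫ x in a..(a + 2 * π), F x = ∫ x in (-π)..π, F x := by
  rw [hF.intervalIntegral_add_eq a (-π)]
  congr 1
  ring

/-- Collapsing does not increase the energy. The mass outside the selected set is spread as the
constant `k` over the collapsed circle. The last integral on the left is the gain that comes from
moving the selected part of `v` towards `0`. -/
theorem IsSobolev.collapse {v d σ : ℝ → ℝ} {α p t k a : ℝ} (hv : IsSobolev v d)
    (hv0 : ∀ x, 0 ≤ v x) (hp : 0 < p) (hpπ : p ≤ π) (h : IsBathtubWeight v p t σ)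
    (hya : ∫ s in (0 : ℝ)..a, σ s = -p)
    (hk : 2 * p * k = ∫ x in (-π)..π, (1 - σ x) * v x) :
    0 ≤ k ∧
    (∫ x in a..(a + 2 * π), σ x * (max (v x) t + k) = ∫ x in (-π)..π, v x) ∧
    (1 / 2) * (∫ x in a..(a + 2 * π), σ x * ({x | t < v x}.indicator d x) ^ 2)
      - α ^ 2 / 2 * (∫ x in a..(a + 2 * π), σ x * (max (v x) t + k) ^ 2)
      - (∫ x in a..(a + 2 * π), σ x * ((max (v x) t + k) * cos (∫ s in (0 : ℝ)..x, σ s)))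
      + (∫ x in a..(a + 2 * π), max (v x - t) 0 * (cos (∫ s in (0 : ℝ)..x, σ s) - cos x))
    ≤ sobolevEnergy α v d := by
  have hle : a ≤ a + 2 * π := by linarith [Real.pi_pos]
  set y : ℝ → ℝ := fun x => ∫ s in (0 : ℝ)..x, σ s with hy
  have hσi := h.intervalIntegrable
  have hk0 : 0 ≤ k := by
    have : 0 ≤ ∫ x in (-π)..π, (1 - σ x) * v x :=
      intervalIntegral.integral_nonneg (by linarith [Real.pi_pos]) fun x _ =>
        mul_nonneg (by linarith [h.le_one x]) (hv0 x)
    by_contra hlt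
    nlinarith
  have hσa : ∫ x in a..(a + 2 * π), σ x = 2 * p := h.integral_period a
  have hka : ∫ x in a..(a + 2 * π), (1 - σ x) * v x = 2 * p * k := by
    rw [hk, integral_period_eq]
    intro x
    simp only [h.periodic x, hv.periodic x]
  have iv : ∀ c d, IntervalIntegrable v volume c d := hv.cont.intervalIntegrable
  have iσv : ∀ c d, IntervalIntegrable (fun x => σ x * v x) volume c d := fun c d =>
    (hσi c d).mul_continuousOn hv.cont.continuousOn
  have i1σv : ∀ c d, IntervalIntegrable (fun x => (1 - σ x) * v x) volume c d := fun c d =>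
    ((intervalIntegrable_const (c := (1 : ℝ))).sub (hσi c d)).mul_continuousOn hv.cont.continuousOn
  have cmax : Continuous (fun x => max (v x) t + k) :=
    (hv.cont.max continuous_const).add continuous_const
  have hycont : ContinuousOn y (uIcc a (a + 2 * π)) := (h.coord a (a + 2 * π)).ac.continuousOn
  have ccy : ContinuousOn (fun x => cos (y x)) (uIcc a (a + 2 * π)) :=
    continuous_cos.comp_continuousOn hycont
  -- all of these hold because `σ = 1` on `{v > t}`, `σ = 0` on `{v < t}` and, whatever `σ` is,
  -- `max v t = v = t` on the level set between
  have key1 : ∀ x, σ x * (max (v x) t + k) = v x - (1 - σ x) * v x + k * σ x := by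
    intro x
    rcases lt_or_ge (v x) t with hx | hx
    · rw [h.of_lt x hx]; ring
    · rw [max_eq_left hx]; ring
  have key2 : ∀ x, σ x * (max (v x) t + k) = max (v x - t) 0 + (t + k) * σ x := by
    intro x
    rcases lt_trichotomy (v x) t with hx | hx | hx
    · rw [h.of_lt x hx, max_eq_right (sub_nonpos.2 hx.le)]; ring
    · rw [max_eq_left hx.ge, hx, sub_self, max_self]; ring
    · rw [h.of_gt x hx, max_eq_left hx.le, max_eq_left (sub_nonneg.2 hx.le)]; ring
  have key3 : ∀ x, v x ^ 2 ≤ σ x * (max (v x) t + k) ^ 2 - (2 * k * t + k ^ 2) * σ x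
      + t * ((1 - σ x) * v x) := by
    intro x
    rcases lt_trichotomy (v x) t with hx | hx | hx
    · rw [h.of_lt x hx]; nlinarith [hv0 x]
    · rw [max_eq_left hx.ge, hx]; nlinarith
    · rw [h.of_gt x hx, max_eq_left hx.le]; nlinarith
  have key4 : ∀ x, min (v x) t = t * σ x + (1 - σ x) * v x := by
    intro x
    rcases lt_trichotomy (v x) t with hx | hx | hx
    · rw [h.of_lt x hx, min_eq_left hx.le]; ring
    · rw [min_eq_left hx.le, hx]; ring
    · rw [h.of_gt x hx, min_eq_right hx.le]; ring
  refine ⟨hk0, ?_, ?_⟩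
  · simp only [key1]
    rw [intervalIntegral.integral_add ((iv _ _).sub (i1σv _ _)) ((hσi _ _).const_mul _),
      intervalIntegral.integral_sub (iv _ _) (i1σv _ _), intervalIntegral.integral_const_mul,
      hσa, hka, integral_period_eq hv.periodic]
    ring
  -- the kinetic energy on `{v ≤ t}` is lost
  have id2 : IntervalIntegrable (fun x => d x ^ 2) volume a (a + 2 * π) := by
    simpa using (hv.hasDeriv a (a + 2 * π)).sq
  have hkin : ∫ x in a..(a + 2 * π), σ x * ({x | t < v x}.indicator d x) ^ 2
      ≤ ∫ x in a..(a + 2 * π), d x ^ 2 := by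
    refine intervalIntegral.integral_mono_on hle (h.truncation (hv.hasDeriv _ _) k).sq id2
      fun x _ => ?_
    by_cases hx : t < v x
    · simp [h.of_gt x hx, indicator, hx]
    · simp [indicator, hx, sq_nonneg]
  -- in the integral of `key3`, the loss `t ∫ (1 - σ) v = 2 p k t` is at most the gain
  -- `(2 k t + k²) ∫ σ`
  have iσf2 : IntervalIntegrable (fun x => σ x * (max (v x) t + k) ^ 2) volume a (a + 2 * π) :=
    (hσi _ _).mul_continuousOn (cmax.pow 2).continuousOn
  have iv2 : IntervalIntegrable (fun x => v x ^ 2) volume a (a + 2 * π) :=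
    (hv.cont.pow 2).intervalIntegrable _ _
  have hquad : ∫ x in a..(a + 2 * π), v x ^ 2
      ≤ ∫ x in a..(a + 2 * π), σ x * (max (v x) t + k) ^ 2 := by
    have := intervalIntegral.integral_mono_on hle iv2
      ((iσf2.sub ((hσi _ _).const_mul (2 * k * t + k ^ 2))).add ((i1σv _ _).const_mul t))
      fun x _ => key3 x
    rw [intervalIntegral.integral_add (iσf2.sub ((hσi _ _).const_mul _))
      ((i1σv _ _).const_mul t), intervalIntegral.integral_sub iσf2 ((hσi _ _).const_mul _),
      intervalIntegral.integral_const_mul, intervalIntegral.integral_const_mul, hσa, hka] at this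
    have h1 : 0 ≤ p * k * t := mul_nonneg (mul_nonneg hp.le hk0) h.nonneg
    have h2 : 0 ≤ p * k ^ 2 := mul_nonneg hp.le (sq_nonneg k)
    nlinarith
  -- by `key2` the part of `v` above `t` is transported by `y`, while the rest becomes the
  -- constant `t + k` on the collapsed circle
  have iplus : ∀ c d, IntervalIntegrable (fun x => max (v x - t) 0 * cos x) volume c d := fun c d =>
    (((hv.cont.sub continuous_const).max continuous_const).mul
      continuous_cos).intervalIntegrable c d
  have iplusy : IntervalIntegrable (fun x => max (v x - t) 0 * cos (y x)) volume a (a + 2 * π) :=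
    (((hv.cont.sub continuous_const).max continuous_const).continuousOn.mul
      ccy).intervalIntegrable
  have ibc : ∀ c d, IntervalIntegrable (fun x => min (v x) t * cos x) volume c d := fun c d =>
    ((hv.cont.min continuous_const).mul continuous_cos).intervalIntegrable c d
  have hyb : y (a + 2 * π) = p := by
    have := h.coord_add a
    simp only [hy, this, hya]
    ring
  have hlin1 : ∫ x in a..(a + 2 * π), σ x * ((max (v x) t + k) * cos (y x))
      = (∫ x in a..(a + 2 * π), max (v x - t) 0 * cos (y x)) + (t + k) * (2 * sin p) := by
    have e := (h.coord a (a + 2 * π)).integral_comp_coord continuous_cos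
    have hya' : y a = -p := hya
    change ∫ x in a..(a + 2 * π), σ x * cos (y x) = ∫ z in (y a)..(y (a + 2 * π)), cos z at e
    rw [hya', hyb, integral_cos, sin_neg, sub_neg_eq_add, ← two_mul] at e
    rw [← e, ← intervalIntegral.integral_const_mul, ← intervalIntegral.integral_add iplusy
      (((hσi _ _).mul_continuousOn ccy).const_mul _)]
    refine intervalIntegral.integral_congr fun x _ => ?_
    have := key2 x
    linear_combination cos (y x) * this
  have hlin2 : ∫ x in (-π)..π, v x * cos x
      ≤ (∫ x in a..(a + 2 * π), max (v x - t) 0 * cos x) + (t + k) * (2 * sin p) := by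
    have hper : Function.Periodic (fun x => max (v x - t) 0 * cos x) (2 * π) := fun x => by
      simp only [hv.periodic x, cos_add_two_pi]
    have hb := integral_mul_cos_le (hv.cont.min continuous_const) (b := fun x => min (v x) t)
      (fun x => le_min (hv0 x) h.nonneg) (fun x => min_le_right _ _) hp hpπ hk0 (by
        simp only [key4]
        rw [intervalIntegral.integral_add ((hσi _ _).const_mul _) (i1σv _ _),
          intervalIntegral.integral_const_mul, h.mass, ← hk]
        ring)
    rw [integral_period_eq hper]
    refine le_trans (le_of_eq ?_) (add_le_add_right hb _)
    rw [← intervalIntegral.integral_add (iplus _ _) (ibc _ _)]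
    refine intervalIntegral.integral_congr fun x _ => ?_
    rcases le_total (v x) t with hx | hx
    · rw [max_eq_right (sub_nonpos.2 hx), min_eq_left hx]; ring
    · rw [max_eq_left (sub_nonneg.2 hx), min_eq_right hx]; ring
  have hlin3 : ∫ x in a..(a + 2 * π), max (v x - t) 0 * (cos (y x) - cos x)
      = (∫ x in a..(a + 2 * π), max (v x - t) 0 * cos (y x))
        - ∫ x in a..(a + 2 * π), max (v x - t) 0 * cos x := by
    rw [← intervalIntegral.integral_sub iplusy (iplus _ _)]
    exact intervalIntegral.integral_congr fun x _ => by ring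
  have hE : ∫ x in (-π)..π, ((d x) ^ 2 - α ^ 2 * (v x) ^ 2)
      = (∫ x in a..(a + 2 * π), d x ^ 2) - α ^ 2 * ∫ x in a..(a + 2 * π), v x ^ 2 := by
    have hper : Function.Periodic (fun x => (d x) ^ 2 - α ^ 2 * (v x) ^ 2) (2 * π) := fun x => by
      simp only [hv.periodic x, hv.periodic_deriv x]
    rw [← integral_period_eq hper a, intervalIntegral.integral_sub id2
      (iv2.const_mul _), intervalIntegral.integral_const_mul]
  rw [sobolevEnergy, hE, hlin3, hlin1]
  have := mul_le_mul_of_nonneg_left hquad (by positivity : 0 ≤ α ^ 2 / 2)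
  linarith

/-! ### Minimality of critical profiles -/

theorem integral_eq_of_eq_zero_outside {F : ℝ → ℝ} {p : ℝ} (hp : 0 < p) (hpπ : p ≤ π)
    (hF : ∀ c d, IntervalIntegrable F volume c d)
    (h0 : ∀ x, p ≤ |x| → |x| ≤ π → p < π → F x = 0) :
    ∫ x in (-π)..π, F x = ∫ x in (-p)..p, F x := by
  rcases hpπ.eq_or_lt with rfl | hlt
  · rfl
  have h1 : ∫ x in (-π)..(-p), F x = 0 := by
    rw [intervalIntegral.integral_congr (g := fun _ => 0)]
    · simp
    · intro x hx
      rw [uIcc_of_le (by linarith)] at hx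
      exact h0 x (by rw [abs_of_nonpos] <;> linarith [hx.2])
        (by rw [abs_of_nonpos] <;> linarith [hx.1, hx.2]) hlt
  have h3 : ∫ x in p..π, F x = 0 := by
    rw [intervalIntegral.integral_congr (g := fun _ => 0)]
    · simp
    · intro x hx
      rw [uIcc_of_le hpπ] at hx
      exact h0 x (by rw [abs_of_nonneg] <;> linarith [hx.1])
        (by rw [abs_of_nonneg] <;> linarith [hx.1, hx.2]) hlt
  rw [← intervalIntegral.integral_add_adjacent_intervals (hF _ (-p)) (hF _ _),
    ← intervalIntegral.integral_add_adjacent_intervals (hF (-p) p) (hF _ _), h1, h3]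
  ring

/-- A nonnegative integrand with nonpositive integral vanishes almost everywhere. -/
theorem ae_eq_zero_of_integral_nonpos {F : ℝ → ℝ} {a b : ℝ} (hab : a ≤ b)
    (hF : IntervalIntegrable F volume a b) (h0 : ∀ x ∈ Icc a b, 0 ≤ F x)
    (h : ∫ x in a..b, F x ≤ 0) : ∀ᵐ x ∂volume.restrict (Ioc a b), F x = 0 := by
  have h0' : 0 ≤ᵐ[volume.restrict (Ioc a b)] F := by
    refine (ae_restrict_iff' measurableSet_Ioc).2 (ae_of_all _ fun x hx => ?_)
    exact h0 x ⟨hx.1.le, hx.2⟩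
  exact (intervalIntegral.integral_eq_zero_iff_of_le_of_nonneg_ae hab h0' hF).1
    (le_antisymm h (intervalIntegral.integral_nonneg hab h0))

/-- A continuous periodic function vanishing almost everywhere on one period does so
on the standard one. -/
theorem ae_eq_zero_of_periodic {F : ℝ → ℝ} (hF : Continuous F) (hper : Function.Periodic F (2 * π))
    {a : ℝ} (h : ∀ᵐ x ∂volume.restrict (Ioc a (a + 2 * π)), F x = 0) :
    ∀ᵐ x ∂periodMeasure, F x = 0 := by
  have hπ := Real.pi_pos
  have h1 : ∫ x in a..(a + 2 * π), |F x| = 0 := by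
    rw [intervalIntegral.integral_of_le (by linarith)]
    refine integral_eq_zero_of_ae ?_
    filter_upwards [h] with x hx
    simp [hx]
  have hper' : Function.Periodic (fun x => |F x|) (2 * π) := fun x => by simp only [hper x]
  rw [integral_period_eq hper'] at h1
  have := ae_eq_zero_of_integral_nonpos (by linarith) (hF.abs.intervalIntegrable (-π) π)
    (fun x _ => abs_nonneg _) h1.le
  filter_upwards [this] with x hx using abs_eq_zero.1 hx

/-- A critical profile of contact point `τ`, extended by `0` to the circle, is the unique minimizer
of the energy among the nonnegative `H¹` functions of the same mass. -/
theorem IsCriticalProfile.minimality {α p τ l : ℝ} {u q P v d : ℝ → ℝ} (hα : 0 < α)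
    (h : IsCriticalProfile α p τ l u q P) (hpπ : p ≤ π) (hαp : α * p < π)
    (hcase : p = π ∨ τ < p) (hu0 : ∀ x, 0 ≤ u x) (hucos : ∀ x z, cos x = cos z → u x = u z)
    (hout : ∀ x, p ≤ |x| → |x| ≤ π → p < π → u x = 0 ∧ q x = 0)
    (hv : IsSobolev v d) (hv0 : ∀ x, 0 ≤ v x)
    (hmass : ∫ x in (-π)..π, v x = ∫ x in (-π)..π, u x) :
    sobolevEnergy α u q ≤ sobolevEnergy α v d ∧
    (sobolevEnergy α v d ≤ sobolevEnergy α u q → v =ᵐ[periodMeasure] u) := by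
  have hp : 0 < p := h.pos.trans_le h.le
  have hπ := Real.pi_pos
  have huc : Continuous u := continuous_iff_continuousAt.2 fun x => (h.hasDeriv x).continuousAt
  obtain ⟨t, σ, hσ⟩ := exists_bathtubWeight hv.cont hv0 hv.periodic hp hpπ
  obtain ⟨a, ha, hya⟩ := hσ.exists_cut hp
  have hab : a ≤ a + 2 * π := by linarith
  obtain ⟨k, hk⟩ : ∃ k, 2 * p * k = ∫ x in (-π)..π, (1 - σ x) * v x :=
    ⟨(∫ x in (-π)..π, (1 - σ x) * v x) / (2 * p), by field_simp⟩
  obtain ⟨hk0, hfm, hE⟩ := hv.collapse (α := α) hv0 hp hpπ hσ hya hk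
  have hy := hσ.coord a (a + 2 * π)
  have hf := hσ.truncation (hv.hasDeriv a (a + 2 * π)) k
  have hyb := hσ.coord_add a
  rw [hya, show -p + 2 * p = p by ring] at hyb
  have hup : u (-p) = u p := hucos _ _ (cos_neg p)
  have i1 : ∫ z in (-π)..π, u z = ∫ z in (-p)..p, u z :=
    integral_eq_of_eq_zero_outside hp hpπ huc.intervalIntegrable fun x h1 h2 h3 =>
      (hout x h1 h2 h3).1
  have i2 : ∫ z in (-π)..π, ((q z) ^ 2 - α ^ 2 * (u z) ^ 2)
      = ∫ z in (-p)..p, ((q z) ^ 2 - α ^ 2 * (u z) ^ 2) :=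
    integral_eq_of_eq_zero_outside hp hpπ
      ((h.cont.pow 2).sub (continuous_const.mul (huc.pow 2))).intervalIntegrable
      fun x h1 h2 h3 => by rw [(hout x h1 h2 h3).1, (hout x h1 h2 h3).2]; ring
  have i3 : ∫ z in (-π)..π, u z * cos z = ∫ z in (-p)..p, u z * cos z :=
    integral_eq_of_eq_zero_outside hp hpπ (huc.mul continuous_cos).intervalIntegrable
      fun x h1 h2 h3 => by rw [(hout x h1 h2 h3).1, zero_mul]
  have hf0 : ∀ x, 0 ≤ max (v x) t + k := fun x =>
    add_nonneg (le_max_of_le_left (hv0 x)) hk0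
  have hC := h.weighted_comparison hab hσ.zero_le hy hf hya hyb
    (by simp only [hv.periodic a]) hup (fun x _ => hf0 x) (by rw [hfm, hmass, i1])
  rw [← i2, ← i3] at hC
  change sobolevEnergy α u q + _ ≤ _ at hC
  set y : ℝ → ℝ := fun x => ∫ s in (0 : ℝ)..x, σ s with hydef
  have hycos : ∀ x ∈ Icc a (a + 2 * π), cos x ≤ cos (y x) := fun x hx =>
    hσ.cos_le_cos_coord ha hya hx
  have hycont : ContinuousOn y (uIcc a (a + 2 * π)) := hy.ac.continuousOn
  have n1 : ∀ x ∈ Icc a (a + 2 * π), 0 ≤ max (v x - t) 0 * (cos (y x) - cos x) := fun x hx =>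
    mul_nonneg (le_max_right _ _) (by linarith [hycos x hx])
  have n2 : ∀ x ∈ Icc a (a + 2 * π), 0 ≤ σ x * (max (v x) t + k - u (y x)) ^ 2 := fun x _ =>
    mul_nonneg (hσ.zero_le x) (sq_nonneg _)
  have I1 := intervalIntegral.integral_nonneg (μ := volume) hab n1
  have I2 := intervalIntegral.integral_nonneg (μ := volume) hab n2
  have hgap : 0 < (π / p) ^ 2 - α ^ 2 := by
    have : α < π / p := (lt_div_iff₀ hp).2 hαp
    nlinarith
  have I3 := mul_nonneg (by positivity : 0 ≤ 1 / 2 * ((π / p) ^ 2 - α ^ 2)) I2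
  refine ⟨by linarith, fun hle => ?_⟩
  have z1 : ∀ᵐ x ∂volume.restrict (Ioc a (a + 2 * π)),
      max (v x - t) 0 * (cos (y x) - cos x) = 0 := by
    refine ae_eq_zero_of_integral_nonpos hab ?_ n1 (by linarith)
    exact ((((hv.cont.sub continuous_const).max continuous_const).continuousOn).mul
      ((continuous_cos.comp_continuousOn hycont).sub continuous_cos.continuousOn)).intervalIntegrable
  have z2 : ∀ᵐ x ∂volume.restrict (Ioc a (a + 2 * π)),
      σ x * (max (v x) t + k - u (y x)) ^ 2 = 0 := by
    refine ae_eq_zero_of_integral_nonpos hab ?_ n2 (by nlinarith)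
    exact (hσ.intervalIntegrable _ _).mul_continuousOn
      ((hf.ac.continuousOn.sub (huc.comp_continuousOn hycont)).pow 2)
  have huper : Function.Periodic u (2 * π) := fun x => hucos _ _ (cos_add_two_pi x)
  rcases hcase with hpe | hlt
  · -- the weight is identically `1`, the coordinate is the identity
    have hσ1 := hσ.full hpe
    have hyx : ∀ x, y x = x := fun x => by simp [hydef, hσ1]
    have hk' : k = 0 := by
      simp only [hσ1, sub_self, zero_mul, intervalIntegral.integral_zero] at hk
      exact (mul_eq_zero.1 hk).resolve_left (by positivity)
    have hvt : ∀ x, t ≤ v x := fun x => by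
      by_contra hlt
      have := hσ.of_lt x (not_le.1 hlt)
      rw [hσ1] at this
      exact one_ne_zero this
    have : ∀ᵐ x ∂periodMeasure, v x - u x = 0 := by
      refine ae_eq_zero_of_periodic (hv.cont.sub huc) (a := a)
        (fun x => by simp only [hv.periodic x, huper x]) ?_
      filter_upwards [z2] with x hx
      rw [hσ1, one_mul, hk', add_zero, max_eq_left (hvt x), hyx] at hx
      exact pow_eq_zero_iff (two_ne_zero) |>.1 hx
    filter_upwards [this] with x hx using sub_eq_zero.1 hx
  · -- the profile vanishes on a part of the collapsed circle, which forces `t = k = 0`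
    obtain ⟨xB, hxB, hyB⟩ : ∃ xB ∈ Icc a (a + 2 * π), y xB = τ := by
      refine intermediate_value_Icc hab (by rwa [uIcc_of_le hab] at hycont) ?_
      rw [show y a = -p from hya, show y (a + 2 * π) = p from hyb]
      constructor <;> linarith [h.pos]
    -- otherwise `max v t + k > 0 = u ∘ y` beyond `xB`, so that `σ` vanishes there, although it has
    -- mass `p - τ > 0`
    have htk : t + k ≤ 0 := by
      by_contra hpos
      have hσ0 : ∀ᵐ x ∂volume.restrict (Ioc xB (a + 2 * π)), σ x = 0 := by
        filter_upwards [ae_restrict_of_ae_restrict_of_subset (Ioc_subset_Ioc_left hxB.1) z2,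
          ae_restrict_mem measurableSet_Ioc] with x hx hm
        rcases mul_eq_zero.1 hx with h0 | h0
        · exact h0
        · have hyx1 := (hσ.coord_sub hm.1.le).1
          have hyx2 := (hσ.coord_sub hm.2).1
          have hux := (h.outside hlt (y x)
            (by rw [abs_of_nonneg] <;> linarith [h.pos])
            (by rw [abs_of_nonneg] <;> linarith [h.pos])).1
          rw [hux, sub_zero] at h0
          have h0' := (pow_eq_zero_iff (two_ne_zero)).1 h0
          have := le_max_right (v x) t
          linarith
      have e : ∫ x in xB..(a + 2 * π), σ x = 0 := by
        rw [intervalIntegral.integral_of_le hxB.2]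
        exact integral_eq_zero_of_ae hσ0
      have e2 := intervalIntegral.integral_interval_sub_left (hσ.intervalIntegrable 0 (a + 2 * π))
        (hσ.intervalIntegrable 0 xB)
      change y (a + 2 * π) - y xB = _ at e2
      rw [e, hyB, show y (a + 2 * π) = p from hyb] at e2
      linarith
    have ht : t = 0 := le_antisymm (by linarith) hσ.nonneg
    have hk' : k = 0 := le_antisymm (by linarith [hσ.nonneg]) hk0
    subst ht
    -- where `v > 0`, equality in the collapse gives `cos (y x) = cos x`, hence `v x = u (y x) = u x`
    have z3 : ∀ᵐ x ∂volume.restrict (Ioc a (a + 2 * π)), max (v x - u x) 0 = 0 := by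
      filter_upwards [z1, z2, ae_restrict_mem measurableSet_Ioc] with x h1 h2 hm
      refine max_eq_right ?_
      rcases (hv0 x).eq_or_lt with hvx | hvx
      · rw [← hvx]; linarith [hu0 x]
      · rw [sub_zero, max_eq_left hvx.le] at h1
        have hc : cos (y x) = cos x := sub_eq_zero.1 ((mul_eq_zero.1 h1).resolve_left hvx.ne')
        rw [hσ.of_gt x hvx, one_mul, hk', add_zero, max_eq_left hvx.le, hucos _ _ hc] at h2
        linarith [(pow_eq_zero_iff (two_ne_zero)).1 h2]
    have z4 : ∀ᵐ x ∂periodMeasure, max (v x - u x) 0 = 0 :=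
      ae_eq_zero_of_periodic ((hv.cont.sub huc).max continuous_const)
        (fun x => by simp only [hv.periodic x, huper x]) z3
    have hvu : v ≤ᵐ[periodMeasure] u := by
      filter_upwards [z4] with x hx
      have := le_max_left (v x - u x) 0
      linarith
    have hle' : -π ≤ π := by linarith
    have h0 : 0 ≤ᵐ[volume.restrict (Ioc (-π) π)] fun x => u x - v x := by
      filter_upwards [hvu] with x hx using sub_nonneg.2 hx
    have hz := (intervalIntegral.integral_eq_zero_iff_of_le_of_nonneg_ae hle' h0
      ((huc.sub hv.cont).intervalIntegrable _ _)).1 (by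
        rw [intervalIntegral.integral_sub (huc.intervalIntegrable _ _)
          (hv.cont.intervalIntegrable _ _), hmass, sub_self])
    filter_upwards [hz] with x hx
    have : u x - v x = 0 := hx
    linarith

/-! ### Weak derivatives on the circle -/

/-- The `2π`-periodic extension of the restriction of `f` to `(-π, π]`. -/
noncomputable def periodize (f : ℝ → ℝ) (x : ℝ) : ℝ := f (toIocMod two_pi_pos (-π) x)

theorem periodize_periodic (f : ℝ → ℝ) : Function.Periodic (periodize f) (2 * π) := fun x => by
  simp only [periodize, toIocMod_add_right]

theorem periodize_eq (f : ℝ → ℝ) {x : ℝ} (hx : x ∈ Ioc (-π) π) : periodize f x = f x := by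
  have : toIocMod two_pi_pos (-π) x = x := by
    rw [toIocMod_eq_self]
    exact ⟨hx.1, by linarith [hx.2]⟩
  rw [periodize, this]

theorem contDiff_periodize {f : ℝ → ℝ} (hf : ContDiff ℝ ∞ f)
    (h0 : ∀ x, x ∉ Ioo (-π) π → f x = 0) : ContDiff ℝ ∞ (periodize f) := by
  rw [contDiff_iff_contDiffAt]
  intro x
  set n := toIocDiv two_pi_pos (-π) x with hn
  have hx := sub_toIocDiv_zsmul_mem_Ioc two_pi_pos (-π) x
  rw [← hn, zsmul_eq_mul] at hx
  have heq : periodize f =ᶠ[𝓝 x]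
      fun z => f (z - n * (2 * π)) + f (z - n * (2 * π) - 2 * π) := by
    have hmem : Ioo (-π + n * (2 * π)) (3 * π + n * (2 * π)) ∈ 𝓝 x :=
      Ioo_mem_nhds (by linarith [hx.1]) (by linarith [hx.2, Real.pi_pos])
    filter_upwards [hmem] with z hz
    have e : periodize f z = periodize f (z - n * (2 * π)) :=
      ((periodize_periodic f).sub_int_mul_eq n).symm
    rw [e]
    rcases le_or_gt (z - n * (2 * π)) π with hz' | hz'
    · rw [periodize_eq f ⟨by linarith [hz.1], hz'⟩, h0 (z - n * (2 * π) - 2 * π), add_zero]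
      intro h
      linarith [h.1]
    · rw [h0 (z - n * (2 * π)), zero_add, ← (periodize_periodic f).sub_eq,
        periodize_eq f ⟨by linarith, by linarith [hz.2]⟩]
      intro h
      linarith [h.2]
  refine ContDiffAt.congr_of_eventuallyEq ?_ heq
  exact (hf.contDiffAt.comp x (by fun_prop)).add (hf.contDiffAt.comp x (by fun_prop))

/-- The fundamental lemma of the calculus of variations on the circle. -/
theorem ae_eq_zero_of_integral_mul_periodic {g : ℝ → ℝ}
    (hg : IntervalIntegrable g volume (-π) π)
    (h : ∀ φ : ℝ → ℝ, ContDiff ℝ ∞ φ → Function.Periodic φ (2 * π) →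
      ∫ x in (-π)..π, g x * φ x = 0) : g =ᵐ[periodMeasure] 0 := by
  have hπ := Real.pi_pos
  have hle : -π ≤ π := by linarith
  have hloc : LocallyIntegrableOn g (Ioo (-π) π) volume :=
    (((intervalIntegrable_iff_integrableOn_Ioc_of_le hle).1 hg).mono_set
      Ioo_subset_Ioc_self).locallyIntegrableOn
  have key := isOpen_Ioo.ae_eq_zero_of_integral_contDiff_smul_eq_zero hloc fun ψ hψ _ hsupp => by
    have h0 : ∀ x, x ∉ Ioo (-π) π → ψ x = 0 := fun x hx =>
      image_eq_zero_of_notMem_tsupport fun hm => hx (hsupp hm)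
    have := h _ (contDiff_periodize hψ h0) (periodize_periodic ψ)
    rw [intervalIntegral.integral_of_le hle] at this
    rw [← this, ← setIntegral_eq_integral_of_forall_compl_eq_zero (s := Ioc (-π) π)]
    · refine setIntegral_congr_fun measurableSet_Ioc fun x hx => ?_
      simp only [periodize_eq ψ hx, smul_eq_mul, mul_comm]
    · intro x hx
      rw [h0 x fun hm => hx (Ioo_subset_Ioc_self hm), zero_smul]
  rw [periodMeasure, Filter.EventuallyEq, ae_restrict_iff' measurableSet_Ioc]
  have hne : ∀ᵐ x : ℝ, x ≠ π := by simp [ae_iff, measure_singleton]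
  filter_upwards [key, hne] with x hx hxπ hm
  exact hx ⟨hm.1, lt_of_le_of_ne hm.2 hxπ⟩

theorem _root_.MeasureTheory.MemLp.intervalIntegrable_period {f : ℝ → ℝ}
    (hf : MemLp f 2 periodMeasure) : IntervalIntegrable f volume (-π) π := by
  have : IsFiniteMeasure periodMeasure := by
    rw [periodMeasure]; infer_instance
  rw [intervalIntegrable_iff_integrableOn_Ioc_of_le (by linarith [Real.pi_pos])]
  exact hf.integrable (by norm_num)

theorem _root_.MeasureTheory.MemLp.intervalIntegrable_sq_period {f : ℝ → ℝ}
    (hf : MemLp f 2 periodMeasure) : IntervalIntegrable (fun x => f x ^ 2) volume (-π) π := by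
  rw [intervalIntegrable_iff_integrableOn_Ioc_of_le (by linarith [Real.pi_pos])]
  exact hf.integrable_sq

theorem HasWeakDeriv.unique {u v v' : ℝ → ℝ} (h : HasWeakDeriv u v) (h' : HasWeakDeriv u v') :
    v =ᵐ[periodMeasure] v' := by
  have i := h.2.1.intervalIntegrable_period
  have i' := h'.2.1.intervalIntegrable_period
  have := ae_eq_zero_of_integral_mul_periodic (i.sub i') fun φ hφ hper => by
    have e : ∀ x, (v x - v' x) * φ x = v x * φ x - v' x * φ x := fun x => by ring
    simp only [e]
    rw [intervalIntegral.integral_sub (i.mul_continuousOn hφ.continuous.continuousOn)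
      (i'.mul_continuousOn hφ.continuous.continuousOn)]
    linarith [h.2.2 φ hφ hper, h'.2.2 φ hφ hper]
  filter_upwards [this] with x hx
  exact sub_eq_zero.1 hx

theorem integral_congr_periodMeasure {F G : ℝ → ℝ} (h : F =ᵐ[periodMeasure] G) :
    ∫ x in (-π)..π, F x = ∫ x in (-π)..π, G x := by
  have hle : -π ≤ π := by linarith [Real.pi_pos]
  rw [intervalIntegral.integral_of_le hle, intervalIntegral.integral_of_le hle]
  exact integral_congr_ae h

/-- Integration by parts on the circle. -/
theorem IsSobolev.integral_mul_deriv {w d φ : ℝ → ℝ} (hw : IsSobolev w d)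
    (hφ : ContDiff ℝ ∞ φ) (hper : Function.Periodic φ (2 * π)) :
    ∫ x in (-π)..π, w x * deriv φ x = -∫ x in (-π)..π, d x * φ x := by
  have hwd := hw.hasDeriv (-π) π
  have hφd : ∀ x, HasDerivAt φ (deriv φ x) x := fun x =>
    (hφ.differentiable (by simp)).differentiableAt.hasDerivAt
  have hφc : Continuous (deriv φ) := hφ.continuous_deriv (by simp)
  have hφac : AbsolutelyContinuousOnInterval φ (-π) π :=
    ContDiffOn.absolutelyContinuousOnInterval (hφ.contDiffOn.of_le (by exact_mod_cast le_top))
  obtain ⟨-, he⟩ := integral_of_ae_hasDerivAt (hwd.ac.fun_mul hφac)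
    (F' := fun x => d x * φ x + w x * deriv φ x) (by
      filter_upwards [hwd.hasDeriv] with x hx hm
      exact ((hx hm).mul (hφd x)).congr_deriv (by ring))
  have hdi : IntervalIntegrable d volume (-π) π := by simpa using hwd.integrable
  have hwi : IntervalIntegrable (fun x => w x * deriv φ x) volume (-π) π :=
    (hw.cont.mul hφc).intervalIntegrable _ _
  rw [intervalIntegral.integral_add (hdi.mul_continuousOn hφ.continuous.continuousOn) hwi] at he
  have h1 : w π = w (-π) := by
    rw [← hw.periodic (-π)]; congr 1; ring
  have h2 : φ π = φ (-π) := by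
    rw [← hper (-π)]; congr 1; ring
  rw [h1, h2, sub_self] at he
  linarith

/-- Every function with a weak derivative on the circle agrees almost everywhere with a
continuous primitive of that derivative. -/
theorem HasWeakDeriv.exists_isSobolev {u v : ℝ → ℝ} (h : HasWeakDeriv u v) :
    ∃ w d, IsSobolev w d ∧ u =ᵐ[periodMeasure] w ∧ v =ᵐ[periodMeasure] d := by
  have hπ := Real.pi_pos
  have hle : -π ≤ π := by linarith
  have iu := h.1.intervalIntegrable_period
  have iv := h.2.1.intervalIntegrable_period
  have iv2 := h.2.1.intervalIntegrable_sq_period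
  set d := periodize v with hd
  have hdv : ∀ x ∈ Ioc (-π) π, d x = v x := fun x hx => periodize_eq v hx
  have hdper : Function.Periodic d (2 * π) := periodize_periodic v
  have hend : -π + 2 * π = π := by ring
  have id : ∀ a b, IntervalIntegrable d volume a b := fun a b => by
    refine hdper.intervalIntegrable two_pi_pos.ne' (t := -π) ?_ a b
    rw [hend]
    refine iv.congr fun x hx => ?_
    rw [uIoc_of_le hle] at hx
    exact (hdv x hx).symm
  have id2 : ∀ a b, IntervalIntegrable (fun x => d x ^ 2) volume a b := fun a b => by
    have : Function.Periodic (fun x => d x ^ 2) (2 * π) := fun x => by simp only [hdper x]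
    refine this.intervalIntegrable two_pi_pos.ne' (t := -π) ?_ a b
    rw [hend]
    refine iv2.congr fun x hx => ?_
    rw [uIoc_of_le hle] at hx
    simp only [hdv x hx]
  have hvd : v =ᵐ[periodMeasure] d :=
    (ae_restrict_iff' measurableSet_Ioc).2 (ae_of_all _ fun x hx => (hdv x hx).symm)
  have hd0 : ∫ x in (-π)..π, d x = 0 := by
    rw [← integral_congr_periodMeasure hvd]
    have := h.2.2 (fun _ => 1) contDiff_const fun _ => rfl
    simpa using this
  set W : ℝ → ℝ := fun x => ∫ s in (0 : ℝ)..x, d s with hW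
  have hWc : Continuous W := intervalIntegral.continuous_primitive id 0
  set c : ℝ := ((∫ x in (-π)..π, u x) - ∫ x in (-π)..π, W x) / (2 * π) with hc
  have hprim : ∀ a x, c + W x = (c + W a) + ∫ s in a..x, d s := fun a x => by
    rw [add_assoc, hW]
    simp only
    rw [intervalIntegral.integral_add_adjacent_intervals (id _ _) (id _ _)]
  have hSob : IsSobolev (fun x => c + W x) d := by
    refine ⟨fun x => ?_, hdper, continuous_const.add hWc, fun a b => ⟨?_, ?_, ?_⟩⟩
    · rw [hprim x (x + 2 * π), integral_period_eq hdper, hd0, add_zero]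
    · exact absolutelyContinuous_primitive (id a b) left_mem_uIcc fun x _ => hprim a x
    · simpa using ae_hasDerivAt_primitive (id a b) left_mem_uIcc fun x _ => hprim a x
    · simpa using id2 a b
  refine ⟨_, d, hSob, ?_, hvd⟩
  have iw : IntervalIntegrable (fun x => c + W x) volume (-π) π :=
    hSob.cont.intervalIntegrable _ _
  have hmean : ∫ x in (-π)..π, (u x - (c + W x)) = 0 := by
    rw [intervalIntegral.integral_sub iu iw, intervalIntegral.integral_add
      intervalIntegrable_const (hWc.intervalIntegrable _ _)]
    simp only [intervalIntegral.integral_const, smul_eq_mul, hc]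
    field_simp
    ring
  have hz := ae_eq_zero_of_integral_mul_periodic (iu.sub iw) fun ψ hψ hper => by
    set m : ℝ := (∫ x in (-π)..π, ψ x) / (2 * π) with hm
    have hψi : ∀ a b, IntervalIntegrable ψ volume a b := hψ.continuous.intervalIntegrable
    have hcm : Continuous (fun x => ψ x - m) := hψ.continuous.sub continuous_const
    have hφd : ∀ x, HasDerivAt (fun x => ∫ s in (0 : ℝ)..x, (ψ s - m)) (ψ x - m) x := fun x =>
      intervalIntegral.integral_hasDerivAt_right (hcm.intervalIntegrable _ _)
        (hcm.stronglyMeasurableAtFilter _ _) hcm.continuousAt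
    have hderiv : deriv (fun x => ∫ s in (0 : ℝ)..x, (ψ s - m)) = fun x => ψ x - m :=
      funext fun x => (hφd x).deriv
    have hφ : ContDiff ℝ ∞ (fun x => ∫ s in (0 : ℝ)..x, (ψ s - m)) := by
      rw [contDiff_infty_iff_deriv]
      refine ⟨fun x => (hφd x).differentiableAt, ?_⟩
      rw [hderiv]
      exact hψ.sub contDiff_const
    have hφper : Function.Periodic (fun x => ∫ s in (0 : ℝ)..x, (ψ s - m)) (2 * π) := fun x => by
      have hp' : Function.Periodic (fun s => ψ s - m) (2 * π) := fun s => by simp only [hper s]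
      have h0 := integral_period_eq hp' x
      rw [intervalIntegral.integral_sub (hψi _ _) intervalIntegrable_const] at h0
      have h1 : ∫ x in (-π)..π, (ψ x - m) = 0 := by
        rw [intervalIntegral.integral_sub (hψi _ _) intervalIntegrable_const]
        simp only [intervalIntegral.integral_const, smul_eq_mul, hm]
        field_simp
        ring
      have h2 := integral_period_eq hp' x
      rw [h1] at h2
      simp only
      rw [← intervalIntegral.integral_add_adjacent_intervals (hcm.intervalIntegrable 0 x)
        (hcm.intervalIntegrable _ _), h2, add_zero]
    have e1 := h.2.2 _ hφ hφper
    have e2 := hSob.integral_mul_deriv hφ hφper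
    have e3 : ∫ x in (-π)..π, v x * ∫ s in (0 : ℝ)..x, (ψ s - m)
        = ∫ x in (-π)..π, d x * ∫ s in (0 : ℝ)..x, (ψ s - m) := by
      refine integral_congr_periodMeasure ?_
      filter_upwards [hvd] with x hx
      rw [hx]
    rw [e3, ← e2, hderiv] at e1
    have e4 : ∀ x, (u x - (c + W x)) * ψ x
        = (u x * (ψ x - m) - (c + W x) * (ψ x - m)) + m * (u x - (c + W x)) := fun x => by ring
    simp only [e4]
    rw [intervalIntegral.integral_add ((iu.mul_continuousOn hcm.continuousOn).sub
      (iw.mul_continuousOn hcm.continuousOn)) ((iu.sub iw).const_mul m),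
      intervalIntegral.integral_sub (iu.mul_continuousOn hcm.continuousOn)
      (iw.mul_continuousOn hcm.continuousOn), intervalIntegral.integral_const_mul, hmean, e1]
    ring
  filter_upwards [hz] with x hx
  exact sub_eq_zero.1 hx

theorem IsSobolev.hasWeakDeriv {w d : ℝ → ℝ} (hw : IsSobolev w d) (hd : Continuous d) :
    HasWeakDeriv w d := by
  have hm : ∀ F : ℝ → ℝ, Continuous F → MemLp F 2 periodMeasure := fun F hF => by
    have : IsFiniteMeasure periodMeasure := by
      rw [periodMeasure]; infer_instance
    obtain ⟨C, hC⟩ := (isCompact_Icc (a := -π) (b := π)).exists_bound_of_continuousOn hF.continuousOn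
    refine MemLp.of_bound hF.aestronglyMeasurable C ?_
    exact (ae_restrict_iff' measurableSet_Ioc).2 (ae_of_all _ fun x hx => hC x ⟨hx.1.le, hx.2⟩)
  exact ⟨hm w hw.cont, hm d hd, fun φ hφ hper => hw.integral_mul_deriv hφ hper⟩

/-- Transfer of the minimality among continuous `H¹` functions to the variational problem in
`L²`. -/
theorem isEnergyMinimizer_of_sobolev {α M : ℝ} {u q : ℝ → ℝ} (hu : IsSobolev u q)
    (hq : Continuous q) (hu0 : ∀ x, 0 ≤ u x) (hM : ∫ x in (-π)..π, u x = M)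
    (hmin : ∀ w d, IsSobolev w d → (∀ x, 0 ≤ w x) → ∫ x in (-π)..π, w x = ∫ x in (-π)..π, u x →
      sobolevEnergy α u q ≤ sobolevEnergy α w d ∧
      (sobolevEnergy α w d ≤ sobolevEnergy α u q → w =ᵐ[periodMeasure] u)) :
    IsEnergyMinimizer α M u ∧ ∀ v, IsEnergyMinimizer α M v → v =ᵐ[periodMeasure] u := by
  have hwd := hu.hasWeakDeriv hq
  have hclass : u ∈ massClass M := ⟨hu.periodic, hwd.1, ae_of_all _ hu0, hM⟩
  have hEu : energy α u ≤ (sobolevEnergy α u q : EReal) := iInf₂_le q hwd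
  -- an arbitrary competitor, in terms of its continuous representative
  have hcomp : ∀ v ∈ massClass M, ∀ v', HasWeakDeriv v v' →
      sobolevEnergy α u q ≤ sobolevEnergy α v v' ∧
      (sobolevEnergy α v v' ≤ sobolevEnergy α u q → v =ᵐ[periodMeasure] u) := by
    intro v hv v' hvv'
    obtain ⟨w, d, hw, hvw, hvd⟩ := hvv'.exists_isSobolev
    have hπ := Real.pi_pos
    have hw0 : ∀ x, 0 ≤ w x := by
      have h1 : ∀ᵐ x ∂periodMeasure, min (w x) 0 = 0 := by
        filter_upwards [hv.2.2.1, hvw] with x h0 hx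
        rw [← hx]
        exact min_eq_right h0
      have hmc : Continuous fun x => min (w x) 0 := hw.cont.min continuous_const
      have h2 : ∀ x ∈ Ioo (-π) π, min (w x) 0 = 0 := by
        have : (fun x => min (w x) 0) =ᵐ[volume.restrict (Ioo (-π) π)] fun _ => 0 :=
          ae_restrict_of_ae_restrict_of_subset Ioo_subset_Ioc_self h1
        exact Measure.eqOn_of_ae_eq this hmc.continuousOn continuousOn_const
          (by rw [interior_Ioo]; exact subset_closure)
      have h3 : ∀ x ∈ Icc (-π) π, min (w x) 0 = 0 := by
        have hcl : closure (Ioo (-π) π) = Icc (-π) π := closure_Ioo (by linarith)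
        rw [← hcl]
        exact closure_minimal h2 (isClosed_eq hmc continuous_const)
      intro x
      have hx := toIocMod_mem_Ioc two_pi_pos (-π) x
      have e : w (toIocMod two_pi_pos (-π) x) = w x := by
        rw [toIocMod, zsmul_eq_mul]
        exact hw.periodic.sub_int_mul_eq _
      rw [← e]
      exact min_eq_right_iff.1 (h3 _ ⟨hx.1.le, by linarith [hx.2]⟩)
    have hwM : ∫ x in (-π)..π, w x = ∫ x in (-π)..π, u x := by
      rw [← integral_congr_periodMeasure hvw, hv.2.2.2, hM]
    have hE : sobolevEnergy α v v' = sobolevEnergy α w d := by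
      unfold sobolevEnergy
      congr 1
      · congr 1
        refine integral_congr_periodMeasure ?_
        filter_upwards [hvw, hvd] with x h1 h2
        rw [h1, h2]
      · refine integral_congr_periodMeasure ?_
        filter_upwards [hvw] with x h1
        rw [h1]
    obtain ⟨h1, h2⟩ := hmin w d hw hw0 hwM
    rw [hE]
    exact ⟨h1, fun h => hvw.trans (h2 h)⟩
  have hlow : ∀ v ∈ massClass M, (sobolevEnergy α u q : EReal) ≤ energy α v := fun v hv =>
    le_iInf₂ fun v' hv' => EReal.coe_le_coe_iff.2 (hcomp v hv v' hv').1
  refine ⟨⟨hclass, fun v hv => hEu.trans (hlow v hv)⟩, fun v hv => ?_⟩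
  have hle := (hv.2 u hclass).trans hEu
  by_cases hex : ∃ v', HasWeakDeriv v v'
  · obtain ⟨v', hv'⟩ := hex
    refine (hcomp v hv.1 v' hv').2 ?_
    -- all versions of the weak derivative give the same energy
    have : (sobolevEnergy α v v' : EReal) ≤ energy α v := by
      refine le_iInf₂ fun v'' hv'' => EReal.coe_le_coe_iff.2 (le_of_eq ?_)
      unfold sobolevEnergy
      congr 2
      refine integral_congr_periodMeasure ?_
      filter_upwards [hv'.unique hv''] with x hx
      rw [hx]
    exact EReal.coe_le_coe_iff.1 (this.trans hle)
  · have htop : energy α v = ⊤ := by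
      unfold energy
      simp only [not_exists] at hex
      simp [hex]
    rw [htop, top_le_iff] at hle
    exact absurd hle (EReal.coe_ne_top _)

/-! ### The droplet profiles -/

/-- The derivative of the particular solution. -/
noncomputable def particularDeriv (α x : ℝ) : ℝ :=
  if α = 1 then -(1 / 2) * (sin x + x * cos x) else -(1 / (1 - α ^ 2)) * sin x

section Droplet

variable {α : ℝ}

theorem one_sub_sq_ne_zero (hα : 0 < α) (h : α ≠ 1) : 1 - α ^ 2 ≠ 0 := by
  intro h0
  have : (1 - α) * (1 + α) = 0 := by linear_combination h0
  rcases mul_eq_zero.1 this with h1 | h1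
  · exact h (by linarith)
  · linarith

theorem hasDerivAt_particular (α x : ℝ) :
    HasDerivAt (particular α) (particularDeriv α x) x := by
  unfold particular particularDeriv
  split_ifs with h
  · exact (((hasDerivAt_id x).const_mul (-(1 / 2))).mul (hasDerivAt_sin x)).congr_deriv
      (by simp; ring)
  · exact ((hasDerivAt_cos x).const_mul _).congr_deriv (by ring)

theorem hasDerivAt_particularDeriv (hα : 0 < α) (x : ℝ) :
    HasDerivAt (particularDeriv α) (-cos x - α ^ 2 * particular α x) x := by
  unfold particular particularDeriv
  split_ifs with h
  · exact (((hasDerivAt_sin x).add ((hasDerivAt_id x).mul (hasDerivAt_cos x))).const_mul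
      (-(1 / 2))).congr_deriv (by simp [h]; ring)
  · refine ((hasDerivAt_sin x).const_mul _).congr_deriv ?_
    have := one_sub_sq_ne_zero hα h
    field_simp
    ring

theorem deriv_particular (α : ℝ) : deriv (particular α) = particularDeriv α :=
  funext fun x => (hasDerivAt_particular α x).deriv

theorem particular_neg (α x : ℝ) : particular α (-x) = particular α x := by
  unfold particular
  split_ifs <;> simp

theorem particularDeriv_neg (α x : ℝ) : particularDeriv α (-x) = -particularDeriv α x := by
  unfold particularDeriv
  split_ifs <;> simp
  ring

theorem particularDeriv_zero (α : ℝ) : particularDeriv α 0 = 0 := by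
  unfold particularDeriv
  split_ifs <;> simp

theorem contDiff_particular (α : ℝ) : ContDiff ℝ ∞ (particular α) := by
  unfold particular
  split_ifs <;> fun_prop

theorem contDiff_particularDeriv (α : ℝ) : ContDiff ℝ ∞ (particularDeriv α) := by
  unfold particularDeriv
  split_ifs <;> fun_prop

theorem coeffA_eq (α t : ℝ) : coeffA α t = particularDeriv α t / (α * sin (α * t)) := by
  rw [coeffA, deriv_particular]

/-- The admissible contact points. For `α < 1` this is `(0, π]`, otherwise it is `(0, π / α)`. -/
def contactSet (α : ℝ) : Set ℝ := {t | 0 < t ∧ t ≤ π ∧ α * t < π}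

theorem sin_pos_of_contact (hα : 0 < α) {t : ℝ} (ht : t ∈ contactSet α) : 0 < sin (α * t) :=
  sin_pos_of_pos_of_lt_pi (mul_pos hα ht.1) ht.2.2

/-- The Wronskian of `u⁰_x` and `sin (α x)`. -/
noncomputable def wronskian (α t : ℝ) : ℝ :=
  (-cos t - α ^ 2 * particular α t) * sin (α * t) - α * particularDeriv α t * cos (α * t)

theorem hasDerivAt_sin_mul (α x : ℝ) : HasDerivAt (fun x => sin (α * x)) (α * cos (α * x)) x := by
  have h : HasDerivAt (fun x : ℝ => α * x) α x := by simpa using (hasDerivAt_id x).const_mul α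
  exact h.sin.congr_deriv (by ring)

theorem hasDerivAt_cos_mul (α x : ℝ) :
    HasDerivAt (fun x => cos (α * x)) (-(α * sin (α * x))) x := by
  have h : HasDerivAt (fun x : ℝ => α * x) α x := by simpa using (hasDerivAt_id x).const_mul α
  exact h.cos.congr_deriv (by ring)

theorem hasDerivAt_wronskian (hα : 0 < α) (x : ℝ) :
    HasDerivAt (wronskian α) (sin x * sin (α * x)) x := by
  have h1 := ((hasDerivAt_cos x).neg.sub ((hasDerivAt_particular α x).const_mul (α ^ 2))).mul
    (hasDerivAt_sin_mul α x)
  have h2 := ((hasDerivAt_particularDeriv hα x).const_mul α).mul (hasDerivAt_cos_mul α x)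
  exact (h1.sub h2).congr_deriv (by simp; ring)

theorem wronskian_pos (hα : 0 < α) {t : ℝ} (h0 : 0 < t) (hπ : t ≤ π) (hαt : α * t ≤ π) :
    0 < wronskian α t := by
  have hc : ContinuousOn (wronskian α) (Icc 0 t) := fun x _ =>
    (hasDerivAt_wronskian hα x).continuousAt.continuousWithinAt
  have hm : StrictMonoOn (wronskian α) (Icc 0 t) := by
    refine strictMonoOn_of_deriv_pos (convex_Icc 0 t) hc fun x hx => ?_
    rw [interior_Icc] at hx
    rw [(hasDerivAt_wronskian hα x).deriv]
    exact mul_pos (sin_pos_of_pos_of_lt_pi hx.1 (hx.2.trans_le hπ))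
      (sin_pos_of_pos_of_lt_pi (mul_pos hα hx.1) ((mul_lt_mul_of_pos_left hx.2 hα).trans_le hαt))
  have := hm (left_mem_Icc.2 h0.le) (right_mem_Icc.2 h0.le) h0
  simpa [wronskian, particularDeriv_zero] using this

theorem hasDerivAt_coeffA (hα : 0 < α) {t : ℝ} (hs : sin (α * t) ≠ 0) :
    HasDerivAt (coeffA α) (wronskian α t / (α * sin (α * t) ^ 2)) t := by
  have e : coeffA α = fun t => particularDeriv α t / (α * sin (α * t)) := funext (coeffA_eq α)
  rw [e]
  refine ((hasDerivAt_particularDeriv hα t).div ((hasDerivAt_sin_mul α t).const_mul α)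
    (mul_ne_zero hα.ne' hs)).congr_deriv ?_
  unfold wronskian
  field_simp

theorem ordConnected_contactSet (hα : 0 < α) : (contactSet α).OrdConnected :=
  ⟨fun _ hx _ hy _ hz => ⟨hx.1.trans_le hz.1, hz.2.trans hy.2.1,
    (mul_le_mul_of_nonneg_left hz.2 hα.le).trans_lt hy.2.2⟩⟩

/-- The coefficient `A` is strictly increasing, because the Wronskian is positive. -/
theorem strictMonoOn_coeffA (hα : 0 < α) : StrictMonoOn (coeffA α) (contactSet α) := by
  refine strictMonoOn_of_deriv_pos (ordConnected_contactSet hα).convex (fun t ht =>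
    (hasDerivAt_coeffA hα (sin_pos_of_contact hα ht).ne').continuousAt.continuousWithinAt)
    fun t ht => ?_
  have ht := interior_subset ht
  have hs := sin_pos_of_contact hα ht
  rw [(hasDerivAt_coeffA hα hs.ne').deriv]
  exact div_pos (wronskian_pos hα ht.1 ht.2.1 ht.2.2.le) (by positivity)

/-- The derivative of the droplet profile. -/
noncomputable def dropletSlope (α t x : ℝ) : ℝ :=
  particularDeriv α x - coeffA α t * (α * sin (α * x))

theorem hasDerivAt_dropletProfile (α t x : ℝ) :
    HasDerivAt (dropletProfile α t) (dropletSlope α t x) x := by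
  have := (((hasDerivAt_particular α x).add ((hasDerivAt_cos_mul α x).const_mul
    (coeffA α t))).sub_const (particular α t)).sub_const (coeffA α t * cos (α * t))
  exact this.congr_deriv (by unfold dropletSlope; ring)

/-- The Lagrange multiplier of a droplet. -/
noncomputable def dropletMultiplier (α t : ℝ) : ℝ :=
  -(α ^ 2 * (particular α t + coeffA α t * cos (α * t)))

/-- The second derivative of the droplet profile. -/
noncomputable def dropletCurv (α t x : ℝ) : ℝ :=
  -cos x - α ^ 2 * particular α x - coeffA α t * (α ^ 2 * cos (α * x))

theorem dropletCurv_eq (α t x : ℝ) :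
    dropletCurv α t x = dropletMultiplier α t - α ^ 2 * dropletProfile α t x - cos x := by
  unfold dropletCurv dropletMultiplier dropletProfile
  ring

theorem hasDerivAt_dropletSlope (hα : 0 < α) (t x : ℝ) :
    HasDerivAt (dropletSlope α t) (dropletCurv α t x) x := by
  have := (hasDerivAt_particularDeriv hα x).sub
    (((hasDerivAt_sin_mul α x).const_mul α).const_mul (coeffA α t))
  exact this.congr_deriv (by unfold dropletCurv; ring)

theorem dropletSlope_neg (α t x : ℝ) : dropletSlope α t (-x) = -dropletSlope α t x := by
  unfold dropletSlope
  rw [particularDeriv_neg, mul_neg, sin_neg]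
  ring

theorem dropletProfile_neg (α t x : ℝ) : dropletProfile α t (-x) = dropletProfile α t x := by
  unfold dropletProfile
  rw [particular_neg, mul_neg, cos_neg]

theorem dropletProfile_self (α t : ℝ) : dropletProfile α t t = 0 := by
  unfold dropletProfile
  ring

theorem dropletSlope_zero (α t : ℝ) : dropletSlope α t 0 = 0 := by
  simp [dropletSlope, particularDeriv_zero]

theorem coeffA_mul (hα : 0 < α) {t : ℝ} (ht : t ∈ contactSet α) :
    coeffA α t * (α * sin (α * t)) = particularDeriv α t := by
  have := sin_pos_of_contact hα ht
  rw [coeffA_eq]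
  field_simp

theorem dropletSlope_self (hα : 0 < α) {t : ℝ} (ht : t ∈ contactSet α) :
    dropletSlope α t t = 0 := by
  rw [dropletSlope, coeffA_mul hα ht, sub_self]

theorem dropletSlope_neg_of_lt (hα : 0 < α) {t x : ℝ} (ht : t ∈ contactSet α) (hx : 0 < x)
    (hxt : x < t) : dropletSlope α t x < 0 := by
  have hxc : x ∈ contactSet α :=
    ⟨hx, hxt.le.trans ht.2.1, (mul_lt_mul_of_pos_left hxt hα).trans ht.2.2⟩
  have h1 := strictMonoOn_coeffA hα hxc ht hxt
  have h2 := mul_pos hα (sin_pos_of_contact hα hxc)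
  rw [dropletSlope, ← coeffA_mul hα hxc]
  nlinarith

theorem strictAntiOn_dropletProfile (hα : 0 < α) {t : ℝ} (ht : t ∈ contactSet α) :
    StrictAntiOn (dropletProfile α t) (Icc 0 t) := by
  refine strictAntiOn_of_deriv_neg (convex_Icc 0 t) (fun x _ =>
    (hasDerivAt_dropletProfile α t x).continuousAt.continuousWithinAt) fun x hx => ?_
  rw [interior_Icc] at hx
  rw [(hasDerivAt_dropletProfile α t x).deriv]
  exact dropletSlope_neg_of_lt hα ht hx.1 hx.2

theorem dropletProfile_pos (hα : 0 < α) {t x : ℝ} (ht : t ∈ contactSet α) (hx : |x| < t) :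
    0 < dropletProfile α t x := by
  have h : dropletProfile α t |x| = dropletProfile α t x := by
    rcases abs_choice x with h | h <;> rw [h]
    exact dropletProfile_neg α t x
  rw [← h, ← dropletProfile_self α t]
  exact strictAntiOn_dropletProfile hα ht ⟨abs_nonneg x, hx.le⟩ (right_mem_Icc.2 ht.1.le) hx

theorem dropletProfile_lt (hα : 0 < α) {t₁ t₂ x : ℝ} (h₁ : t₁ ∈ contactSet α)
    (h₂ : t₂ ∈ contactSet α) (h : t₁ < t₂) (hx : |x| ≤ t₁) :
    dropletProfile α t₁ x < dropletProfile α t₂ x := by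
  have hA := strictMonoOn_coeffA hα h₁ h₂ h
  have hc : cos (α * t₁) ≤ cos (α * x) := by
    rw [← cos_abs (α * x), abs_mul, abs_of_pos hα]
    exact cos_le_cos_of_nonneg_of_le_pi (by positivity) h₁.2.2.le
      (mul_le_mul_of_nonneg_left hx hα.le)
  have hp := dropletProfile_pos hα h₂ (x := t₁) (by rwa [abs_of_pos h₁.1])
  have := mul_nonneg (sub_nonneg.2 hA.le) (sub_nonneg.2 hc)
  unfold dropletProfile at *
  nlinarith

theorem cos_le_dropletMultiplier (hα : 0 < α) {t x : ℝ} (ht : t ∈ contactSet α) (hx : t ≤ |x|)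
    (hxπ : |x| ≤ π) : cos x ≤ dropletMultiplier α t := by
  have h1 : cos x ≤ cos t := by
    rw [← cos_abs x]
    exact cos_le_cos_of_nonneg_of_le_pi ht.1.le hxπ hx
  have h2 : 0 < dropletCurv α t t := by
    have hs := sin_pos_of_contact hα ht
    have hw := wronskian_pos hα ht.1 ht.2.1 ht.2.2.le
    have e : dropletCurv α t t = wronskian α t / sin (α * t) := by
      rw [dropletCurv, wronskian, coeffA_eq]
      field_simp
    rw [e]
    exact div_pos hw hs
  rw [dropletCurv_eq, dropletProfile_self] at h2
  linarith

/-- The mass of a droplet with contact point `t`. -/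
noncomputable def dropletMass (α t : ℝ) : ℝ :=
  -2 * sin t / α ^ 2 - 2 * t * particular α t - 2 * t * (coeffA α t * cos (α * t))

theorem integral_dropletProfile (hα : 0 < α) {t : ℝ} (ht : t ∈ contactSet α) :
    ∫ x in (-t)..t, dropletProfile α t x = dropletMass α t := by
  have hd : ∀ x, HasDerivAt (fun x => -(sin x + particularDeriv α x) / α ^ 2
      + coeffA α t * (sin (α * x) / α) - x * (particular α t + coeffA α t * cos (α * t)))
      (dropletProfile α t x) x := fun x => by
    have h1 := ((hasDerivAt_sin x).add (hasDerivAt_particularDeriv hα x)).neg.div_const (α ^ 2)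
    have h2 := ((hasDerivAt_sin_mul α x).div_const α).const_mul (coeffA α t)
    have h3 := (hasDerivAt_id x).mul_const (particular α t + coeffA α t * cos (α * t))
    refine ((h1.add h2).sub h3).congr_deriv ?_
    unfold dropletProfile
    field_simp
    ring
  have hc : Continuous (dropletProfile α t) := continuous_iff_continuousAt.2 fun x =>
    (hasDerivAt_dropletProfile α t x).continuousAt
  rw [intervalIntegral.integral_eq_sub_of_hasDerivAt (fun x _ => hd x)
    (hc.intervalIntegrable _ _)]
  simp only [particularDeriv_neg, mul_neg, sin_neg, dropletMass]
  rw [← coeffA_mul hα ht]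
  field_simp
  ring

theorem hasDerivAt_dropletMass (hα : 0 < α) {t : ℝ} (ht : t ∈ contactSet α) :
    HasDerivAt (dropletMass α)
      (2 * (wronskian α t / (α * sin (α * t) ^ 2)) * (sin (α * t) / α - t * cos (α * t))) t := by
  have hs := sin_pos_of_contact hα ht
  have hA := hasDerivAt_coeffA hα hs.ne'
  have h1 := ((hasDerivAt_sin t).const_mul (-2)).div_const (α ^ 2)
  have h2 := ((hasDerivAt_id t).const_mul 2).mul (hasDerivAt_particular α t)
  have h3 := ((hasDerivAt_id t).const_mul 2).mul (hA.mul (hasDerivAt_cos_mul α t))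
  refine ((h1.sub h2).sub h3).congr_deriv ?_
  simp only [id, Pi.mul_apply]
  rw [← coeffA_mul hα ht]
  have hu : particularDeriv α t = coeffA α t * (α * sin (α * t)) := (coeffA_mul hα ht).symm
  unfold wronskian
  rw [hu]
  field_simp
  ring

theorem deriv_dropletMass_pos (hα : 0 < α) {t : ℝ} (ht : t ∈ contactSet α) :
    0 < 2 * (wronskian α t / (α * sin (α * t) ^ 2)) * (sin (α * t) / α - t * cos (α * t)) := by
  have hs := sin_pos_of_contact hα ht
  have hw := wronskian_pos hα ht.1 ht.2.1 ht.2.2.le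
  have h := mul_cos_lt_sin (mul_pos hα ht.1) ht.2.2.le
  have : sin (α * t) / α - t * cos (α * t) = (sin (α * t) - α * t * cos (α * t)) / α := by
    field_simp
  rw [this]
  have := sub_pos.2 h
  positivity

theorem strictMonoOn_dropletMass (hα : 0 < α) :
    StrictMonoOn (dropletMass α) (contactSet α) := by
  refine strictMonoOn_of_deriv_pos (ordConnected_contactSet hα).convex (fun t ht =>
    (hasDerivAt_dropletMass hα ht).continuousAt.continuousWithinAt) fun t ht => ?_
  rw [(hasDerivAt_dropletMass hα (interior_subset ht)).deriv]
  exact deriv_dropletMass_pos hα (interior_subset ht)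

theorem contDiffAt_dropletMass (hα : 0 < α) {t : ℝ} (ht : t ∈ contactSet α) :
    ContDiffAt ℝ ∞ (dropletMass α) t := by
  have hs := sin_pos_of_contact hα ht
  have hA : ContDiffAt ℝ ∞ (coeffA α) t := by
    have e : coeffA α = fun t => particularDeriv α t / (α * sin (α * t)) := funext (coeffA_eq α)
    rw [e]
    exact (contDiff_particularDeriv α).contDiffAt.div (by fun_prop) (by positivity)
  have hu : ContDiffAt ℝ ∞ (particular α) t := (contDiff_particular α).contDiffAt
  unfold dropletMass
  fun_prop

theorem tendsto_dropletMass_zero (hα : 0 < α) :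
    Tendsto (dropletMass α) (𝓝[>] 0) (𝓝 0) := by
  have h1 : Tendsto (fun t : ℝ => sin (α * t) / t) (𝓝[>] 0) (𝓝 α) := by
    have := (hasDerivAt_sin_mul α 0).tendsto_slope_zero_right
    simpa [div_eq_inv_mul] using this
  have h2 : Tendsto (fun t : ℝ => (-2 * sin t / α ^ 2 - 2 * t * particular α t)
      - 2 * (particularDeriv α t * cos (α * t) / α) * (sin (α * t) / t)⁻¹) (𝓝[>] 0)
      (𝓝 ((-2 * sin 0 / α ^ 2 - 2 * 0 * particular α 0)
      - 2 * (particularDeriv α 0 * cos (α * 0) / α) * α⁻¹)) := by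
    have c1 := (contDiff_particular α).continuous
    have c2 := (contDiff_particularDeriv α).continuous
    refine Tendsto.sub ?_ (Tendsto.mul ?_ (h1.inv₀ hα.ne'))
    · exact (Continuous.tendsto (by fun_prop) 0).mono_left nhdsWithin_le_nhds
    · exact (Continuous.tendsto (by fun_prop) 0).mono_left nhdsWithin_le_nhds
  simp only [sin_zero, mul_zero, zero_div, zero_mul, sub_zero, particularDeriv_zero] at h2
  refine h2.congr' ?_
  filter_upwards [self_mem_nhdsWithin] with t ht
  rw [dropletMass, coeffA_eq, inv_div]
  field_simp

theorem dropletMass_pi (h1 : α < 1) :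
    dropletMass α π = 2 * π / (1 - α ^ 2) := by
  simp [dropletMass, coeffA_eq, particularDeriv, particular, h1.ne]
  field_simp

theorem tendsto_dropletMass_top (hα : 1 ≤ α) :
    Tendsto (dropletMass α) (𝓝[<] (π / α)) atTop := by
  have hα0 : 0 < α := by linarith
  have hπα : α * (π / α) = π := by field_simp
  have c1 := (contDiff_particular α).continuous
  have c2 := (contDiff_particularDeriv α).continuous
  have hpos : 0 < particularDeriv α (π / α) := by
    have := wronskian_pos hα0 (t := π / α) (by positivity)
      (div_le_self Real.pi_pos.le hα) hπα.le
    rw [wronskian, hπα, sin_pi, cos_pi] at this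
    have h2 : 0 < α * particularDeriv α (π / α) := by linarith
    exact pos_of_mul_pos_right h2 hα0.le
  have hs : Tendsto (fun t => (sin (α * t))⁻¹) (𝓝[<] (π / α)) atTop := by
    refine tendsto_inv_nhdsGT_zero.comp (tendsto_nhdsWithin_iff.2 ⟨?_, ?_⟩)
    · have : Tendsto (fun t => sin (α * t)) (𝓝 (π / α)) (𝓝 (sin (α * (π / α)))) :=
        Continuous.tendsto (by fun_prop) _
      rw [hπα, sin_pi] at this
      exact this.mono_left nhdsWithin_le_nhds
    · filter_upwards [Ioo_mem_nhdsLT (show 0 < π / α by positivity)] with t ht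
      refine sin_pos_of_pos_of_lt_pi (mul_pos hα0 ht.1) ?_
      rw [← hπα]
      exact mul_lt_mul_of_pos_left ht.2 hα0
  have h1 : Tendsto (fun t => -2 * t * particularDeriv α t * cos (α * t) / α) (𝓝[<] (π / α))
      (𝓝 (-2 * (π / α) * particularDeriv α (π / α) * cos (α * (π / α)) / α)) :=
    (Continuous.tendsto (by fun_prop) _).mono_left nhdsWithin_le_nhds
  have h2 : Tendsto (fun t => -2 * sin t / α ^ 2 - 2 * t * particular α t) (𝓝[<] (π / α))
      (𝓝 (-2 * sin (π / α) / α ^ 2 - 2 * (π / α) * particular α (π / α))) :=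
    (Continuous.tendsto (by fun_prop) _).mono_left nhdsWithin_le_nhds
  refine (h2.add_atTop (h1.pos_mul_atTop ?_ hs)).congr fun t => ?_
  · rw [hπα, cos_pi]
    have : -2 * (π / α) * particularDeriv α (π / α) * -1 / α
      = 2 * (π / α) * particularDeriv α (π / α) / α := by ring
    rw [this]
    positivity
  · rw [dropletMass, coeffA_eq]
    by_cases h : sin (α * t) = 0
    · simp [h]
    · field_simp
      ring

theorem dropletMass_mem (hα : 0 < α) {t : ℝ} (ht : t ∈ contactSet α) :
    dropletMass α t ∈ dropletMasses α := by
  refine ⟨?_, ?_⟩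
  · rw [← integral_dropletProfile hα ht]
    refine intervalIntegral.intervalIntegral_pos_of_pos_on ?_ (fun x hx => ?_) (by linarith [ht.1])
    · exact (continuous_iff_continuousAt.2 fun x =>
        (hasDerivAt_dropletProfile α t x).continuousAt).intervalIntegrable _ _
    · exact dropletProfile_pos hα ht (abs_lt.2 hx)
  · rintro ⟨h1, h2⟩
    have hπ : π ∈ contactSet α := ⟨Real.pi_pos, le_rfl, by nlinarith [Real.pi_pos]⟩
    have h3 : dropletMass α t ≤ dropletMass α π :=
      (strictMonoOn_dropletMass hα).monotoneOn ht hπ ht.2.1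
    have h4 : 0 < 1 - α ^ 2 := by nlinarith
    rw [dropletMass_pi h1, le_div_iff₀ h4] at h3
    linarith

theorem exists_contact (hα : 0 < α) {M : ℝ} (hM : M ∈ dropletMasses α) :
    ∃ t ∈ contactSet α, dropletMass α t = M := by
  have hsmall : ∃ t ∈ contactSet α, dropletMass α t ≤ M := by
    have h1 := (tendsto_dropletMass_zero hα).eventually (ge_mem_nhds hM.1)
    have hm : 0 < min π (π / α) := lt_min Real.pi_pos (div_pos Real.pi_pos hα)
    obtain ⟨t, h, ht⟩ := (h1.and (Ioo_mem_nhdsGT hm)).exists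
    refine ⟨t, ⟨ht.1, (ht.2.trans_le (min_le_left _ _)).le, ?_⟩, h⟩
    have := ht.2.trans_le (min_le_right _ _)
    rwa [lt_div_iff₀ hα, mul_comm] at this
  have hbig : ∃ t ∈ contactSet α, M ≤ dropletMass α t := by
    rcases lt_or_ge α 1 with h1 | h1
    · have h4 : 0 < 1 - α ^ 2 := by nlinarith
      refine ⟨π, ⟨Real.pi_pos, le_rfl, by nlinarith [Real.pi_pos]⟩, ?_⟩
      rw [dropletMass_pi h1, le_div_iff₀ h4]
      by_contra hlt
      exact hM.2 ⟨h1, not_le.1 hlt⟩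
    · have h2 := (tendsto_dropletMass_top h1).eventually (eventually_ge_atTop M)
      obtain ⟨t, h, ht⟩ := (h2.and (Ioo_mem_nhdsLT (show 0 < π / α by positivity))).exists
      refine ⟨t, ⟨ht.1, ht.2.le.trans (div_le_self Real.pi_pos.le h1), ?_⟩, h⟩
      have := ht.2
      rwa [lt_div_iff₀ hα, mul_comm] at this
  obtain ⟨a, ha, ha'⟩ := hsmall
  obtain ⟨b, hb, hb'⟩ := hbig
  have hc : ContinuousOn (dropletMass α) (contactSet α) := fun t ht =>
    (hasDerivAt_dropletMass hα ht).continuousAt.continuousWithinAt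
  obtain ⟨t, ht, h⟩ := (ordConnected_contactSet hα).isPreconnected.intermediate_value ha hb hc
    ⟨ha', hb'⟩
  exact ⟨t, ht, h⟩

end Droplet

/-! ### The contact point as a function of the mass -/

section Contact

variable {α : ℝ}

open Classical in
/-- The contact point of the minimizer of mass `M`; it is `π` in the strictly positive regime. -/
noncomputable def contactPoint (α M : ℝ) : ℝ :=
  if h : ∃ t ∈ contactSet α, dropletMass α t = M then h.choose else π

theorem contactPoint_spec (hα : 0 < α) {M : ℝ} (hM : M ∈ dropletMasses α) :
    contactPoint α M ∈ contactSet α ∧ dropletMass α (contactPoint α M) = M := by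
  have h := exists_contact hα hM
  rw [contactPoint, dif_pos h]
  exact h.choose_spec

theorem lt_one_of_notMem_dropletMasses {M : ℝ} (hM : 0 < M) (h : M ∉ dropletMasses α) :
    α < 1 ∧ 2 * π < M * (1 - α ^ 2) := by
  by_contra hc
  exact h ⟨hM, hc⟩

theorem pi_mem_contactSet (h1 : α < 1) : π ∈ contactSet α :=
  ⟨Real.pi_pos, le_rfl, by nlinarith [Real.pi_pos]⟩

theorem contactPoint_of_notMem (hα : 0 < α) {M : ℝ} (h : M ∉ dropletMasses α) :
    contactPoint α M = π := by
  rw [contactPoint, dif_neg]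
  rintro ⟨t, ht, rfl⟩
  exact h (dropletMass_mem hα ht)

theorem contactPoint_mem (hα : 0 < α) {M : ℝ} (hM : 0 < M) :
    contactPoint α M ∈ contactSet α := by
  by_cases h : M ∈ dropletMasses α
  · exact (contactPoint_spec hα h).1
  · rw [contactPoint_of_notMem hα h]
    exact pi_mem_contactSet (lt_one_of_notMem_dropletMasses hM h).1

theorem mem_dropletMasses_of_le {M M' : ℝ} (hM : 0 < M) (h : M ≤ M') (hM' : M' ∈ dropletMasses α) :
    M ∈ dropletMasses α := by
  refine ⟨hM, fun ⟨h1, h2⟩ => hM'.2 ⟨h1, ?_⟩⟩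
  by_contra hc
  have : M * (1 - α ^ 2) ≤ 2 * π := by
    rcases le_total 0 (1 - α ^ 2) with h3 | h3
    · exact (mul_le_mul_of_nonneg_right h h3).trans (not_lt.1 hc)
    · nlinarith [Real.pi_pos]
  linarith

theorem strictMonoOn_contactPoint (hα : 0 < α) :
    StrictMonoOn (contactPoint α) (dropletMasses α) := by
  intro M hM M' hM' hlt
  obtain ⟨h1, h2⟩ := contactPoint_spec hα hM
  obtain ⟨h1', h2'⟩ := contactPoint_spec hα hM'
  rw [← (strictMonoOn_dropletMass hα).lt_iff_lt h1 h1', h2, h2']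
  exact hlt

theorem le_contactPoint (hα : 0 < α) {M t : ℝ} (ht : t ∈ contactSet α)
    (h : dropletMass α t ≤ M) : t ≤ contactPoint α M := by
  by_cases hD : M ∈ dropletMasses α
  · obtain ⟨h1, h2⟩ := contactPoint_spec hα hD
    rwa [← (strictMonoOn_dropletMass hα).le_iff_le ht h1, h2]
  · rw [contactPoint_of_notMem hα hD]
    exact ht.2.1

theorem contactPoint_lt (hα : 0 < α) {M t : ℝ} (hM : 0 < M) (ht : t ∈ contactSet α)
    (h : M < dropletMass α t) : contactPoint α M < t := by
  obtain ⟨h1, h2⟩ := contactPoint_spec hα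
    (mem_dropletMasses_of_le hM h.le (dropletMass_mem hα ht))
  rwa [← (strictMonoOn_dropletMass hα).lt_iff_lt h1 ht, h2]

theorem dropletMass_contactPoint_le (hα : 0 < α) {M : ℝ} (hM : 0 < M) :
    dropletMass α (contactPoint α M) ≤ M := by
  by_cases h : M ∈ dropletMasses α
  · exact (contactPoint_spec hα h).2.le
  · obtain ⟨h1, h2⟩ := lt_one_of_notMem_dropletMasses hM h
    have h4 : 0 < 1 - α ^ 2 := by nlinarith
    rw [contactPoint_of_notMem hα h, dropletMass_pi h1, div_le_iff₀ h4]
    exact h2.le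

theorem mem_dropletMasses_of_contactPoint_lt (hα : 0 < α) {M : ℝ} (h : contactPoint α M < π) :
    M ∈ dropletMasses α := by
  by_contra hc
  exact h.ne (contactPoint_of_notMem hα hc)

theorem continuousAt_contactPoint (hα : 0 < α) {M₀ : ℝ} (hM₀ : 0 < M₀) :
    ContinuousAt (contactPoint α) M₀ := by
  have hmem := contactPoint_mem hα hM₀
  have hmono := strictMonoOn_dropletMass hα
  refine tendsto_order.2 ⟨fun a ha => ?_, fun b hb => ?_⟩
  · obtain ⟨a', ha1, ha2⟩ := exists_between (max_lt ha hmem.1)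
    have ha' : a' ∈ contactSet α := ⟨(le_max_right _ _).trans_lt ha1, ha2.le.trans hmem.2.1,
      (mul_lt_mul_of_pos_left ha2 hα).trans hmem.2.2⟩
    have hlt : dropletMass α a' < M₀ :=
      (hmono ha' hmem ha2).trans_le (dropletMass_contactPoint_le hα hM₀)
    filter_upwards [lt_mem_nhds hlt] with M hM
    exact ((le_max_left _ _).trans_lt ha1).trans_le (le_contactPoint hα ha' (le_of_lt hM))
  · have hev : ∀ᶠ M in 𝓝 M₀, 0 < M := lt_mem_nhds hM₀
    rcases hmem.2.1.eq_or_lt with hπ | hπ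
    · filter_upwards [hev] with M hM
      exact ((contactPoint_mem hα hM).2.1.trans hπ.ge).trans_lt hb
    · have h1 : contactPoint α M₀ < π / α := by
        rw [lt_div_iff₀ hα, mul_comm]
        exact hmem.2.2
      obtain ⟨b', hb1, hb2⟩ := exists_between (lt_min hb (lt_min hπ h1))
      have hb3 := hb2.trans_le (min_le_right _ _)
      have hb' : b' ∈ contactSet α := ⟨hmem.1.trans hb1, (hb3.trans_le (min_le_left _ _)).le, by
        have := hb3.trans_le (min_le_right _ _)
        rwa [lt_div_iff₀ hα, mul_comm] at this⟩
      have hlt : M₀ < dropletMass α b' := by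
        have := hmono hmem hb' hb1
        rwa [(contactPoint_spec hα (mem_dropletMasses_of_contactPoint_lt hα hπ)).2] at this
      filter_upwards [hev, gt_mem_nhds hlt] with M hM hMb
      exact (contactPoint_lt hα hM hb' hMb).trans (hb2.trans_le (min_le_left _ _))

/-- Smoothness, including one-sidedly at the largest droplet mass when `α < 1`: the mass is a
smooth function with positive derivative on a full neighbourhood of every contact point. -/
theorem contDiffOn_contactPoint (hα : 0 < α) :
    ContDiffOn ℝ ∞ (contactPoint α) (dropletMasses α) := by
  intro M₀ hM₀
  obtain ⟨h1, h2⟩ := contactPoint_spec hα hM₀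
  have hd := hasDerivAt_dropletMass hα h1
  have hpos := deriv_dropletMass_pos hα h1
  have hc := contDiffAt_dropletMass hα h1
  have hs : HasStrictDerivAt (dropletMass α) _ (contactPoint α M₀) :=
    hc.hasStrictDerivAt' hd (by simp)
  have hg : ContDiffAt ℝ ∞ (hs.localInverse _ _ _ hpos.ne') M₀ := by
    have := hc.to_localInverse (f' := ContinuousLinearEquiv.unitsEquivAut ℝ (Units.mk0 _ hpos.ne'))
      (hs.hasStrictFDerivAt_equiv hpos.ne').hasFDerivAt (by simp)
    rwa [h2] at this
  refine hg.contDiffWithinAt.congr_of_eventuallyEq ?_ ?_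
  · have he := (continuousAt_contactPoint hα hM₀.1).eventually
      (hs.eventually_left_inverse hpos.ne')
    filter_upwards [mem_nhdsWithin_of_mem_nhds he, self_mem_nhdsWithin] with M hM hMD
    rw [(contactPoint_spec hα hMD).2] at hM
    exact hM.symm
  · have := (hs.eventually_left_inverse hpos.ne').self_of_nhds
    rw [h2] at this
    exact this.symm

end Contact

/-! ### The minimizer of given mass -/

section Profile

/-- The distance of `x` to `2πℤ`, in `[0, π]`. -/
noncomputable def foldAngle (x : ℝ) : ℝ := arccos (cos x)

theorem foldAngle_mem (x : ℝ) : foldAngle x ∈ Icc 0 π := ⟨arccos_nonneg _, arccos_le_pi _⟩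

theorem cos_foldAngle (x : ℝ) : cos (foldAngle x) = cos x :=
  cos_arccos (neg_one_le_cos x) (cos_le_one x)

theorem foldAngle_eq_abs {x : ℝ} (hx : |x| ≤ π) : foldAngle x = |x| := by
  rw [foldAngle, ← cos_abs, arccos_cos (abs_nonneg x) hx]

theorem continuous_foldAngle : Continuous foldAngle := continuous_arccos.comp continuous_cos

theorem foldAngle_add (x : ℝ) : foldAngle (x + 2 * π) = foldAngle x := by
  rw [foldAngle, cos_add_two_pi, foldAngle]

theorem foldAngle_neg (x : ℝ) : foldAngle (-x) = foldAngle x := by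
  rw [foldAngle, cos_neg, foldAngle]

/-- The second derivative of the `2π`-periodic profile with contact point `t`. -/
noncomputable def profileCurv (α t x : ℝ) : ℝ :=
  if foldAngle x ≤ t then dropletCurv α t (foldAngle x) else 0

/-- The first derivative of the `2π`-periodic profile with contact point `t`. -/
noncomputable def profileSlope (α t x : ℝ) : ℝ := ∫ s in (0 : ℝ)..x, profileCurv α t s

/-- The `2π`-periodic profile with contact point `t`, normalized to vanish at `0`. -/
noncomputable def profileShape (α t x : ℝ) : ℝ := ∫ s in (0 : ℝ)..x, profileSlope α t s

/-- The minimizer of mass `M`. -/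
noncomputable def minimizer (α M x : ℝ) : ℝ :=
  (M - ∫ s in (-π)..π, profileShape α (contactPoint α M) s) / (2 * π)
    + profileShape α (contactPoint α M) x

variable {α : ℝ}

/-- A bound for the curvature that depends on `t` only through the coefficient `A`. -/
theorem exists_profileCurv_bound (α : ℝ) :
    ∃ B, 0 ≤ B ∧ ∀ t x, |profileCurv α t x| ≤ B + |coeffA α t| * α ^ 2 := by
  have hc : Continuous fun x => -cos x - α ^ 2 * particular α x :=
    continuous_cos.neg.sub (continuous_const.mul (contDiff_particular α).continuous)
  obtain ⟨B, hB⟩ := (isCompact_Icc (a := 0) (b := π)).exists_bound_of_continuousOn hc.continuousOn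
  have hB0 : 0 ≤ B := (norm_nonneg _).trans (hB 0 (left_mem_Icc.2 Real.pi_pos.le))
  refine ⟨B, hB0, fun t x => ?_⟩
  unfold profileCurv
  split_ifs
  · have h1 := hB _ (foldAngle_mem x)
    rw [Real.norm_eq_abs] at h1
    have h2 : |coeffA α t * (α ^ 2 * cos (α * foldAngle x))| ≤ |coeffA α t| * α ^ 2 := by
      rw [abs_mul, abs_mul, abs_of_nonneg (sq_nonneg α)]
      refine mul_le_mul_of_nonneg_left ?_ (abs_nonneg _)
      exact mul_le_of_le_one_right (sq_nonneg α) (abs_cos_le_one _)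
    exact (abs_sub _ _).trans (add_le_add h1 h2)
  · rw [abs_zero]
    positivity

theorem measurable_profileCurv (α t : ℝ) : Measurable (profileCurv α t) := by
  refine Measurable.ite (measurableSet_le continuous_foldAngle.measurable measurable_const) ?_
    measurable_const
  have : Continuous (dropletCurv α t) := by
    have := (contDiff_particular α).continuous
    unfold dropletCurv
    fun_prop
  exact (this.comp continuous_foldAngle).measurable

theorem intervalIntegrable_profileCurv (α t a b : ℝ) :
    IntervalIntegrable (profileCurv α t) volume a b := by
  obtain ⟨B, hB0, hB⟩ := exists_profileCurv_bound α
  refine (intervalIntegrable_const (c := B + |coeffA α t| * α ^ 2)).mono_fun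
    (measurable_profileCurv α t).aestronglyMeasurable (ae_of_all _ fun x => ?_)
  exact (hB t x).trans (le_abs_self _)

theorem continuous_profileSlope (α t : ℝ) : Continuous (profileSlope α t) :=
  intervalIntegral.continuous_primitive (intervalIntegrable_profileCurv α t) 0

theorem profileSlope_sub (α t x y : ℝ) :
    profileSlope α t y - profileSlope α t x = ∫ s in x..y, profileCurv α t s :=
  intervalIntegral.integral_interval_sub_left (intervalIntegrable_profileCurv α t _ _)
    (intervalIntegrable_profileCurv α t _ _)

theorem lipschitzWith_profileSlope {α t : ℝ} {K : ℝ≥0} (hK : ∀ x, |profileCurv α t x| ≤ K) :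
    LipschitzWith K (profileSlope α t) := by
  refine LipschitzWith.of_dist_le_mul fun x y => ?_
  rw [dist_eq_norm, profileSlope_sub, dist_comm, Real.dist_eq, abs_sub_comm]
  rw [abs_sub_comm]
  have := intervalIntegral.norm_integral_le_of_norm_le_const (a := y) (b := x)
    (f := profileCurv α t) (C := K) fun s _ => hK s
  rwa [abs_sub_comm] at this

theorem hasDerivAt_profileShape (α t x : ℝ) :
    HasDerivAt (profileShape α t) (profileSlope α t x) x :=
  intervalIntegral.integral_hasDerivAt_right ((continuous_profileSlope α t).intervalIntegrable _ _)
    ((continuous_profileSlope α t).stronglyMeasurableAtFilter _ _)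
    (continuous_profileSlope α t).continuousAt

theorem hasDerivAt_minimizer (α M x : ℝ) :
    HasDerivAt (minimizer α M) (profileSlope α (contactPoint α M) x) x :=
  (hasDerivAt_profileShape α _ x).const_add _

theorem deriv_minimizer (α M : ℝ) :
    deriv (minimizer α M) = profileSlope α (contactPoint α M) :=
  funext fun x => (hasDerivAt_minimizer α M x).deriv

theorem continuous_profileShape (α t : ℝ) : Continuous (profileShape α t) :=
  continuous_iff_continuousAt.2 fun x => (hasDerivAt_profileShape α t x).continuousAt

theorem continuous_minimizer (α M : ℝ) : Continuous (minimizer α M) :=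
  continuous_const.add (continuous_profileShape α _)

theorem integral_minimizer (α M : ℝ) : ∫ x in (-π)..π, minimizer α M x = M := by
  unfold minimizer
  rw [intervalIntegral.integral_add intervalIntegrable_const
    ((continuous_profileShape α _).intervalIntegrable _ _)]
  have := Real.pi_pos
  simp only [intervalIntegral.integral_const, smul_eq_mul]
  field_simp
  ring

theorem profileCurv_neg (α t x : ℝ) : profileCurv α t (-x) = profileCurv α t x := by
  simp only [profileCurv, foldAngle_neg]

theorem profileCurv_add (α t x : ℝ) : profileCurv α t (x + 2 * π) = profileCurv α t x := by
  simp only [profileCurv, foldAngle_add]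

theorem profileSlope_neg (α t x : ℝ) : profileSlope α t (-x) = -profileSlope α t x := by
  have := intervalIntegral.integral_comp_neg (f := profileCurv α t) (a := 0) (b := x)
  simp only [profileCurv_neg, neg_zero] at this
  rw [profileSlope, profileSlope, this, intervalIntegral.integral_symm]

theorem profileShape_neg (α t x : ℝ) : profileShape α t (-x) = profileShape α t x := by
  have := intervalIntegral.integral_comp_neg (f := profileSlope α t) (a := 0) (b := x)
  simp only [profileSlope_neg, neg_zero, intervalIntegral.integral_neg] at this
  rw [profileShape, profileShape, intervalIntegral.integral_symm, ← this, neg_neg]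

theorem profileSlope_of_le (hα : 0 < α) {t x : ℝ} (ht : t ∈ contactSet α) (hx : |x| ≤ t) :
    profileSlope α t x = dropletSlope α t x := by
  wlog hx0 : 0 ≤ x generalizing x
  · have := this (x := -x) (by rwa [abs_neg]) (by linarith)
    rw [profileSlope_neg, dropletSlope_neg] at this
    linarith
  rw [abs_of_nonneg hx0] at hx
  have hc : Continuous (dropletCurv α t) := by
    have := (contDiff_particular α).continuous
    unfold dropletCurv
    fun_prop
  have h1 := intervalIntegral.integral_eq_sub_of_hasDerivAt (a := 0) (b := x)
    (fun s _ => hasDerivAt_dropletSlope hα t s) (hc.intervalIntegrable _ _)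
  rw [dropletSlope_zero, sub_zero] at h1
  rw [← h1, profileSlope]
  refine intervalIntegral.integral_congr fun s hs => ?_
  rw [uIcc_of_le hx0] at hs
  have hs' : foldAngle s = s := by
    rw [foldAngle_eq_abs, abs_of_nonneg hs.1]
    rw [abs_of_nonneg hs.1]
    exact hs.2.trans (hx.trans ht.2.1)
  simp only [profileCurv, hs', if_pos (hs.2.trans hx)]

theorem profileSlope_of_ge (hα : 0 < α) {t x : ℝ} (ht : t ∈ contactSet α) (hx : t ≤ |x|)
    (hxπ : |x| ≤ π) : profileSlope α t x = 0 := by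
  wlog hx0 : 0 ≤ x generalizing x
  · have := this (x := -x) (by rwa [abs_neg]) (by rwa [abs_neg]) (by linarith)
    rw [profileSlope_neg] at this
    linarith
  rw [abs_of_nonneg hx0] at hx hxπ
  have h1 := profileSlope_sub α t t x
  rw [profileSlope_of_le hα ht (abs_of_pos ht.1).le, dropletSlope_self hα ht, sub_zero] at h1
  rw [h1, intervalIntegral.integral_of_le hx]
  refine setIntegral_eq_zero_of_forall_eq_zero fun s hs => ?_
  have hs0 : 0 ≤ s := ht.1.le.trans hs.1.le
  have hs' : foldAngle s = s := by
    rw [foldAngle_eq_abs, abs_of_nonneg hs0]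
    rw [abs_of_nonneg hs0]
    exact hs.2.trans hxπ
  simp only [profileCurv, hs', if_neg (not_le.2 hs.1)]

theorem profileSlope_periodic (hα : 0 < α) {t : ℝ} (ht : t ∈ contactSet α) :
    Function.Periodic (profileSlope α t) (2 * π) := fun x => by
  have h1 := profileSlope_sub α t x (x + 2 * π)
  rw [integral_period_eq (profileCurv_add α t), ← profileSlope_sub, profileSlope_neg,
    profileSlope_of_ge hα ht (by rw [abs_of_pos Real.pi_pos]; exact ht.2.1)
      (abs_of_pos Real.pi_pos).le] at h1
  linarith

theorem profileShape_sub (α t x y : ℝ) :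
    profileShape α t y - profileShape α t x = ∫ s in x..y, profileSlope α t s :=
  intervalIntegral.integral_interval_sub_left ((continuous_profileSlope α t).intervalIntegrable _ _)
    ((continuous_profileSlope α t).intervalIntegrable _ _)

theorem profileShape_periodic (hα : 0 < α) {t : ℝ} (ht : t ∈ contactSet α) :
    Function.Periodic (profileShape α t) (2 * π) := fun x => by
  have h1 := profileShape_sub α t x (x + 2 * π)
  rw [integral_period_eq (profileSlope_periodic hα ht), ← profileShape_sub, profileShape_neg] at h1
  linarith

theorem profileShape_of_le (hα : 0 < α) {t x : ℝ} (ht : t ∈ contactSet α) (hx : |x| ≤ t) :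
    profileShape α t x = dropletProfile α t x - dropletProfile α t 0 := by
  have hc : Continuous (dropletSlope α t) := continuous_iff_continuousAt.2 fun s =>
    (hasDerivAt_dropletSlope hα t s).continuousAt
  rw [← intervalIntegral.integral_eq_sub_of_hasDerivAt (a := 0) (b := x)
    (fun s _ => hasDerivAt_dropletProfile α t s) (hc.intervalIntegrable _ _), profileShape]
  refine intervalIntegral.integral_congr fun s hs => profileSlope_of_le hα ht ?_
  refine le_trans ?_ hx
  simpa using abs_sub_left_of_mem_uIcc hs

theorem profileShape_of_ge (hα : 0 < α) {t x : ℝ} (ht : t ∈ contactSet α) (hx : t ≤ |x|)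
    (hxπ : |x| ≤ π) : profileShape α t x = -dropletProfile α t 0 := by
  wlog hx0 : 0 ≤ x generalizing x
  · have := this (x := -x) (by rwa [abs_neg]) (by rwa [abs_neg]) (by linarith)
    rwa [profileShape_neg] at this
  rw [abs_of_nonneg hx0] at hx hxπ
  have h1 := profileShape_sub α t t x
  have h2 : ∫ s in t..x, profileSlope α t s = 0 := by
    rw [intervalIntegral.integral_congr (g := fun _ => 0)]
    · simp
    · intro s hs
      rw [uIcc_of_le hx] at hs
      have hs0 : 0 ≤ s := ht.1.le.trans hs.1
      exact profileSlope_of_ge hα ht (by rw [abs_of_nonneg hs0]; exact hs.1)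
        (by rw [abs_of_nonneg hs0]; exact hs.2.trans hxπ)
  rw [h2, profileShape_of_le hα ht (abs_of_pos ht.1).le, dropletProfile_self] at h1
  linarith

theorem integral_profileShape (hα : 0 < α) {t : ℝ} (ht : t ∈ contactSet α) :
    ∫ x in (-π)..π, profileShape α t x = dropletMass α t - 2 * π * dropletProfile α t 0 := by
  have hc : Continuous fun x => profileShape α t x + dropletProfile α t 0 :=
    (continuous_profileShape α t).add continuous_const
  have h1 := integral_eq_of_eq_zero_outside ht.1 ht.2.1 hc.intervalIntegrable fun x h1 h2 _ => by
    rw [profileShape_of_ge hα ht h1 h2]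
    ring
  have h2 : ∫ x in (-t)..t, (profileShape α t x + dropletProfile α t 0) = dropletMass α t := by
    rw [← integral_dropletProfile hα ht]
    refine intervalIntegral.integral_congr fun x hx => ?_
    rw [uIcc_of_le (by linarith [ht.1])] at hx
    simp only [profileShape_of_le hα ht (abs_le.2 hx), sub_add_cancel]
  rw [h2, intervalIntegral.integral_add ((continuous_profileShape α t).intervalIntegrable _ _)
    intervalIntegrable_const, intervalIntegral.integral_const, smul_eq_mul] at h1
  linarith

/-- The mass exceeding that of the widest droplet, as a height. It vanishes in the droplet regime. -/
noncomputable def excessHeight (α M : ℝ) : ℝ :=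
  (M - dropletMass α (contactPoint α M)) / (2 * π)

theorem excessHeight_nonneg (hα : 0 < α) {M : ℝ} (hM : 0 < M) : 0 ≤ excessHeight α M :=
  div_nonneg (sub_nonneg.2 (dropletMass_contactPoint_le hα hM)) two_pi_pos.le

theorem excessHeight_of_mem (hα : 0 < α) {M : ℝ} (hM : M ∈ dropletMasses α) :
    excessHeight α M = 0 := by
  rw [excessHeight, (contactPoint_spec hα hM).2, sub_self, zero_div]

theorem minimizer_eq (hα : 0 < α) {M : ℝ} (hM : 0 < M) (x : ℝ) :
    minimizer α M x = profileShape α (contactPoint α M) x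
      + dropletProfile α (contactPoint α M) 0 + excessHeight α M := by
  have := Real.pi_pos
  rw [minimizer, integral_profileShape hα (contactPoint_mem hα hM), excessHeight]
  field_simp
  ring

theorem minimizer_of_le (hα : 0 < α) {M x : ℝ} (hM : 0 < M) (hx : |x| ≤ contactPoint α M) :
    minimizer α M x = dropletProfile α (contactPoint α M) x + excessHeight α M := by
  rw [minimizer_eq hα hM, profileShape_of_le hα (contactPoint_mem hα hM) hx]
  ring

theorem minimizer_of_ge (hα : 0 < α) {M x : ℝ} (hM : 0 < M) (hx : contactPoint α M ≤ |x|)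
    (hxπ : |x| ≤ π) : minimizer α M x = excessHeight α M := by
  rw [minimizer_eq hα hM, profileShape_of_ge hα (contactPoint_mem hα hM) hx hxπ]
  ring

theorem minimizer_neg (α M x : ℝ) : minimizer α M (-x) = minimizer α M x := by
  rw [minimizer, minimizer, profileShape_neg]

theorem minimizer_periodic (hα : 0 < α) {M : ℝ} (hM : 0 < M) :
    Function.Periodic (minimizer α M) (2 * π) := fun x => by
  rw [minimizer, minimizer, profileShape_periodic hα (contactPoint_mem hα hM)]

theorem minimizer_congr_cos (hα : 0 < α) {M : ℝ} (hM : 0 < M) {x z : ℝ} (h : cos x = cos z) :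
    minimizer α M x = minimizer α M z := by
  obtain ⟨k, hk | hk⟩ := Real.cos_eq_cos_iff.1 h
  · rw [hk, show 2 * (k : ℝ) * π + x = x + k * (2 * π) by ring,
      (minimizer_periodic hα hM).int_mul k x]
  · rw [hk, show 2 * (k : ℝ) * π - x = -x + k * (2 * π) by ring,
      (minimizer_periodic hα hM).int_mul k (-x), minimizer_neg]

theorem minimizer_foldAngle (hα : 0 < α) {M : ℝ} (hM : 0 < M) (x : ℝ) :
    minimizer α M (foldAngle x) = minimizer α M x :=
  minimizer_congr_cos hα hM (cos_foldAngle x)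

theorem abs_foldAngle (x : ℝ) : |foldAngle x| = foldAngle x := abs_of_nonneg (foldAngle_mem x).1

theorem minimizer_nonneg (hα : 0 < α) {M : ℝ} (hM : 0 < M) (x : ℝ) : 0 ≤ minimizer α M x := by
  have he := excessHeight_nonneg hα hM
  rw [← minimizer_foldAngle hα hM]
  have habs := abs_foldAngle x
  rcases lt_or_ge (foldAngle x) (contactPoint α M) with h | h
  · rw [minimizer_of_le hα hM (by rw [habs]; exact h.le)]
    have := dropletProfile_pos hα (contactPoint_mem hα hM) (by rwa [habs])
    linarith
  · rw [minimizer_of_ge hα hM (by rwa [habs]) (by rw [habs]; exact (foldAngle_mem x).2)]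
    exact he

theorem isSobolev_minimizer (hα : 0 < α) {M : ℝ} (hM : 0 < M) :
    IsSobolev (minimizer α M) (profileSlope α (contactPoint α M)) := by
  have hc := continuous_profileSlope α (contactPoint α M)
  refine ⟨minimizer_periodic hα hM, profileSlope_periodic hα (contactPoint_mem hα hM),
    continuous_minimizer α M, fun a b => ⟨?_, ae_of_all _ fun x _ => ?_, ?_⟩⟩
  · refine absolutelyContinuous_primitive (hc.intervalIntegrable a b) left_mem_uIcc fun x _ => ?_
    rw [intervalIntegral.integral_eq_sub_of_hasDerivAt (fun s _ => hasDerivAt_minimizer α M s)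
      (hc.intervalIntegrable _ _)]
    ring
  · rw [one_mul]
    exact hasDerivAt_minimizer α M x
  · have : IntervalIntegrable (fun x => profileSlope α (contactPoint α M) x ^ 2) volume a b :=
      (hc.pow 2).intervalIntegrable a b
    simpa using this

theorem isCriticalProfile_minimizer (hα : 0 < α) {M p : ℝ} (hM : 0 < M)
    (hp : contactPoint α M ≤ p) (hpπ : p ≤ π) :
    IsCriticalProfile α p (contactPoint α M)
      (dropletMultiplier α (contactPoint α M) + α ^ 2 * excessHeight α M)
      (minimizer α M) (profileSlope α (contactPoint α M)) (dropletSlope α (contactPoint α M)) := by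
  have ht := contactPoint_mem hα hM
  refine ⟨ht.1, hp, hasDerivAt_minimizer α M, continuous_profileSlope α _,
    fun x hx => profileSlope_of_le hα ht (abs_le.2 hx), fun x hx => ?_, ?_,
    dropletSlope_self hα ht, fun hlt x h1 h2 => ?_⟩
  · refine (hasDerivAt_dropletSlope hα _ x).congr_deriv ?_
    rw [dropletCurv_eq, minimizer_of_le hα hM (abs_le.2 hx)]
    ring
  · rw [dropletSlope_neg, dropletSlope_self hα ht, neg_zero]
  · have he := excessHeight_of_mem hα
      (mem_dropletMasses_of_contactPoint_lt hα (hlt.trans_le hpπ))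
    have h2' := h2.trans hpπ
    rw [minimizer_of_ge hα hM h1 h2', profileSlope_of_ge hα ht h1 h2', he, mul_zero, add_zero]
    exact ⟨rfl, rfl, cos_le_dropletMultiplier hα ht h1 h2'⟩

theorem isEnergyMinimizer_minimizer (hα : 0 < α) {M : ℝ} (hM : 0 < M) :
    IsEnergyMinimizer α M (minimizer α M) ∧
      ∀ v, IsEnergyMinimizer α M v → v =ᵐ[periodMeasure] minimizer α M := by
  have ht := contactPoint_mem hα hM
  -- a half period `p` strictly below `π / α`, so that the second variation is coercive
  obtain ⟨p, hp1, hp2, hp3, hp4⟩ : ∃ p, contactPoint α M ≤ p ∧ p ≤ π ∧ α * p < π ∧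
      (p = π ∨ contactPoint α M < p) := by
    rcases lt_or_ge α 1 with h1 | h1
    · exact ⟨π, ht.2.1, le_rfl, (pi_mem_contactSet h1).2.2, Or.inl rfl⟩
    · have h2 : contactPoint α M < π / α := by
        rw [lt_div_iff₀ hα, mul_comm]
        exact ht.2.2
      obtain ⟨p, h3, h4⟩ := exists_between h2
      refine ⟨p, h3.le, h4.le.trans (div_le_self Real.pi_pos.le h1), ?_, Or.inr h3⟩
      rwa [lt_div_iff₀ hα, mul_comm] at h4
  refine isEnergyMinimizer_of_sobolev (isSobolev_minimizer hα hM) (continuous_profileSlope α _)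
    (minimizer_nonneg hα hM) (integral_minimizer α M) fun w d hw hw0 hmass => ?_
  refine (isCriticalProfile_minimizer hα hM hp1 hp2).minimality hα hp2 hp3 hp4
    (minimizer_nonneg hα hM) (fun x z h => minimizer_congr_cos hα hM h) (fun x h1 h2 h3 => ?_)
    hw hw0 hmass
  have h4 := hp1.trans h1
  rw [minimizer_of_ge hα hM h4 h2, profileSlope_of_ge hα ht h4 h2,
    excessHeight_of_mem hα (mem_dropletMasses_of_contactPoint_lt hα (hp1.trans_lt h3))]
  exact ⟨rfl, rfl⟩

/-! ### Shape of the minimizer -/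

theorem isStrictlySymmetricDecreasing_minimizer (hα : 0 < α) {M : ℝ} (hM : 0 < M) :
    IsStrictlySymmetricDecreasing (minimizer α M) := by
  have ht := contactPoint_mem hα hM
  have he := excessHeight_nonneg hα hM
  have hstrict : ∀ x ∈ Icc 0 π, ∀ y ∈ Icc 0 π, x < y → x < contactPoint α M →
      minimizer α M y < minimizer α M x := by
    intro x hx y hy hxy hxt
    rw [minimizer_of_le hα hM (x := x) (by rw [abs_of_nonneg hx.1]; exact hxt.le)]
    rcases le_total y (contactPoint α M) with h | h
    · rw [minimizer_of_le hα hM (by rwa [abs_of_nonneg hy.1])]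
      have := strictAntiOn_dropletProfile hα ht ⟨hx.1, hxt.le⟩ ⟨hy.1, h⟩ hxy
      linarith
    · rw [minimizer_of_ge hα hM (by rwa [abs_of_nonneg hy.1])
        (by rw [abs_of_nonneg hy.1]; exact hy.2)]
      have := dropletProfile_pos hα ht (x := x) (by rwa [abs_of_nonneg hx.1])
      linarith
  refine ⟨minimizer_neg α M, fun x hx y hy hxy => ?_, fun x hx y hy hxy hpos => ?_⟩
  · rcases hxy.eq_or_lt with rfl | hlt
    · exact le_rfl
    rcases lt_or_ge x (contactPoint α M) with h | h
    · exact (hstrict x hx y hy hlt h).le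
    · rw [minimizer_of_ge hα hM (x := x) (by rwa [abs_of_nonneg hx.1])
          (by rw [abs_of_nonneg hx.1]; exact hx.2),
        minimizer_of_ge hα hM (x := y) (by rw [abs_of_nonneg hy.1]; exact h.trans hxy)
          (by rw [abs_of_nonneg hy.1]; exact hy.2)]
  · refine hstrict x hx y hy hxy ?_
    by_contra hge
    rw [not_lt] at hge
    rw [minimizer_of_ge hα hM (x := x) (by rwa [abs_of_nonneg hx.1])
      (by rw [abs_of_nonneg hx.1]; exact hx.2), excessHeight_of_mem hα
      (mem_dropletMasses_of_contactPoint_lt hα (hge.trans_lt (hxy.trans_le hy.2)))] at hpos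
    exact lt_irrefl _ hpos

theorem isC11_minimizer (α M : ℝ) : IsC11 (minimizer α M) := by
  obtain ⟨B, hB0, hB⟩ := exists_profileCurv_bound α
  refine ⟨fun x => (hasDerivAt_minimizer α M x).differentiableAt,
    ⟨B + |coeffA α (contactPoint α M)| * α ^ 2, by positivity⟩, ?_⟩
  rw [deriv_minimizer]
  exact lipschitzWith_profileSlope (hB _)

theorem minimizer_lt (hα : 0 < α) {M₁ M₂ x : ℝ} (h₁ : 0 < M₁) (h : M₁ < M₂)
    (hx : 0 < minimizer α M₁ x) : minimizer α M₁ x < minimizer α M₂ x := by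
  have h₂ := h₁.trans h
  have m₁ := contactPoint_mem hα h₁
  have m₂ := contactPoint_mem hα h₂
  rw [← minimizer_foldAngle hα h₁] at hx ⊢
  rw [← minimizer_foldAngle hα h₂]
  have habs := abs_foldAngle x
  have hmem := foldAngle_mem x
  set r := foldAngle x
  have hT : contactPoint α M₁ ≤ contactPoint α M₂ :=
    le_contactPoint hα m₁ ((dropletMass_contactPoint_le hα h₁).trans h.le)
  have hr : r ≤ contactPoint α M₁ := by
    by_contra hlt
    rw [not_le] at hlt
    rw [minimizer_of_ge hα h₁ (by rw [habs]; exact hlt.le) (by rw [habs]; exact hmem.2),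
      excessHeight_of_mem hα
      (mem_dropletMasses_of_contactPoint_lt hα (hlt.trans_le hmem.2))] at hx
    exact lt_irrefl _ hx
  rw [minimizer_of_le hα h₁ (by rwa [habs]),
    minimizer_of_le hα h₂ (by rw [habs]; exact hr.trans hT)]
  have he₂ := excessHeight_nonneg hα h₂
  rcases hT.eq_or_lt with hT | hT
  · have : excessHeight α M₁ < excessHeight α M₂ := by
      rw [excessHeight, excessHeight, ← hT]
      exact div_lt_div_of_pos_right (by linarith) two_pi_pos
    rw [← hT]
    linarith
  · have := dropletProfile_lt hα m₁ m₂ hT (x := r) (by rwa [habs])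
    rw [excessHeight_of_mem hα (mem_dropletMasses_of_contactPoint_lt hα (hT.trans_le m₂.2.1))]
    linarith

theorem minimizer_strictly_positive_regime (hα : 0 < α) {M : ℝ} (hM : 0 < M) (h1 : α < 1)
    (h2 : 2 * π < M * (1 - α ^ 2)) (x : ℝ) :
    0 < minimizer α M x ∧ minimizer α M x = M / (2 * π) + 1 / (1 - α ^ 2) * cos x := by
  have hπ := Real.pi_pos
  have h4 : 0 < 1 - α ^ 2 := by nlinarith
  have hT : contactPoint α M = π := contactPoint_of_notMem hα fun h => h.2 ⟨h1, h2⟩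
  have hA : coeffA α π = 0 := by simp [coeffA_eq, particularDeriv, h1.ne]
  have key : minimizer α M x = M / (2 * π) + 1 / (1 - α ^ 2) * cos x := by
    rw [← minimizer_foldAngle hα hM, minimizer_of_le hα hM
      (by rw [abs_foldAngle, hT]; exact (foldAngle_mem x).2), excessHeight, hT,
      dropletMass_pi h1, dropletProfile, hA, ← cos_foldAngle x]
    simp only [particular, h1.ne, if_false, cos_pi]
    field_simp
    ring
  refine ⟨?_, key⟩
  rw [key]
  have h5 : 1 / (1 - α ^ 2) < M / (2 * π) := by
    rw [div_lt_div_iff₀ h4 two_pi_pos]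
    linarith
  have h6 : -(1 / (1 - α ^ 2)) ≤ 1 / (1 - α ^ 2) * cos x := by
    have := mul_le_mul_of_nonneg_left (neg_one_le_cos x) (by positivity : 0 ≤ 1 / (1 - α ^ 2))
    linarith
  linarith

theorem contactPoint_mul_max (hα : 0 < α) {M : ℝ} (hM : M ∈ dropletMasses α) :
    contactPoint α M * max α 1 ≤ π ∧
    (contactPoint α M * max α 1 = π ↔ α < 1 ∧ M * (1 - α ^ 2) = 2 * π) := by
  obtain ⟨ht, hm⟩ := contactPoint_spec hα hM
  rcases lt_or_ge α 1 with h1 | h1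
  · rw [max_eq_right h1.le, mul_one]
    have h4 : 0 < 1 - α ^ 2 := by nlinarith
    have hπ := pi_mem_contactSet h1
    refine ⟨ht.2.1, ⟨fun h => ⟨h1, ?_⟩, fun h => ?_⟩⟩
    · rw [h, dropletMass_pi h1] at hm
      rw [← hm]
      field_simp
    · refine (strictMonoOn_dropletMass hα).injOn ht hπ ?_
      rw [hm, dropletMass_pi h1, eq_div_iff h4.ne', h.2]
  · rw [max_eq_left h1, mul_comm]
    exact ⟨ht.2.2.le, ⟨fun h => absurd h ht.2.2.ne, fun h => absurd h.1 (not_lt.2 h1)⟩⟩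

theorem minimizer_droplet_regime (hα : 0 < α) {M : ℝ} (hM : M ∈ dropletMasses α) :
    (∀ x, |x| < contactPoint α M →
      0 < minimizer α M x ∧ minimizer α M x = dropletProfile α (contactPoint α M) x) ∧
    (∀ x, contactPoint α M ≤ |x| → |x| ≤ π → minimizer α M x = 0) ∧
    ∀ x, |x| = contactPoint α M → deriv (minimizer α M) x = 0 := by
  have ht := contactPoint_mem hα hM.1
  have he := excessHeight_of_mem hα hM
  refine ⟨fun x hx => ?_, fun x hx hxπ => ?_, fun x hx => ?_⟩
  · rw [minimizer_of_le hα hM.1 hx.le, he, add_zero]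
    exact ⟨dropletProfile_pos hα ht hx, rfl⟩
  · rw [minimizer_of_ge hα hM.1 hx hxπ, he]
  · rw [deriv_minimizer, profileSlope_of_ge hα ht hx.ge (hx.trans_le ht.2.1)]

end Profile

/-! ### Continuous dependence on the mass -/

section Family

variable {α : ℝ}

/-- In `L^p` with `p < ∞`, uniformly bounded functions that converge almost everywhere to `0`
converge to `0`. -/
theorem tendsto_eLpNorm_zero_of_bounded {F : ℝ → ℝ → ℝ} {M₀ K : ℝ} {p : ℝ≥0∞} (hp : p ≠ ⊤)
    (hmeas : ∀ M, Measurable (F M)) (hK : ∀ᶠ M in 𝓝 M₀, ∀ x, |F M x| ≤ K)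
    (hlim : ∀ᵐ x ∂periodMeasure, Tendsto (fun M => F M x) (𝓝 M₀) (𝓝 0)) :
    Tendsto (fun M => eLpNorm (F M) p periodMeasure) (𝓝 M₀) (𝓝 0) := by
  rcases eq_or_ne p 0 with rfl | hp0
  · simp
  have hr : 0 < p.toReal := ENNReal.toReal_pos hp0 hp
  have hfin : periodMeasure univ ≠ ⊤ := by simp [periodMeasure]
  have h := tendsto_lintegral_filter_of_dominated_convergence (μ := periodMeasure) (l := 𝓝 M₀)
    (F := fun M x => ‖F M x‖ₑ ^ p.toReal) (f := fun _ => 0)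
    (fun _ => ENNReal.ofReal K ^ p.toReal)
    (Eventually.of_forall fun M => (hmeas M).enorm.pow_const _)
    (hK.mono fun M hM => ae_of_all _ fun x => ENNReal.rpow_le_rpow (by
      rw [← ofReal_norm]
      exact ENNReal.ofReal_le_ofReal (hM x)) hr.le)
    (by
      rw [lintegral_const]
      exact ENNReal.mul_ne_top (ENNReal.rpow_ne_top_of_nonneg hr.le ENNReal.ofReal_ne_top) hfin)
    (hlim.mono fun x hx => by
      have := (hx.enorm).ennrpow_const p.toReal
      simpa [hr] using this)
  rw [lintegral_zero] at h
  have h2 := h.ennrpow_const (1 / p.toReal)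
  rw [ENNReal.zero_rpow_of_pos (by positivity)] at h2
  refine h2.congr fun M => ?_
  rw [eLpNorm_eq_lintegral_rpow_enorm_toReal hp0 hp]

theorem tendsto_coeffA_contactPoint (hα : 0 < α) {M₀ : ℝ} (hM₀ : 0 < M₀) :
    Tendsto (fun M => coeffA α (contactPoint α M)) (𝓝 M₀) (𝓝 (coeffA α (contactPoint α M₀))) :=
  (hasDerivAt_coeffA hα
    (sin_pos_of_contact hα (contactPoint_mem hα hM₀)).ne').continuousAt.tendsto.comp
    (continuousAt_contactPoint hα hM₀)

theorem exists_profileCurv_bound_nhds (hα : 0 < α) {M₀ : ℝ} (hM₀ : 0 < M₀) :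
    ∃ K : ℝ≥0, ∀ᶠ M in 𝓝 M₀, ∀ x, |profileCurv α (contactPoint α M) x| ≤ K := by
  obtain ⟨B, hB0, hB⟩ := exists_profileCurv_bound α
  refine ⟨⟨B + (|coeffA α (contactPoint α M₀)| + 1) * α ^ 2, by positivity⟩, ?_⟩
  have h := (tendsto_coeffA_contactPoint hα hM₀).abs.eventually (gt_mem_nhds (lt_add_one _))
  filter_upwards [h] with M hM x
  refine (hB _ x).trans ?_
  have := mul_le_mul_of_nonneg_right (le_of_lt hM) (sq_nonneg α)
  exact add_le_add_right this B

/-- The second derivatives converge pointwise away from the contact points, across which they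
jump. -/
theorem tendsto_profileCurv (hα : 0 < α) {M₀ x : ℝ} (hM₀ : 0 < M₀)
    (hx : foldAngle x ≠ contactPoint α M₀) :
    Tendsto (fun M => profileCurv α (contactPoint α M) x) (𝓝 M₀)
      (𝓝 (profileCurv α (contactPoint α M₀) x)) := by
  have hT := continuousAt_contactPoint hα hM₀
  rcases lt_or_gt_of_ne hx with h | h
  · have hc : Tendsto (fun M => dropletCurv α (contactPoint α M) (foldAngle x)) (𝓝 M₀)
        (𝓝 (dropletCurv α (contactPoint α M₀) (foldAngle x))) :=
      ((tendsto_coeffA_contactPoint hα hM₀).mul_const _).const_sub _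
    rw [profileCurv, if_pos h.le]
    refine hc.congr' ?_
    filter_upwards [hT.eventually (lt_mem_nhds h)] with M hM
    rw [profileCurv, if_pos (le_of_lt hM)]
  · rw [profileCurv, if_neg (not_le.2 h)]
    refine tendsto_const_nhds.congr' ?_
    filter_upwards [hT.eventually (gt_mem_nhds h)] with M hM
    rw [profileCurv, if_neg (not_le.2 hM)]

theorem ae_foldAngle_ne (t : ℝ) : ∀ᵐ x ∂periodMeasure, foldAngle x ≠ t := by
  have h : ∀ᵐ x : ℝ, x ∉ ({t, -t} : Set ℝ) :=
    measure_eq_zero_iff_ae_notMem.1 ((Set.toFinite _).measure_zero volume)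
  rw [periodMeasure, ae_restrict_iff' measurableSet_Ioc]
  filter_upwards [h] with x hx hxπ heq
  rw [foldAngle_eq_abs (abs_le.2 ⟨hxπ.1.le, hxπ.2⟩)] at heq
  refine hx ?_
  rcases abs_choice x with h | h
  · exact Or.inl (by linarith)
  · exact Or.inr (by show x = -t; linarith)

theorem ae_tendsto_profileCurv_sub (hα : 0 < α) {M₀ : ℝ} (hM₀ : 0 < M₀) :
    ∀ᵐ x ∂periodMeasure, Tendsto (fun M => profileCurv α (contactPoint α M) x
      - profileCurv α (contactPoint α M₀) x) (𝓝 M₀) (𝓝 0) := by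
  filter_upwards [ae_foldAngle_ne (contactPoint α M₀)] with x hx
  simpa using (tendsto_profileCurv hα hM₀ hx).sub_const (profileCurv α (contactPoint α M₀) x)

theorem deriv_deriv_minimizer_ae (α M : ℝ) :
    deriv (deriv (minimizer α M)) =ᵐ[periodMeasure] profileCurv α (contactPoint α M) := by
  have hloc : LocallyIntegrable (profileCurv α (contactPoint α M)) volume := by
    obtain ⟨B, -, hB⟩ := exists_profileCurv_bound α
    exact (locallyIntegrable_const (B + |coeffA α (contactPoint α M)| * α ^ 2)).mono
      (measurable_profileCurv α _).aestronglyMeasurable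
      (ae_of_all _ fun x => (hB _ x).trans (le_abs_self _))
  refine ae_restrict_of_ae ?_
  filter_upwards [LocallyIntegrable.ae_hasDerivAt_integral hloc] with x hx
  rw [deriv_minimizer]
  exact (hx 0).deriv

/-- The `L¹` distance of the second derivatives of the minimizers of masses `M` and `M₀`. -/
noncomputable def curvGap (α M₀ M : ℝ) : ℝ :=
  ∫ x in (-π)..π, |profileCurv α (contactPoint α M) x - profileCurv α (contactPoint α M₀) x|

theorem tendsto_curvGap (hα : 0 < α) {M₀ : ℝ} (hM₀ : 0 < M₀) :
    Tendsto (curvGap α M₀) (𝓝 M₀) (𝓝 0) := by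
  obtain ⟨K, hK⟩ := exists_profileCurv_bound_nhds hα hM₀
  have hπ : (-π : ℝ) ≤ π := by linarith [Real.pi_pos]
  have h := intervalIntegral.tendsto_integral_filter_of_dominated_convergence (μ := volume)
    (a := -π) (b := π) (l := 𝓝 M₀)
    (F := fun M x =>
      |profileCurv α (contactPoint α M) x - profileCurv α (contactPoint α M₀) x|)
    (f := fun _ => 0) (fun _ => (K : ℝ) + K)
    (Eventually.of_forall fun M => ((measurable_profileCurv α _).sub
      (measurable_profileCurv α _)).abs.aestronglyMeasurable)
    (hK.mono fun M hM => ae_of_all _ fun x _ => by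
      rw [Real.norm_eq_abs, abs_abs]
      exact (abs_sub _ _).trans (add_le_add (hM x) (hK.self_of_nhds x)))
    intervalIntegrable_const ?_
  · rw [intervalIntegral.integral_zero] at h
    exact h
  · have := ae_tendsto_profileCurv_sub hα hM₀
    rw [periodMeasure, ae_restrict_iff' measurableSet_Ioc] at this
    filter_upwards [this] with x hx hxπ
    rw [uIoc_of_le hπ] at hxπ
    simpa using (hx hxπ).abs

theorem abs_profileSlope_sub_le (hα : 0 < α) {M M₀ : ℝ} (hM : 0 < M) (hM₀ : 0 < M₀) (x : ℝ) :
    |profileSlope α (contactPoint α M) x - profileSlope α (contactPoint α M₀) x|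
      ≤ curvGap α M₀ M := by
  have hper : Function.Periodic (fun x => profileSlope α (contactPoint α M) x
      - profileSlope α (contactPoint α M₀) x) (2 * π) :=
    (profileSlope_periodic hα (contactPoint_mem hα hM)).sub
      (profileSlope_periodic hα (contactPoint_mem hα hM₀))
  obtain ⟨y, hy, hxy⟩ := hper.exists_mem_Ioc two_pi_pos x (-π)
  refine (congrArg abs hxy).trans_le ?_
  show |_ - _| ≤ _
  have hy2 : y ≤ π := by linarith [hy.2]
  have hint : ∀ a b, IntervalIntegrable (fun x => |profileCurv α (contactPoint α M) x
      - profileCurv α (contactPoint α M₀) x|) volume a b := fun a b =>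
    ((intervalIntegrable_profileCurv α _ a b).sub (intervalIntegrable_profileCurv α _ a b)).abs
  have hπ : (-π : ℝ) ≤ π := by linarith [Real.pi_pos]
  rw [profileSlope, profileSlope, ← intervalIntegral.integral_sub
    (intervalIntegrable_profileCurv α _ _ _) (intervalIntegrable_profileCurv α _ _ _)]
  rw [← Real.norm_eq_abs]
  refine intervalIntegral.norm_integral_le_integral_norm_uIoc.trans ?_
  rw [curvGap, intervalIntegral.integral_of_le hπ]
  refine setIntegral_mono_set ((intervalIntegrable_iff_integrableOn_Ioc_of_le hπ).1 (hint _ _))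
    (ae_of_all _ fun x => abs_nonneg _) (LE.le.eventuallyLE ?_)
  intro z hz
  rw [mem_uIoc] at hz
  rcases hz with hz | hz
  · exact ⟨by linarith [Real.pi_pos], hz.2.trans hy2⟩
  · exact ⟨hy.1.trans hz.1, by linarith [Real.pi_pos]⟩

theorem abs_minimizer_sub_le (hα : 0 < α) {M M₀ : ℝ} (hM : 0 < M) (hM₀ : 0 < M₀) (x : ℝ) :
    |minimizer α M x - minimizer α M₀ x| ≤ |M - M₀| / (2 * π) + 2 * π * curvGap α M₀ M := by
  have hπ := Real.pi_pos
  set δ := curvGap α M₀ M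
  set w := fun x => profileShape α (contactPoint α M) x - profileShape α (contactPoint α M₀) x
    with hw
  have hper : Function.Periodic (fun x => minimizer α M x - minimizer α M₀ x) (2 * π) :=
    (minimizer_periodic hα hM).sub (minimizer_periodic hα hM₀)
  obtain ⟨y, hy, hxy⟩ := hper.exists_mem_Ioc two_pi_pos x (-π)
  refine (congrArg abs hxy).trans_le ?_
  show |_ - _| ≤ _
  have hbound : ∀ z, |z| ≤ π → |w z| ≤ π * δ := by
    intro z hz
    have h1 : w z = ∫ s in (0 : ℝ)..z, (profileSlope α (contactPoint α M) s
        - profileSlope α (contactPoint α M₀) s) :=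
      (intervalIntegral.integral_sub ((continuous_profileSlope α _).intervalIntegrable _ _)
        ((continuous_profileSlope α _).intervalIntegrable _ _)).symm
    have h2 := intervalIntegral.norm_integral_le_of_norm_le_const (a := 0) (b := z)
      (f := fun s => profileSlope α (contactPoint α M) s
        - profileSlope α (contactPoint α M₀) s) (C := δ)
      fun s _ => abs_profileSlope_sub_le hα hM hM₀ s
    rw [← h1, sub_zero, Real.norm_eq_abs] at h2
    have hδ : 0 ≤ δ := (abs_nonneg _).trans (abs_profileSlope_sub_le hα hM hM₀ 0)
    nlinarith
  have hint : ∀ t, IntervalIntegrable (profileShape α t) volume (-π) π := fun t =>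
    (continuous_profileShape α t).intervalIntegrable _ _
  have hI : |∫ s in (-π)..π, w s| ≤ π * δ * (2 * π) := by
    have := intervalIntegral.norm_integral_le_of_norm_le_const (a := -π) (b := π) (f := w)
      (C := π * δ) fun s hs => by
        rw [uIoc_of_le (by linarith)] at hs
        exact hbound s (abs_le.2 ⟨hs.1.le, hs.2⟩)
    rwa [show |π - -π| = 2 * π by rw [abs_of_pos (by linarith)]; ring] at this
  have hdecomp : minimizer α M y - minimizer α M₀ y
      = (M - M₀) / (2 * π) - (∫ s in (-π)..π, w s) / (2 * π) + w y := by
    rw [hw, intervalIntegral.integral_sub (hint _) (hint _), minimizer, minimizer]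
    ring
  have h1 : |(M - M₀) / (2 * π)| = |M - M₀| / (2 * π) := by
    rw [abs_div, abs_of_pos two_pi_pos]
  have h2 : |(∫ s in (-π)..π, w s) / (2 * π)| ≤ π * δ := by
    rw [abs_div, abs_of_pos two_pi_pos, div_le_iff₀ two_pi_pos]
    exact hI
  have h3 := hbound y (abs_le.2 ⟨hy.1.le, by linarith [hy.2]⟩)
  rw [hdecomp]
  have h4 := abs_add_le ((M - M₀) / (2 * π) - (∫ s in (-π)..π, w s) / (2 * π)) (w y)
  have h5 := abs_sub ((M - M₀) / (2 * π)) ((∫ s in (-π)..π, w s) / (2 * π))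
  linarith

/-- Interpolation between the uniform and the Lipschitz bound. -/
theorem le_mul_rpow_of_le_of_le {a d s β K δ : ℝ} (ha : 0 ≤ a) (hβ : 0 ≤ β) (hβ1 : β < 1)
    (hK : 0 ≤ K) (hs : 0 ≤ s) (h1 : a ≤ K * s) (h2 : a ≤ δ)
    (hd : K ^ β * δ ^ (1 - β) ≤ d) : a ≤ d * s ^ β := by
  calc a = a ^ β * a ^ (1 - β) := by
        rw [← rpow_add_of_nonneg ha hβ (by linarith)]
        simp
    _ ≤ (K * s) ^ β * δ ^ (1 - β) := by gcongr
    _ = K ^ β * δ ^ (1 - β) * s ^ β := by rw [mul_rpow hK hs]; ring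
    _ ≤ d * s ^ β := by gcongr

theorem isC11FamilyContinuousAt_minimizer (hα : 0 < α) {M₀ : ℝ} (hM₀ : 0 < M₀) :
    IsC11FamilyContinuousAt (minimizer α) M₀ := by
  obtain ⟨K, hK⟩ := exists_profileCurv_bound_nhds hα hM₀
  have hlip : ∀ᶠ M in 𝓝 M₀, LipschitzWith K (deriv (minimizer α M)) := by
    filter_upwards [hK] with M hM
    rw [deriv_minimizer]
    exact lipschitzWith_profileSlope hM
  have hgap := tendsto_curvGap hα hM₀
  have hpos : ∀ᶠ M in 𝓝 M₀, 0 < M := lt_mem_nhds hM₀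
  refine ⟨fun β hβ hβ1 ε hε => ?_, fun p hp => ?_, K, hlip⟩
  · have h1 : ∀ᶠ M in 𝓝 M₀, |M - M₀| / (2 * π) + 2 * π * curvGap α M₀ M < ε := by
      have h : Tendsto (fun M => |M - M₀| / (2 * π) + 2 * π * curvGap α M₀ M) (𝓝 M₀)
          (𝓝 (|M₀ - M₀| / (2 * π) + 2 * π * 0)) :=
        ((Continuous.tendsto (by fun_prop) M₀).div_const _).add (hgap.const_mul _)
      exact h.eventually (gt_mem_nhds (by simpa using hε))
    have h2 : ∀ᶠ M in 𝓝 M₀, (2 * (K : ℝ)) ^ β * (2 * curvGap α M₀ M) ^ (1 - β) < ε := by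
      have h : Tendsto (fun M => (2 * (K : ℝ)) ^ β * (2 * curvGap α M₀ M) ^ (1 - β)) (𝓝 M₀)
          (𝓝 ((2 * (K : ℝ)) ^ β * (2 * 0) ^ (1 - β))) :=
        ((hgap.const_mul 2).rpow_const (Or.inr (by linarith))).const_mul _
      refine h.eventually (gt_mem_nhds ?_)
      rw [mul_zero, zero_rpow (by linarith), mul_zero]
      exact hε
    filter_upwards [h1, h2, hpos, hlip, hgap.eventually (gt_mem_nhds hε)]
      with M h1 h2 hM hL h3
    simp only [deriv_minimizer] at hL ⊢
    have hq := abs_profileSlope_sub_le hα hM hM₀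
    have hL₀ := hlip.self_of_nhds
    rw [deriv_minimizer] at hL₀
    refine ⟨fun x => (abs_minimizer_sub_le hα hM hM₀ x).trans (le_of_lt h1),
      fun x => (hq x).trans (le_of_lt h3), fun x y => ?_⟩
    refine le_mul_rpow_of_le_of_le (K := 2 * K) (abs_nonneg _) hβ hβ1 (by positivity)
      (abs_nonneg _) ?_ ?_ (le_of_lt h2)
    · have e1 := hL.dist_le_mul x y
      have e2 := hL₀.dist_le_mul x y
      rw [Real.dist_eq, Real.dist_eq] at e1 e2
      rw [sub_sub_sub_comm]
      refine (abs_sub _ _).trans ?_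
      linarith
    · refine (abs_sub _ _).trans ?_
      linarith [hq x, hq y]
  · have h := tendsto_eLpNorm_zero_of_bounded (K := K + K) hp
      (F := fun M x => profileCurv α (contactPoint α M) x - profileCurv α (contactPoint α M₀) x)
      (fun M => (measurable_profileCurv α _).sub (measurable_profileCurv α _))
      (hK.mono fun M hM x => (abs_sub _ _).trans (add_le_add (hM x) (hK.self_of_nhds x)))
      (ae_tendsto_profileCurv_sub hα hM₀)
    refine h.congr fun M => eLpNorm_congr_ae ?_
    filter_upwards [deriv_deriv_minimizer_ae α M, deriv_deriv_minimizer_ae α M₀] with x e1 e2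
    rw [e1, e2]

end Family

end ThinFilm

theorem theorem2p4 (α : ℝ) (hα : 0 < α) :
    ∃ (u : ℝ → ℝ → ℝ) (τ : ℝ → ℝ),
      -- existence and uniqueness of the minimizer `u M` of mass `M`
      (∀ M, 0 < M → ThinFilm.IsEnergyMinimizer α M (u M) ∧
        ∀ v, ThinFilm.IsEnergyMinimizer α M v → v =ᵐ[ThinFilm.periodMeasure] u M) ∧
      -- shape and regularity
      (∀ M, 0 < M → (∀ x, 0 ≤ u M x) ∧
        ThinFilm.IsStrictlySymmetricDecreasing (u M) ∧ ThinFilm.IsC11 (u M)) ∧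
      -- continuity and monotonicity in the mass
      (∀ M, 0 < M → ThinFilm.IsC11FamilyContinuousAt u M) ∧
      (∀ M₁ M₂, 0 < M₁ → M₁ < M₂ → ∀ x, 0 < u M₁ x → u M₁ x < u M₂ x) ∧
      -- the strictly positive regime
      (∀ M, 0 < M → α < 1 → 2 * π < M * (1 - α ^ 2) →
        ∀ x, 0 < u M x ∧ u M x = M / (2 * π) + 1 / (1 - α ^ 2) * cos x) ∧
      -- the droplet regime
      (∀ M ∈ ThinFilm.dropletMasses α,
        0 < τ M ∧ τ M * max α 1 ≤ π ∧
        (τ M * max α 1 = π ↔ α < 1 ∧ M * (1 - α ^ 2) = 2 * π) ∧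
        (∀ x, |x| < τ M → 0 < u M x ∧ u M x = ThinFilm.dropletProfile α (τ M) x) ∧
        (∀ x, τ M ≤ |x| → |x| ≤ π → u M x = 0) ∧
        deriv (u M) (τ M) = 0 ∧ deriv (u M) (-τ M) = 0) ∧
      -- the contact point as a function of the mass
      ContDiffOn ℝ ∞ τ (ThinFilm.dropletMasses α) ∧
      StrictMonoOn τ (ThinFilm.dropletMasses α) := by
  open ThinFilm in
  exact ⟨minimizer α, contactPoint α, fun M hM => isEnergyMinimizer_minimizer hα hM,
    fun M hM => ⟨minimizer_nonneg hα hM, isStrictlySymmetricDecreasing_minimizer hα hM,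
      isC11_minimizer α M⟩,
    fun M hM => isC11FamilyContinuousAt_minimizer hα hM,
    fun M₁ M₂ h₁ h x hx => minimizer_lt hα h₁ h hx,
    fun M hM h1 h2 x => minimizer_strictly_positive_regime hα hM h1 h2 x,
    fun M hM =>
      have ht := (contactPoint_mem hα hM.1).1
      have hmax := contactPoint_mul_max hα hM
      have ⟨hpos, hzero, hderiv⟩ := minimizer_droplet_regime hα hM
      ⟨ht, hmax.1, hmax.2, hpos, hzero, hderiv _ (abs_of_pos ht),
        hderiv _ (by rw [abs_neg, abs_of_pos ht])⟩,
    contDiffOn_contactPoint hα, strictMonoOn_contactPoint hα⟩
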